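/- Let $K$ be an algebraically closed field of characteristic $2$. For a shearing vector $\underline N=(N_1,\dots,N_m)$ with $1\le N_i\le\infty$, let $\mathcal O(m;\underline N)$ be the divided power algebra with basis $u^{(r)}=\prod_i u_i^{(r_i)}$, $0\le r_i<2^{N_i}$, multiplication $u^{(r)}u^{(s)}=\prod_i\binom{r_i+s_i}{r_i}\,u^{(r+s)}$, and distinguished derivations $\partial_{u_i}$, $\partial_{u_i}u_j^{(k)}=\delta_{ij}u_j^{(k-1)}$. Let $\mathfrak{vect}(m;\underline N)=\{\sum f_i\partial_{u_i}: f_i\in\mathcal O(m;\underline N)\}$ and $\mathfrak{svect}(m;\underline N)=\{\sum f_i\partial_{u_i}:\sum\partial_{u_i}f_i=0\}$. We put $\partial_i=\partial_{u_i}$. Let $\underline N=(N_1,\dots,N_5)$ be any shearing vector with $1\le N_i\le\infty$. Consider $11$ indeterminates $u_1,u_2,u_3,u_4=\chi_1,u_5=\chi_2,\eta_1,\eta_2,\eta_3,\xi_1,\xi_2,\xi_3$, all regarded as even, with shearing vector equal to $\underline N$ on $u_1,\dots,u_5$ and to $1$ on the $\eta_i,\xi_i$. For every cyclic permutation $(i,j,k)$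 of $(1,2,3)$ put $$Y_{\xi_i}=\partial_{\xi_i},\qquad Y_{\eta_i}=\partial_{\eta_i}+\xi_k\partial_{u_j}-\xi_j\partial_{u_k}+(\xi_k\eta_j-\xi_j\eta_k)\partial_{\chi_1}-\xi_j\xi_k\partial_{\chi_2}.$$ The desuperization $\mathbf F(\mathfrak{mb}(3;\underline N|8))$ is the Lie algebra of those vector fields in these $11$ indeterminates that preserve the distribution (the module over the functions) spanned by the $Y_{\xi_i}$ and $Y_{\eta_i}$. For a field $X=\sum_i(g_{u_i}\partial_{u_i}+g_{\eta_i}\partial_{\eta_i}+g_{\xi_i}\partial_{\xi_i})+g_{\chi_1}\partial_{\chi_1}+g_{\chi_2}\partial_{\chi_2}$ in it (sums over $i=1,2,3$), set $$F_1=g_{\chi_1}-\sum_i g_{u_i}\eta_i,\qquad F_2=g_{\chi_2}-\sum_i g_{u_i}\xi_i-\sum_{(i,j,k)\text{ cyclic}} g_{\eta_i}\xi_j\xi_k,$$ and let $f=(f_1,\dots,f_5)$, a tuple of functions of $u_1,\dots,u_5$, be given as follows: $f_i$ ($i=1,2,3$) is the coefficient of $\eta_i$ in $F_1$, that is, the value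 of $\partial_{\eta_i}F_1$ at $\eta=\xi=0$, while $f_4$ and $f_5$ are the values of $F_1$ and $F_2$ at $\eta=\xi=0$. Write $X=X^f$ and $D^f=\sum_{i=1}^5 f_i\partial_{u_i}$. For $D^f,D^g\in\mathfrak{svect}(5;\underline N)$ put $$c(D^f,D^g)=\sum_{(i,j,k)\in S_3}\left(\partial_i f_4\,\partial_j g_5+\partial_i f_5\,\partial_j g_4\right)\partial_k ,$$ where the sum runs over all permutations of $(1,2,3)$. Let $\mathbf F(\mathfrak{kle})=\mathfrak{svect}(5;\underline N)\oplus d\Omega^1(5;\underline N)$, where $d\Omega^1$ is the space of exact differential $2$-forms, be the Lie algebra with the usual bracket on $\mathfrak{svect}(5;\underline N)$, the bracket $[D,\omega]=L_D\omega$ (Lie derivative), and the bracket of two forms $\omega,\omega'\in d\Omega^1$ equal to the divergence-free vector field which corresponds to $(\omega\wedge\omega')/\mathrm{vol}$. Put $Z_i(D)=du_i\wedge df_i$ for $D=\sum f_i\partial_{u_i}$, and $\psi(D)=D+Z_4(D)+Z_5(D)$. Then, for every $\underline N$ as above: 1. The map $\varphi: X^f\mapsto D^f$ is a linear bijection from $\mathbf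 F(\mathfrak{mb}(3;\underline N|8))$ onto $\mathfrak{svect}(5;\underline N)$. 2. $\varphi([X^f,X^g])=[D^f,D^g]+c(D^f,D^g)$ for all $X^f,X^g$; the map $c$ is a $2$-cocycle of $\mathfrak{svect}(5;\underline N)$ with coefficients in the adjoint module, and it is not a coboundary. 3. The linear map $\psi:\mathfrak{svect}(5;\underline N)\to\mathbf F(\mathfrak{kle})$ is injective, and $[\psi(D),\psi(E)]=\psi([D,E]+c(D,E))$ for all $D,E\in\mathfrak{svect}(5;\underline N)$; thus $\psi\circ\varphi$ is an injective homomorphism of Lie algebras $\mathbf F(\mathfrak{mb}(3;\underline N|8))\to\mathbf F(\mathfrak{kle})$. Moreover, for $\underline N=\underline N_\infty=(\infty,\dots,\infty)$: 4. $\mathbf F(\mathfrak{mb}(3;\underline N_\infty|8))$ has no maximal subalgebra of codimension $5$, whereas $\mathfrak{svect}(5;\underline N_\infty)$ has one. Hence these two Lie algebras are not isomorphic, and $\mathbf F(\mathfrak{mb}(3;\underline N_\infty|8))$ is a true deform of $\mathfrak{svect}(5;\underline N_\infty)$: the cocycle $c$ is not a coboundary, and the deformed algebra is not isomorphic to the initial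 one. -/

import Mathlib

namespace CharTwo5

noncomputable section

/-- Divided power polynomials over `K` in indeterminates indexed by `ι` (all exponents allowed):
`f` stands for `∑ r, f r • u^(r)` with `u^(r) = ∏ i, u_i^(r i)`. -/
def DivPow (K ι : Type*) [Field K] : Type _ := (ι → ℕ) →₀ K

namespace DivPow

variable {K ι : Type*} [Field K]

instance : AddCommGroup (DivPow K ι) := inferInstanceAs (AddCommGroup ((ι → ℕ) →₀ K))

instance : Module K (DivPow K ι) := inferInstanceAs (Module K ((ι → ℕ) →₀ K))

/-- The coefficient of `u^(r)`. -/
def coeff (r : ι → ℕ) : DivPow K ι →ₗ[K] K := Finsupp.lapply r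

/-- The divided monomial `u^(r)`. -/
def mon (r : ι → ℕ) : DivPow K ι := Finsupp.single r (1 : K)

/-- Linear maps out of the divided power algebra, by their values on divided monomials. -/
def lift {M : Type*} [AddCommGroup M] [Module K M] (v : (ι → ℕ) → M) : DivPow K ι →ₗ[K] M :=
  Finsupp.linearCombination K v

theorem lift_mon {M : Type*} [AddCommGroup M] [Module K M] (v : (ι → ℕ) → M) (r : ι → ℕ) :
    lift v (mon r : DivPow K ι) = v r := by
  exact (Finsupp.linearCombination_single K (1 : K) r).trans (one_smul K (v r))

theorem coeff_mon [DecidableEq (ι → ℕ)] (r s : ι → ℕ) :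
    coeff s (mon r : DivPow K ι) = if r = s then 1 else 0 := by
  simp only [coeff, mon]
  exact Finsupp.single_apply

theorem hom_ext {M : Type*} [AddCommGroup M] [Module K M] {f g : DivPow K ι →ₗ[K] M}
    (h : ∀ r, f (mon r) = g (mon r)) : f = g :=
  Finsupp.lhom_ext' fun r => LinearMap.ext_ring (h r)

theorem span_mon : Submodule.span K (Set.range (mon : (ι → ℕ) → DivPow K ι)) = ⊤ := by
  rw [eq_top_iff]
  intro f _
  have h : f = Finsupp.linearCombination K (mon : (ι → ℕ) → DivPow K ι) f := by
    have : (LinearMap.id : DivPow K ι →ₗ[K] DivPow K ι) = lift mon := hom_ext fun r => by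
      rw [lift_mon]; rfl
    exact LinearMap.congr_fun this f
  rw [h]
  exact (Finsupp.mem_span_range_iff_exists_finsupp).2 ⟨f, rfl⟩

variable [Fintype ι]

/-- The multiplication: `u^(r) * u^(s) = ∏ i, (r i + s i choose r i) • u^(r + s)`. -/
def mulHom : DivPow K ι →ₗ[K] DivPow K ι →ₗ[K] DivPow K ι :=
  lift fun r => lift fun s => ((∏ i, (r i + s i).choose (r i) : ℕ) : K) • mon (r + s)

instance : Mul (DivPow K ι) := ⟨fun f g => mulHom f g⟩

instance : One (DivPow K ι) := ⟨mon 0⟩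

theorem mul_def (f g : DivPow K ι) : f * g = mulHom f g := rfl

theorem one_def : (1 : DivPow K ι) = mon 0 := rfl

theorem mon_mul_mon (r s : ι → ℕ) : (mon r * mon s : DivPow K ι) =
    ((∏ i, (r i + s i).choose (r i) : ℕ) : K) • mon (r + s) := by
  rw [mul_def, mulHom, lift_mon, lift_mon]

theorem mul_comm' (f g : DivPow K ι) : f * g = g * f := by
  have : (mulHom : DivPow K ι →ₗ[K] _) = mulHom.flip := by
    refine hom_ext fun r => hom_ext fun s => ?_
    change mon r * mon s = mon s * mon r
    rw [mon_mul_mon, mon_mul_mon, add_comm s r]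
    congr 2
    refine Finset.prod_congr rfl fun i _ => ?_
    rw [add_comm (s i), ← Nat.choose_symm_add]
  exact LinearMap.congr_fun (LinearMap.congr_fun this f) g

theorem one_mul' (f : DivPow K ι) : 1 * f = f := by
  have : mulHom (1 : DivPow K ι) = LinearMap.id := by
    refine hom_ext fun r => ?_
    change mon 0 * mon r = mon r
    rw [mon_mul_mon]
    simp
  exact LinearMap.congr_fun this f

theorem choose_assoc (a b c : ℕ) : (a + b).choose a * (a + b + c).choose (a + b) =
    (b + c).choose b * (a + (b + c)).choose a := by
  have h := Nat.choose_mul (n := a + b + c) (k := a + b) (s := a) (by omega)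
  rw [mul_comm, h, mul_comm, show a + b + c - a = b + c by omega, show a + b - a = b by omega,
    add_assoc]

theorem mul_assoc' (f g h : DivPow K ι) : f * g * h = f * (g * h) := by
  have key : ∀ r s t : ι → ℕ, (mon r * mon s * mon t : DivPow K ι) = mon r * (mon s * mon t) := by
    intro r s t
    rw [mon_mul_mon, mon_mul_mon, mul_def, map_smul, LinearMap.smul_apply, ← mul_def, mon_mul_mon,
      mul_def (mon r), map_smul, ← mul_def, mon_mul_mon, smul_smul, smul_smul, add_assoc]
    congr 1
    rw [← Nat.cast_mul, ← Nat.cast_mul, ← Finset.prod_mul_distrib, ← Finset.prod_mul_distrib]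
    congr 1
    exact Finset.prod_congr rfl fun i _ => choose_assoc _ _ _
  have h1 : ∀ r s, mulHom (mon r * mon s : DivPow K ι) =
      (mulHom (mon r)).comp (mulHom (mon s)) := fun r s => hom_ext fun t => key r s t
  have h2 : ∀ r, mulHom.comp (mulHom (mon r : DivPow K ι)) =
      (LinearMap.llcomp K _ _ _ (mulHom (mon r))).comp mulHom := fun r => hom_ext fun s => h1 r s
  have h3 : mulHom.compr₂ (mulHom (K := K) (ι := ι)) =
      (LinearMap.lcomp K _ mulHom).comp ((LinearMap.llcomp K _ _ _).comp mulHom) :=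
    hom_ext fun r => h2 r
  exact LinearMap.congr_fun (LinearMap.congr_fun (LinearMap.congr_fun h3 f) g) h

instance : CommRing (DivPow K ι) where
  __ := (inferInstance : AddCommGroup (DivPow K ι))
  mul := (· * ·)
  one := 1
  mul_assoc := mul_assoc'
  one_mul := one_mul'
  mul_one f := by rw [mul_comm', one_mul']
  left_distrib f g h := map_add (mulHom f) g h
  right_distrib f g h := by rw [mul_def, map_add]; rfl
  zero_mul f := by rw [mul_def, map_zero]; rfl
  mul_zero f := map_zero (mulHom f)
  mul_comm := mul_comm'

instance : Algebra K (DivPow K ι) :=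
  Algebra.ofModule (fun a f g => by rw [mul_def, map_smul]; rfl) (fun a f g => map_smul (mulHom f) a g)

variable [DecidableEq ι]

/-- The linear map `u^(r) ↦ u^(r - e_i)`, read as `0` if `r i = 0`. -/
def pdHom (i : ι) : DivPow K ι →ₗ[K] DivPow K ι :=
  lift fun r => if r i = 0 then 0 else mon (r - Pi.single i 1)

theorem pdHom_mon (i : ι) (r : ι → ℕ) : pdHom i (mon r : DivPow K ι) =
    if r i = 0 then 0 else mon (r - Pi.single i 1) := lift_mon _ _

theorem pd_leibniz_mon (i : ι) (r s : ι → ℕ) : pdHom i (mon r * mon s : DivPow K ι) =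
    mon r * pdHom i (mon s) + mon s * pdHom i (mon r) := by
  have hsplit : ∀ r s : ι → ℕ, (∏ j, (r j + s j).choose (r j)) =
      (r i + s i).choose (r i) * ∏ j ∈ Finset.univ.erase i, (r j + s j).choose (r j) :=
    fun r s => (Finset.mul_prod_erase _ _ (Finset.mem_univ i)).symm
  have hoff : ∀ r s : ι → ℕ, ∏ j ∈ Finset.univ.erase i,
      (r j + (s - Pi.single i 1 : ι → ℕ) j).choose (r j) =
      ∏ j ∈ Finset.univ.erase i, (r j + s j).choose (r j) := by
    intro r s
    refine Finset.prod_congr rfl fun j hj => ?_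
    simp [Pi.single_eq_of_ne (Finset.ne_of_mem_erase hj)]
  have hadd : ∀ r s : ι → ℕ, s i ≠ 0 → r + (s - Pi.single i 1) = r + s - Pi.single i 1 := by
    intro r s h
    funext j
    by_cases hj : j = i
    · subst hj; simp; omega
    · simp [Pi.single_eq_of_ne hj]
  have hterm : ∀ r s : ι → ℕ, (mon r * pdHom i (mon s) : DivPow K ι) =
      (((if s i = 0 then 0 else (r i + (s i - 1)).choose (r i)) *
        ∏ j ∈ Finset.univ.erase i, (r j + s j).choose (r j) : ℕ) : K) •
        mon (r + s - Pi.single i 1) := by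
    intro r s
    rw [pdHom_mon]
    split_ifs with h
    · rw [mul_def, map_zero]; simp
    · rw [mon_mul_mon, hadd r s h, hsplit, hoff]
      simp
  rw [hterm, hterm, mon_mul_mon, map_smul, pdHom_mon, add_comm s r, ← add_smul, hsplit]
  have hsymm : ∏ j ∈ Finset.univ.erase i, (s j + r j).choose (s j) =
      ∏ j ∈ Finset.univ.erase i, (r j + s j).choose (r j) :=
    Finset.prod_congr rfl fun j _ => by rw [add_comm (s j), ← Nat.choose_symm_add]
  rw [hsymm, ← Nat.cast_add, ← add_mul]
  have hpas : ∀ a b : ℕ, a + b ≠ 0 → (a + b).choose a =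
      (if b = 0 then 0 else (a + (b - 1)).choose a) +
      (if a = 0 then 0 else (b + (a - 1)).choose b) := by
    intro a b h
    rcases a with _ | a
    · rcases b with _ | b
      · simp at h
      · simp
    · rcases b with _ | b
      · simp
      · have e := Nat.choose_symm_add (a := a) (b := b + 1)
        have e1 : a + 1 + (b + 1) = (a + (b + 1)) + 1 := by ring
        rw [e1, Nat.choose_succ_succ', e]
        simp only [Nat.add_eq_zero_iff, one_ne_zero, and_false, if_false, Nat.add_sub_cancel]
        rw [show a + 1 + b = a + (b + 1) by ring, show b + 1 + a = a + (b + 1) by ring]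
        ring
  by_cases h : r i + s i = 0
  · have h1 : r i = 0 := by omega
    have h2 : s i = 0 := by omega
    simp [h1, h2]
  · rw [hpas _ _ h, if_neg (show ¬ (r + s) i = 0 from h)]

/-- The distinguished partial derivative `∂_i`, with `∂_i (u_j^(k)) = δ_ij u_j^(k-1)`. -/
def pd (i : ι) : Derivation K (DivPow K ι) (DivPow K ι) :=
  Derivation.mk' (pdHom i) fun f g => by
    have h : mulHom.compr₂ (pdHom i : DivPow K ι →ₗ[K] _) =
        mulHom.compl₂ (pdHom i) + (mulHom.compl₂ (pdHom i)).flip :=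
      hom_ext fun r => hom_ext fun s => pd_leibniz_mon i r s
    exact LinearMap.congr_fun (LinearMap.congr_fun h f) g

theorem pd_mon (i : ι) (r : ι → ℕ) : pd i (mon r : DivPow K ι) =
    if r i = 0 then 0 else mon (r - Pi.single i 1) := pdHom_mon i r

theorem pd_comm (i j : ι) (f : DivPow K ι) : pd i (pd j f) = pd j (pd i f) := by
  have h : (pdHom i : DivPow K ι →ₗ[K] DivPow K ι).comp (pdHom j) =
      (pdHom j).comp (pdHom i) := by
    refine hom_ext fun r => ?_
    change pd i (pd j (mon r)) = pd j (pd i (mon r))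
    by_cases hij : i = j
    · subst hij; rfl
    · rw [pd_mon, pd_mon]
      split_ifs with h1 h2 h2
      · simp
      · rw [map_zero, pd_mon, if_pos]
        simp [h1]
      · rw [map_zero, pd_mon, if_pos]
        simp [h2]
      · rw [pd_mon, pd_mon, if_neg, if_neg, tsub_right_comm]
        · simpa [Pi.single_eq_of_ne (Ne.symm hij)] using h1
        · simpa [Pi.single_eq_of_ne hij] using h2
  exact LinearMap.congr_fun h f

variable (K)

/-- The exponents `r` with `r i < 2 ^ N i` for all `i` (no condition at `i` if `N i = ∞`). -/
def Bounded (N : ι → WithTop ℕ+) : Set (ι → ℕ) :=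
  {r | ∀ i, ∀ n : ℕ+, N i = n → r i < 2 ^ (n : ℕ)}

theorem even_choose {n a b : ℕ} (ha : a < 2 ^ n) (hb : b < 2 ^ n) (hab : 2 ^ n ≤ a + b) :
    2 ∣ (a + b).choose a := by
  have hn : n ≠ 0 := by
    rintro rfl
    simp at ha hb
    subst ha; subst hb
    simp at hab
  refine Nat.dvd_of_factorization_pos ?_
  rw [add_comm a b, Nat.factorization_choose' Nat.prime_two (b := Nat.log 2 (b + a) + 1) (by omega)]
  refine (Finset.card_pos.2 ⟨n, ?_⟩).ne'
  rw [Finset.mem_filter, Finset.mem_Ico, Nat.mod_eq_of_lt ha, Nat.mod_eq_of_lt hb]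
  refine ⟨⟨by omega, Nat.lt_succ_of_le ?_⟩, hab⟩
  exact (Nat.le_log_iff_pow_le (by norm_num) (by omega)).2 (by omega)

variable [CharP K 2]

/-- The divided power algebra `O(N)`: the span of the `u^(r)` with `r i < 2 ^ N i`. -/
def trunc (N : ι → WithTop ℕ+) : Subalgebra K (DivPow K ι) :=
  (Submodule.span K (mon '' Bounded N)).toSubalgebra
    (Submodule.subset_span ⟨0, fun i n _ => by simp, rfl⟩)
    (fun f g hf hg => by
      induction hf using Submodule.span_induction with
      | zero => rw [zero_mul]; exact Submodule.zero_mem _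
      | add f f' _ _ h h' => rw [add_mul]; exact Submodule.add_mem _ h h'
      | smul a f _ h => rw [smul_mul_assoc]; exact Submodule.smul_mem _ _ h
      | mem f hf =>
        obtain ⟨r, hr, rfl⟩ := hf
        induction hg using Submodule.span_induction with
        | zero => rw [mul_zero]; exact Submodule.zero_mem _
        | add f f' _ _ h h' => rw [mul_add]; exact Submodule.add_mem _ h h'
        | smul a f _ h => rw [mul_smul_comm]; exact Submodule.smul_mem _ _ h
        | mem g hg =>
          obtain ⟨s, hs, rfl⟩ := hg
          rw [mon_mul_mon]
          by_cases h : r + s ∈ Bounded N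
          · exact Submodule.smul_mem _ _ (Submodule.subset_span ⟨_, h, rfl⟩)
          · simp only [Bounded, Set.mem_ofPred_eq, not_forall] at h
            obtain ⟨i, n, hN, hlt⟩ := h
            have h2 : 2 ∣ ∏ j, (r j + s j).choose (r j) :=
              (even_choose (hr i n hN) (hs i n hN) (not_lt.1 hlt)).trans
                (Finset.dvd_prod_of_mem _ (Finset.mem_univ i))
            rw [(CharP.cast_eq_zero_iff K 2 _).2 h2, zero_smul]
            exact Submodule.zero_mem _)

theorem mon_mem_trunc {N : ι → WithTop ℕ+} {r : ι → ℕ} (h : r ∈ Bounded N) :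
    (mon r : DivPow K ι) ∈ trunc K N := Submodule.subset_span ⟨r, h, rfl⟩

theorem map_trunc_le {M : Type*} [AddCommGroup M] [Module K M] {N : ι → WithTop ℕ+}
    (l : DivPow K ι →ₗ[K] M) (P : Submodule K M) (h : ∀ r ∈ Bounded N, l (mon r) ∈ P)
    {f : DivPow K ι} (hf : f ∈ trunc K N) : l f ∈ P := by
  have : Submodule.span K (mon '' Bounded N) ≤ P.comap l := by
    rw [Submodule.span_le]
    rintro _ ⟨r, hr, rfl⟩
    exact h r hr
  exact this hf

end DivPow

section Fields

variable (K : Type*) [Field K] [CharP K 2] {ι : Type*} [Fintype ι] [DecidableEq ι]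

/-- `O(N)`, the divided power algebra with shearing vector `N`. -/
def O (N : ι → WithTop ℕ+) : Type _ := ↥(DivPow.trunc K N)

instance (N : ι → WithTop ℕ+) : CommRing (O K N) := inferInstanceAs (CommRing ↥(DivPow.trunc K N))

instance (N : ι → WithTop ℕ+) : Algebra K (O K N) :=
  inferInstanceAs (Algebra K ↥(DivPow.trunc K N))

/-- The derivations of `O(N)`. -/
abbrev Der (N : ι → WithTop ℕ+) : Type _ := Derivation K (O K N) (O K N)

variable {K}
variable {N : ι → WithTop ℕ+}

/-- The inclusion of `O(N)` into the algebra of all divided power polynomials. -/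
def O.val : O K N →ₐ[K] DivPow K ι := (DivPow.trunc K N).val

theorem O.val_mem (f : O K N) : O.val f ∈ DivPow.trunc K N := Subtype.property f

theorem O.ext {f g : O K N} (h : O.val f = O.val g) : f = g := Subtype.ext h

/-- An element of `O(N)`, from a divided power polynomial that lies in `O(N)`. -/
def O.mk (f : DivPow K ι) (hf : f ∈ DivPow.trunc K N) : O K N := ⟨f, hf⟩

theorem O.val_mk (f : DivPow K ι) (hf : f ∈ DivPow.trunc K N) : O.val (O.mk f hf) = f := rfl

theorem O.induction {P : O K N → Prop}
    (hm : ∀ (r : ι → ℕ) (h : r ∈ DivPow.Bounded N), P (O.mk (DivPow.mon r) (DivPow.mon_mem_trunc K h)))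
    (ha : ∀ f g, P f → P g → P (f + g)) (hs : ∀ (a : K) f, P f → P (a • f)) (f : O K N) : P f := by
  obtain ⟨f, hf⟩ := f
  have hf' : f ∈ Submodule.span K (DivPow.mon '' DivPow.Bounded N) := hf
  induction hf' using Submodule.span_induction with
  | zero =>
    have h0 : (0 : ι → ℕ) ∈ DivPow.Bounded N := fun i n _ => by simp
    have := hs 0 _ (hm 0 h0)
    rwa [zero_smul] at this
  | add f g h1 h2 ih1 ih2 => exact ha (O.mk f h1) (O.mk g h2) (ih1 h1) (ih2 h2)
  | smul a f h ih => exact hs a (O.mk f h) (ih h)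
  | mem f h =>
    obtain ⟨r, hr, rfl⟩ := h
    exact hm r hr

theorem DivPow.pd_mem_trunc (i : ι) {f : DivPow K ι} (hf : f ∈ DivPow.trunc K N) :
    DivPow.pd i f ∈ DivPow.trunc K N := by
  refine DivPow.map_trunc_le K (DivPow.pd i).toLinearMap
    (Subalgebra.toSubmodule (DivPow.trunc K N)) (fun r hr => ?_) hf
  change DivPow.pd i (DivPow.mon r) ∈ DivPow.trunc K N
  rw [DivPow.pd_mon]
  split_ifs
  · exact Subalgebra.zero_mem _
  · refine DivPow.mon_mem_trunc K fun j n hn => lt_of_le_of_lt ?_ (hr j n hn)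
    simp

/-- The underlying linear map of `∂_i` on `O(N)`. -/
def pdLin (i : ι) : O K N →ₗ[K] O K N where
  toFun f := O.mk (DivPow.pd i (O.val f)) (DivPow.pd_mem_trunc i (O.val_mem f))
  map_add' f g := O.ext (by
    rw [O.val_mk, map_add O.val, map_add O.val, O.val_mk, O.val_mk, map_add (DivPow.pd i)])
  map_smul' a f := O.ext (by
    rw [O.val_mk, map_smul O.val, RingHom.id_apply, map_smul O.val, O.val_mk,
      Derivation.map_smul (DivPow.pd i)])

theorem pdLin_val (i : ι) (f : O K N) : O.val (pdLin i f) = DivPow.pd i (O.val f) := rfl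

/-- The distinguished partial derivative `∂_i` on `O(N)`. -/
def pd (i : ι) : Der K N :=
  Derivation.mk' (pdLin i) fun f g => O.ext (by
    rw [pdLin_val, map_mul O.val, Derivation.leibniz (DivPow.pd i), map_add O.val, smul_eq_mul,
      smul_eq_mul, smul_eq_mul, smul_eq_mul, map_mul O.val, map_mul O.val, pdLin_val, pdLin_val])

theorem pd_val (i : ι) (f : O K N) : O.val (pd i f) = DivPow.pd i (O.val f) := rfl

theorem pd_comm (i j : ι) (f : O K N) : pd i (pd j f) = pd j (pd i f) :=
  O.ext (by rw [pd_val, pd_val, pd_val, pd_val, DivPow.pd_comm])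

theorem single_mem_bounded (N : ι → WithTop ℕ+) (i : ι) :
    (Pi.single i 1 : ι → ℕ) ∈ DivPow.Bounded N := by
  intro j n _
  refine lt_of_le_of_lt ?_ (Nat.one_lt_two_pow n.ne_zero)
  by_cases h : j = i
  · subst h; simp
  · simp [Pi.single_eq_of_ne h]

/-- The indeterminate `u_i`. -/
def X (i : ι) : O K N :=
  O.mk (DivPow.mon (Pi.single i 1)) (DivPow.mon_mem_trunc K (single_mem_bounded N i))

theorem pd_X (i j : ι) : pd i (X j : O K N) = if i = j then 1 else 0 := by
  refine O.ext ?_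
  rw [pd_val, X, O.val_mk, DivPow.pd_mon]
  by_cases h : i = j
  · subst h
    rw [if_pos rfl, map_one, DivPow.one_def]
    simp
  · rw [if_pos (by simp [Pi.single_eq_of_ne h]), if_neg h, map_zero]

theorem sum_smul_pd_apply (f : ι → O K N) (a : O K N) :
    (∑ i, f i • (pd i : Der K N)) a = ∑ i, f i * pd i a := by
  have h := map_sum (Derivation.coeFnAddMonoidHom (R := K) (A := O K N) (M := O K N))
    (fun i => f i • (pd i : Der K N)) Finset.univ
  have h' := congrFun h a
  rw [Finset.sum_apply] at h'
  exact h'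

theorem sum_smul_pd_X (f : ι → O K N) (j : ι) : (∑ i, f i • (pd i : Der K N)) (X j) = f j := by
  rw [sum_smul_pd_apply]
  simp [pd_X]

variable (K N) in
/-- `vect(N)`: the Lie algebra of vector fields `∑ f_i ∂_i` with `f_i ∈ O(N)`. -/
def vect : LieSubalgebra K (Der K N) where
  carrier := {D | ∃ f : ι → O K N, D = ∑ i, f i • pd i}
  add_mem' := by
    rintro _ _ ⟨f, rfl⟩ ⟨g, rfl⟩
    exact ⟨f + g, by simp [add_smul, Finset.sum_add_distrib]⟩
  zero_mem' := ⟨0, by simp⟩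
  smul_mem' := by
    rintro a _ ⟨f, rfl⟩
    exact ⟨a • f, by simp [Finset.smul_sum]⟩
  lie_mem' := by
    rintro D E ⟨f, hf⟩ ⟨g, hg⟩
    refine ⟨fun k => D (g k) - E (f k), ?_⟩
    refine Derivation.ext fun a => ?_
    have hD : ∀ a, D a = ∑ i, f i * pd i a := fun a => by rw [hf, sum_smul_pd_apply]
    have hE : ∀ a, E a = ∑ i, g i * pd i a := fun a => by rw [hg, sum_smul_pd_apply]
    rw [sum_smul_pd_apply, Derivation.commutator_apply]
    have h1 : D (E a) = ∑ k, (D (g k) * pd k a + g k * D (pd k a)) := by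
      rw [hE a, map_sum]
      refine Finset.sum_congr rfl fun k _ => ?_
      rw [Derivation.leibniz, smul_eq_mul, smul_eq_mul]; ring
    have h2 : E (D a) = ∑ k, (E (f k) * pd k a + f k * E (pd k a)) := by
      rw [hD a, map_sum]
      refine Finset.sum_congr rfl fun k _ => ?_
      rw [Derivation.leibniz, smul_eq_mul, smul_eq_mul]; ring
    have h3 : ∑ k, g k * D (pd k a) = ∑ k, f k * E (pd k a) := by
      simp only [hD, hE, Finset.mul_sum]
      rw [Finset.sum_comm]
      refine Finset.sum_congr rfl fun k _ => Finset.sum_congr rfl fun l _ => ?_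
      rw [pd_comm k l]; ring
    rw [h1, h2, Finset.sum_add_distrib, Finset.sum_add_distrib, h3, add_sub_add_right_eq_sub,
      ← Finset.sum_sub_distrib]
    exact Finset.sum_congr rfl fun k _ => by ring

theorem vect_apply {D : Der K N} (hD : D ∈ vect K N) (a : O K N) :
    D a = ∑ i, D (X i) * pd i a := by
  obtain ⟨f, rfl⟩ := hD
  rw [sum_smul_pd_apply]
  exact Finset.sum_congr rfl fun i _ => by rw [sum_smul_pd_X]

theorem pd_vect {D : Der K N} (hD : D ∈ vect K N) (i : ι) (a : O K N) :
    pd i (D a) = D (pd i a) + ∑ k, pd i (D (X k)) * pd k a := by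
  rw [vect_apply hD a, vect_apply hD (pd i a), map_sum, ← Finset.sum_add_distrib]
  refine Finset.sum_congr rfl fun k _ => ?_
  rw [Derivation.leibniz, smul_eq_mul, smul_eq_mul, pd_comm i k]; ring

/-- The divergence `∑ ∂_i f_i` of `D = ∑ f_i ∂_i`; note `f_i = D u_i`. -/
def div (D : Der K N) : O K N := ∑ i, pd i (D (X i))

theorem div_lie {D E : Der K N} (hD : D ∈ vect K N) (hE : E ∈ vect K N) :
    div ⁅D, E⁆ = D (div E) - E (div D) := by
  have h1 : ∀ {D E : Der K N}, D ∈ vect K N → ∑ i, pd i (D (E (X i))) =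
      D (div E) + ∑ i, ∑ k, pd i (D (X k)) * pd k (E (X i)) := by
    intro D E hD
    rw [div, map_sum, ← Finset.sum_add_distrib]
    exact Finset.sum_congr rfl fun i _ => pd_vect hD i _
  have h2 : div ⁅D, E⁆ = ∑ i, pd i (D (E (X i))) - ∑ i, pd i (E (D (X i))) := by
    rw [div, ← Finset.sum_sub_distrib]
    exact Finset.sum_congr rfl fun i _ => by rw [Derivation.commutator_apply, map_sub]
  rw [h2, h1 hD, h1 hE, Finset.sum_comm]
  have h3 : ∑ y, ∑ x, pd x (D (X y)) * pd y (E (X x)) =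
      ∑ i, ∑ k, pd i (E (X k)) * pd k (D (X i)) :=
    Finset.sum_congr rfl fun i _ => Finset.sum_congr rfl fun k _ => mul_comm _ _
  rw [h3]; ring

variable (K N) in
/-- `svect(N)`: the Lie algebra of divergence-free vector fields. -/
def svect : LieSubalgebra K (Der K N) where
  carrier := {D | D ∈ vect K N ∧ div D = 0}
  add_mem' := by
    rintro D E ⟨hD, hD'⟩ ⟨hE, hE'⟩
    refine ⟨(vect K N).add_mem hD hE, ?_⟩
    have : div (D + E) = div D + div E := by simp [div, Finset.sum_add_distrib]
    rw [this, hD', hE', add_zero]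
  zero_mem' := ⟨(vect K N).zero_mem, by simp [div]⟩
  smul_mem' := by
    rintro a D ⟨hD, hD'⟩
    refine ⟨(vect K N).smul_mem a hD, ?_⟩
    have : div (a • D) = a • div D := by simp [div, Finset.smul_sum]
    rw [this, hD', smul_zero]
  lie_mem' := by
    rintro D E ⟨hD, hD'⟩ ⟨hE, hE'⟩
    exact ⟨(vect K N).lie_mem hD hE, by rw [div_lie hD hE, hD', hE', map_zero, map_zero, sub_zero]⟩

end Fields

/-! ### Dimension five -/

section Algebra5

variable {A : Type*} [CommRing A]

/-- The coefficient of `∂_m` in the vector field corresponding to the 4-form `ω ∧ ω'` divided by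
the volume form, where `du_a ∧ du_b ∧ du_c ∧ du_d` corresponds to `sign (a b c d m) ∂_m`. A 2-form is
given by its array of coefficients. -/
def wedgeCoeff (ω ω' : Fin 5 → Fin 5 → A) (m : Fin 5) : A :=
  let a := m.succAbove 0
  let b := m.succAbove 1
  let c := m.succAbove 2
  let d := m.succAbove 3
  (-1) ^ (m : ℕ) * (ω a b * ω' c d - ω a c * ω' b d + ω a d * ω' b c + ω b c * ω' a d
    - ω b d * ω' a c + ω c d * ω' a b)

theorem wedgeCoeff_comm (ω ω' : Fin 5 → Fin 5 → A) (m : Fin 5) :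
    wedgeCoeff ω ω' m = wedgeCoeff ω' ω m := by
  simp only [wedgeCoeff]; ring

theorem wedgeCoeff_self (h2 : (2 : A) = 0) (ω : Fin 5 → Fin 5 → A) (m : Fin 5) :
    wedgeCoeff ω ω m = 0 := by
  simp only [wedgeCoeff]
  linear_combination ((-1) ^ (m : ℕ) * (ω (m.succAbove 0) (m.succAbove 1) *
    ω (m.succAbove 2) (m.succAbove 3) - ω (m.succAbove 0) (m.succAbove 2) *
    ω (m.succAbove 1) (m.succAbove 3) + ω (m.succAbove 0) (m.succAbove 3) *
    ω (m.succAbove 1) (m.succAbove 2))) * h2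

theorem wedgeCoeff_values (ω ω' : Fin 5 → Fin 5 → A) :
    wedgeCoeff ω ω' 0 = ω 1 2 * ω' 3 4 - ω 1 3 * ω' 2 4 + ω 1 4 * ω' 2 3 + ω 2 3 * ω' 1 4
      - ω 2 4 * ω' 1 3 + ω 3 4 * ω' 1 2 ∧
    wedgeCoeff ω ω' 1 = -(ω 0 2 * ω' 3 4 - ω 0 3 * ω' 2 4 + ω 0 4 * ω' 2 3 + ω 2 3 * ω' 0 4
      - ω 2 4 * ω' 0 3 + ω 3 4 * ω' 0 2) ∧
    wedgeCoeff ω ω' 2 = ω 0 1 * ω' 3 4 - ω 0 3 * ω' 1 4 + ω 0 4 * ω' 1 3 + ω 1 3 * ω' 0 4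
      - ω 1 4 * ω' 0 3 + ω 3 4 * ω' 0 1 ∧
    wedgeCoeff ω ω' 3 = -(ω 0 1 * ω' 2 4 - ω 0 2 * ω' 1 4 + ω 0 4 * ω' 1 2 + ω 1 2 * ω' 0 4
      - ω 1 4 * ω' 0 2 + ω 2 4 * ω' 0 1) ∧
    wedgeCoeff ω ω' 4 = ω 0 1 * ω' 2 3 - ω 0 2 * ω' 1 3 + ω 0 3 * ω' 1 2 + ω 1 2 * ω' 0 3
      - ω 1 3 * ω' 0 2 + ω 2 3 * ω' 0 1 := by
  have e0 : (0 : Fin 5).succAbove (0 : Fin 4) = 1 ∧ (0 : Fin 5).succAbove (1 : Fin 4) = 2 ∧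
    (0 : Fin 5).succAbove (2 : Fin 4) = 3 ∧ (0 : Fin 5).succAbove (3 : Fin 4) = 4 := by decide
  have e1 : (1 : Fin 5).succAbove (0 : Fin 4) = 0 ∧ (1 : Fin 5).succAbove (1 : Fin 4) = 2 ∧
    (1 : Fin 5).succAbove (2 : Fin 4) = 3 ∧ (1 : Fin 5).succAbove (3 : Fin 4) = 4 := by decide
  have e2 : (2 : Fin 5).succAbove (0 : Fin 4) = 0 ∧ (2 : Fin 5).succAbove (1 : Fin 4) = 1 ∧
    (2 : Fin 5).succAbove (2 : Fin 4) = 3 ∧ (2 : Fin 5).succAbove (3 : Fin 4) = 4 := by decide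
  have e3 : (3 : Fin 5).succAbove (0 : Fin 4) = 0 ∧ (3 : Fin 5).succAbove (1 : Fin 4) = 1 ∧
    (3 : Fin 5).succAbove (2 : Fin 4) = 2 ∧ (3 : Fin 5).succAbove (3 : Fin 4) = 4 := by decide
  have e4 : (4 : Fin 5).succAbove (0 : Fin 4) = 0 ∧ (4 : Fin 5).succAbove (1 : Fin 4) = 1 ∧
    (4 : Fin 5).succAbove (2 : Fin 4) = 2 ∧ (4 : Fin 5).succAbove (3 : Fin 4) = 3 := by decide
  obtain ⟨a0, a1, a2, a3⟩ := e0
  obtain ⟨b0, b1, b2, b3⟩ := e1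
  obtain ⟨c0, c1, c2, c3⟩ := e2
  obtain ⟨d0, d1, d2, d3⟩ := e3
  obtain ⟨f0, f1, f2, f3⟩ := e4
  refine ⟨?_, ?_, ?_, ?_, ?_⟩
  · simp only [wedgeCoeff, a0, a1, a2, a3]; simp
  · simp only [wedgeCoeff, b0, b1, b2, b3]; simp
  · simp only [wedgeCoeff, c0, c1, c2, c3]; simp
  · simp only [wedgeCoeff, d0, d1, d2, d3]; norm_num
  · simp only [wedgeCoeff, f0, f1, f2, f3]; norm_num

/-- Antisymmetric arrays with zero diagonal. -/
def IsAlt (ω : Fin 5 → Fin 5 → A) : Prop := (∀ i, ω i i = 0) ∧ ∀ i j, ω i j = -ω j i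

theorem IsAlt.lower {ω : Fin 5 → Fin 5 → A} (h : IsAlt ω) :
    (ω 0 0 = 0 ∧ ω 1 1 = 0 ∧ ω 2 2 = 0 ∧ ω 3 3 = 0 ∧ ω 4 4 = 0) ∧
    (ω 1 0 = -ω 0 1 ∧ ω 2 0 = -ω 0 2 ∧ ω 3 0 = -ω 0 3 ∧ ω 4 0 = -ω 0 4 ∧ ω 2 1 = -ω 1 2) ∧
    (ω 3 1 = -ω 1 3 ∧ ω 4 1 = -ω 1 4 ∧ ω 3 2 = -ω 2 3 ∧ ω 4 2 = -ω 2 4 ∧ ω 4 3 = -ω 3 4) :=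
  ⟨⟨h.1 _, h.1 _, h.1 _, h.1 _, h.1 _⟩, ⟨h.2 _ _, h.2 _ _, h.2 _ _, h.2 _ _, h.2 _ _⟩,
    ⟨h.2 _ _, h.2 _ _, h.2 _ _, h.2 _ _, h.2 _ _⟩⟩

theorem contract_cyclic {x y z : Fin 5 → Fin 5 → A} (hx : IsAlt x) (hy : IsAlt y) (hz : IsAlt z)
    (j : Fin 5) : ∑ k, wedgeCoeff y z k * x k j + ∑ k, wedgeCoeff z x k * y k j +
      ∑ k, wedgeCoeff x y k * z k j = 0 := by
  obtain ⟨⟨x1, x2, x3, x4, x5⟩, ⟨x6, x7, x8, x9, x10⟩, ⟨x11, x12, x13, x14, x15⟩⟩ := hx.lower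
  obtain ⟨⟨y1, y2, y3, y4, y5⟩, ⟨y6, y7, y8, y9, y10⟩, ⟨y11, y12, y13, y14, y15⟩⟩ := hy.lower
  obtain ⟨⟨z1, z2, z3, z4, z5⟩, ⟨z6, z7, z8, z9, z10⟩, ⟨z11, z12, z13, z14, z15⟩⟩ := hz.lower
  simp only [Fin.sum_univ_five]
  obtain ⟨p0, p1, p2, p3, p4⟩ := wedgeCoeff_values y z
  obtain ⟨q0, q1, q2, q3, q4⟩ := wedgeCoeff_values z x
  obtain ⟨r0, r1, r2, r3, r4⟩ := wedgeCoeff_values x y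
  rw [p0, p1, p2, p3, p4, q0, q1, q2, q3, q4, r0, r1, r2, r3, r4]
  fin_cases j <;>
  simp only [Fin.zero_eta, Fin.mk_one, Fin.reduceFinMk, x1, x2, x3, x4, x5, x6, x7, x8, x9, x10,
    x11, x12, x13, x14, x15, y1, y2, y3, y4, y5, y6, y7, y8, y9, y10, y11, y12, y13, y14, y15,
    z1, z2, z3, z4, z5, z6, z7, z8, z9, z10, z11, z12, z13, z14, z15] <;>
  ring

/-- The infinitesimal action of a matrix `J` on arrays. -/
def matAct (J : Fin 5 → Fin 5 → A) (ω : Fin 5 → Fin 5 → A) (i j : Fin 5) : A :=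
  ∑ k, (J i k * ω k j + J j k * ω i k)

theorem wedge_matAct {x y J : Fin 5 → Fin 5 → A} (hx : IsAlt x) (hy : IsAlt y)
    (hJ : ∑ i, J i i = 0) (m : Fin 5) :
    wedgeCoeff (matAct J x) y m + wedgeCoeff x (matAct J y) m = -∑ k, wedgeCoeff x y k * J k m := by
  obtain ⟨⟨x1, x2, x3, x4, x5⟩, ⟨x6, x7, x8, x9, x10⟩, ⟨x11, x12, x13, x14, x15⟩⟩ := hx.lower
  obtain ⟨⟨y1, y2, y3, y4, y5⟩, ⟨y6, y7, y8, y9, y10⟩, ⟨y11, y12, y13, y14, y15⟩⟩ := hy.lower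
  rw [Fin.sum_univ_five] at hJ
  obtain ⟨p0, p1, p2, p3, p4⟩ := wedgeCoeff_values (matAct J x) y
  obtain ⟨q0, q1, q2, q3, q4⟩ := wedgeCoeff_values x (matAct J y)
  obtain ⟨r0, r1, r2, r3, r4⟩ := wedgeCoeff_values x y
  have key : wedgeCoeff (matAct J x) y m + wedgeCoeff x (matAct J y) m +
      ∑ k, wedgeCoeff x y k * J k m =
      wedgeCoeff x y m * (J 0 0 + J 1 1 + J 2 2 + J 3 3 + J 4 4) := by
    rw [Fin.sum_univ_five, r0, r1, r2, r3, r4]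
    fin_cases m <;>
    simp only [Fin.zero_eta, Fin.mk_one, Fin.reduceFinMk, p0, p1, p2, p3, p4, q0, q1, q2, q3, q4,
      r0, r1, r2, r3, r4] <;>
    simp only [matAct, Fin.sum_univ_five,
      x1, x2, x3, x4, x5, x6, x7, x8, x9, x10,
      x11, x12, x13, x14, x15, y1, y2, y3, y4, y5, y6, y7, y8, y9, y10, y11, y12, y13, y14, y15] <;>
    ring
  rw [hJ, mul_zero] at key
  exact eq_neg_of_add_eq_zero_left key

theorem perm3_sum {M : Type*} [AddCommMonoid M] (F : Fin 3 → Fin 3 → Fin 3 → M) :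
    ∑ σ : Equiv.Perm (Fin 3), F (σ 0) (σ 1) (σ 2) =
      F 0 1 2 + F 0 2 1 + F 1 0 2 + F 1 2 0 + F 2 0 1 + F 2 1 0 := by
  have h : (Finset.univ : Finset (Equiv.Perm (Fin 3))) =
      {1, Equiv.swap 1 2, Equiv.swap 0 1, Equiv.swap 0 1 * Equiv.swap 1 2,
        Equiv.swap 1 2 * Equiv.swap 0 1, Equiv.swap 0 2} := by decide
  have v : (Equiv.swap 1 2 : Equiv.Perm (Fin 3)) 0 = 0 ∧ (Equiv.swap 0 1 : Equiv.Perm (Fin 3)) 2 = 2 ∧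
      (Equiv.swap 0 2 : Equiv.Perm (Fin 3)) 1 = 1 := by decide
  rw [h, Finset.sum_insert (by decide), Finset.sum_insert (by decide), Finset.sum_insert (by decide),
    Finset.sum_insert (by decide), Finset.sum_insert (by decide), Finset.sum_singleton]
  simp only [Equiv.Perm.mul_apply, Equiv.Perm.one_apply, Equiv.swap_apply_left,
    Equiv.swap_apply_right, v.1, v.2.1, v.2.2, add_assoc]

end Algebra5

section

variable {K : Type*} [Field K] [CharP K 2] {ι : Type*} [Fintype ι] [DecidableEq ι]
variable {N : ι → WithTop ℕ+}

theorem two_eq_zero : (2 : O K N) = 0 := by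
  have h : ((2 : K) • (1 : O K N)) = 0 := by rw [CharTwo.two_eq_zero, zero_smul]
  rw [← h, two_smul, one_add_one_eq_two]

theorem smul_pd_mem_vect (f : O K N) (i : ι) : f • (pd i : Der K N) ∈ vect K N := by
  refine ⟨Pi.single i f, ?_⟩
  rw [Finset.sum_eq_single i]
  · rw [Pi.single_eq_same]
  · intro j _ hj
    rw [Pi.single_eq_of_ne hj, zero_smul]
  · intro h
    exact absurd (Finset.mem_univ i) h

theorem smul_pd_X (f : O K N) (i j : ι) : (f • (pd i : Der K N)) (X j) = if i = j then f else 0 := by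
  rw [Derivation.smul_apply, pd_X]
  split_ifs <;> simp

theorem vect_ext {D E : Der K N} (hD : D ∈ vect K N) (hE : E ∈ vect K N)
    (h : ∀ k, D (X k) = E (X k)) : D = E :=
  Derivation.ext fun a => by
    rw [vect_apply hD, vect_apply hE]
    exact Finset.sum_congr rfl fun k _ => by rw [h]

end

section Five

variable {K : Type*} [Field K] [CharP K 2] {N : Fin 5 → WithTop ℕ+}

/-- The vector field
`c(D, E) = ∑_{(i,j,k) ∈ S_3} (∂_i f_4 ∂_j g_5 + ∂_i f_5 ∂_j g_4) ∂_k` for `D = ∑ f_i ∂_i` and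
`E = ∑ g_i ∂_i`; here `S_3` permutes the first three indices, and the indices of the five
indeterminates start at `0`. -/
def cField (D E : Der K N) : Der K N :=
  ∑ σ : Equiv.Perm (Fin 3),
    (pd ((σ 0).castLE (by norm_num)) (D (X 3)) * pd ((σ 1).castLE (by norm_num)) (E (X 4)) +
      pd ((σ 0).castLE (by norm_num)) (D (X 4)) * pd ((σ 1).castLE (by norm_num)) (E (X 3))) •
    pd ((σ 2).castLE (by norm_num))

theorem cField_eq (D E : Der K N) : cField D E =
    (pd 1 (D (X 3)) * pd 2 (E (X 4)) + pd 1 (D (X 4)) * pd 2 (E (X 3)) +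
      (pd 2 (D (X 3)) * pd 1 (E (X 4)) + pd 2 (D (X 4)) * pd 1 (E (X 3)))) • pd 0 +
    (pd 0 (D (X 3)) * pd 2 (E (X 4)) + pd 0 (D (X 4)) * pd 2 (E (X 3)) +
      (pd 2 (D (X 3)) * pd 0 (E (X 4)) + pd 2 (D (X 4)) * pd 0 (E (X 3)))) • pd 1 +
    (pd 0 (D (X 3)) * pd 1 (E (X 4)) + pd 0 (D (X 4)) * pd 1 (E (X 3)) +
      (pd 1 (D (X 3)) * pd 0 (E (X 4)) + pd 1 (D (X 4)) * pd 0 (E (X 3)))) • pd 2 := by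
  have h := perm3_sum (fun a b c : Fin 3 =>
    (pd (a.castLE (by norm_num)) (D (X 3)) * pd (b.castLE (by norm_num)) (E (X 4)) +
      pd (a.castLE (by norm_num)) (D (X 4)) * pd (b.castLE (by norm_num)) (E (X 3))) •
    (pd (c.castLE (by norm_num)) : Der K N))
  have c0 : Fin.castLE (show 3 ≤ 5 by norm_num) 0 = 0 := rfl
  have c1 : Fin.castLE (show 3 ≤ 5 by norm_num) 1 = 1 := rfl
  have c2 : Fin.castLE (show 3 ≤ 5 by norm_num) 2 = 2 := rfl
  rw [cField, h]
  simp only [c0, c1, c2, add_smul]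
  abel

theorem cField_mem (D E : Der K N) : cField D E ∈ svect K N := by
  rw [cField_eq]
  refine ⟨(vect K N).add_mem ((vect K N).add_mem (smul_pd_mem_vect _ _) (smul_pd_mem_vect _ _))
    (smul_pd_mem_vect _ _), ?_⟩
  have h2 : (2 : O K N) = 0 := two_eq_zero
  rw [div]
  simp only [Fin.sum_univ_five, Derivation.add_apply, smul_pd_X]
  simp only [Fin.isValue, Fin.reduceEq, if_true, if_false, add_zero, zero_add, map_zero, map_add,
    Derivation.leibniz, smul_eq_mul]
  generalize D (X 3) = p
  generalize D (X 4) = q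
  generalize E (X 3) = p'
  generalize E (X 4) = q'
  rw [pd_comm 1 0 p, pd_comm 1 0 q, pd_comm 1 0 p', pd_comm 1 0 q',
    pd_comm 2 0 p, pd_comm 2 0 q, pd_comm 2 0 p', pd_comm 2 0 q',
    pd_comm 2 1 p, pd_comm 2 1 q, pd_comm 2 1 p', pd_comm 2 1 q']
  linear_combination (pd 0 (pd 1 p) * pd 2 q' + pd 0 (pd 2 p) * pd 1 q' + pd 1 (pd 2 p) * pd 0 q' +
    pd 0 (pd 1 q) * pd 2 p' + pd 0 (pd 2 q) * pd 1 p' + pd 1 (pd 2 q) * pd 0 p' +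
    pd 0 (pd 1 p') * pd 2 q + pd 0 (pd 2 p') * pd 1 q + pd 1 (pd 2 p') * pd 0 q +
    pd 0 (pd 1 q') * pd 2 p + pd 0 (pd 2 q') * pd 1 p + pd 1 (pd 2 q') * pd 0 p) * h2

theorem cField_add_left (D D' E : Der K N) : cField (D + D') E = cField D E + cField D' E := by
  simp only [cField, Derivation.add_apply, map_add, ← Finset.sum_add_distrib, ← add_smul]
  refine Finset.sum_congr rfl fun σ _ => ?_
  congr 1; ring

theorem cField_add_right (D E E' : Der K N) : cField D (E + E') = cField D E + cField D E' := by
  simp only [cField, Derivation.add_apply, map_add, ← Finset.sum_add_distrib, ← add_smul]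
  refine Finset.sum_congr rfl fun σ _ => ?_
  congr 1; ring

theorem cField_smul_left (a : K) (D E : Der K N) : cField (a • D) E = a • cField D E := by
  simp only [cField, Derivation.smul_apply, Derivation.map_smul, Finset.smul_sum, smul_mul_assoc,
    ← smul_add, smul_assoc]

theorem cField_smul_right (a : K) (D E : Der K N) : cField D (a • E) = a • cField D E := by
  simp only [cField, Derivation.smul_apply, Derivation.map_smul, Finset.smul_sum, mul_smul_comm,
    ← smul_add, smul_assoc]

theorem cField_self (D : Der K N) : cField D D = 0 := by
  have h2 : (2 : O K N) = 0 := two_eq_zero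
  have h : ∀ a b c d : O K N, a * b + c * d + (d * c + b * a) = 0 := fun a b c d => by
    linear_combination (a * b + c * d) * h2
  rw [cField_eq, h, h, h, zero_smul, zero_smul, zero_smul, add_zero, add_zero]

variable (K N) in
/-- `c` as a 2-cochain of `svect(5; N)` with coefficients in the adjoint module. -/
def cCochain : LieModule.Cohomology.twoCochain K (svect K N) (svect K N) :=
  ⟨LinearMap.mk₂ K (fun D E => ⟨cField (D : Der K N) (E : Der K N), cField_mem _ _⟩)
    (fun _ _ _ => Subtype.ext (cField_add_left _ _ _))
    (fun _ _ _ => Subtype.ext (cField_smul_left _ _ _))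
    (fun _ _ _ => Subtype.ext (cField_add_right _ _ _))
    (fun _ _ _ => Subtype.ext (cField_smul_right _ _ _)),
  fun _ => Subtype.ext (cField_self _)⟩

variable (K N)

/-- Differential 1-forms `∑ α_i du_i`, given by their coefficients. -/
abbrev Form1 : Type _ := Fin 5 → O K N

/-- Arrays of coefficients `ω_ij` of 2-forms `∑_{i < j} ω_ij du_i ∧ du_j`. -/
abbrev Form2 : Type _ := Fin 5 → Fin 5 → O K N

/-- The exterior differential of a 1-form. -/
def extD : Form1 K N →ₗ[K] Form2 K N where
  toFun α i j := pd i (α j) - pd j (α i)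
  map_add' α β := by
    funext i j; simp only [Pi.add_apply, map_add]; ring
  map_smul' a α := by
    funext i j; simp only [Pi.smul_apply, Derivation.map_smul, RingHom.id_apply, smul_sub]

/-- `dΩ¹(5; N)`, the space of exact 2-forms. -/
def dOmega1 : Submodule K (Form2 K N) := LinearMap.range (extD K N)

variable {K N}

theorem extD_apply (α : Form1 K N) (i j : Fin 5) : extD K N α i j = pd i (α j) - pd j (α i) := rfl

theorem isAlt_of_mem {ω : Form2 K N} (h : ω ∈ dOmega1 K N) : IsAlt ω := by
  obtain ⟨α, rfl⟩ := h
  exact ⟨fun i => by rw [extD_apply, sub_self], fun i j => by rw [extD_apply, extD_apply]; ring⟩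

theorem closed_of_mem {ω : Form2 K N} (h : ω ∈ dOmega1 K N) (i j k : Fin 5) :
    pd i (ω j k) - pd j (ω i k) + pd k (ω i j) = 0 := by
  obtain ⟨α, rfl⟩ := h
  simp only [extD_apply, map_sub]
  rw [pd_comm j i, pd_comm k i, pd_comm k j]; ring

/-- The Lie derivative along `D = ∑ f_k ∂_k` of a 2-form:
`(L_D ω)_ij = D ω_ij + ∑_k (∂_i f_k ω_kj + ∂_j f_k ω_ik)`. -/
def lieForm (D : Der K N) (ω : Form2 K N) : Form2 K N :=
  fun i j => D (ω i j) + ∑ k, (pd i (D (X k)) * ω k j + pd j (D (X k)) * ω i k)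

/-- The vector field corresponding to `ω ∧ ω'` divided by the volume form. -/
def wedgeField (ω ω' : Form2 K N) : Der K N := ∑ m, wedgeCoeff ω ω' m • pd m

theorem lieForm_add_left (D E : Der K N) (ω : Form2 K N) :
    lieForm (D + E) ω = lieForm D ω + lieForm E ω := by
  funext i j
  simp only [lieForm, Pi.add_apply, Derivation.add_apply, map_add, Fin.sum_univ_five]; ring

theorem lieForm_add_right (D : Der K N) (ω ω' : Form2 K N) :
    lieForm D (ω + ω') = lieForm D ω + lieForm D ω' := by
  funext i j
  simp only [lieForm, Pi.add_apply, map_add, Fin.sum_univ_five]; ring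

theorem lieForm_smul_left (a : K) (D : Der K N) (ω : Form2 K N) :
    lieForm (a • D) ω = a • lieForm D ω := by
  funext i j
  simp only [lieForm, Pi.smul_apply, Derivation.smul_apply, Derivation.map_smul, smul_add,
    Finset.smul_sum, smul_mul_assoc]

theorem lieForm_smul_right (a : K) (D : Der K N) (ω : Form2 K N) :
    lieForm D (a • ω) = a • lieForm D ω := by
  funext i j
  simp only [lieForm, Pi.smul_apply, Derivation.map_smul, smul_add, Finset.smul_sum, mul_smul_comm]

theorem lieForm_mem {D : Der K N} (hD : D ∈ vect K N) {ω : Form2 K N} (h : ω ∈ dOmega1 K N) :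
    lieForm D ω ∈ dOmega1 K N := by
  obtain ⟨α, rfl⟩ := h
  refine ⟨fun j => D (α j) + ∑ k, pd j (D (X k)) * α k, ?_⟩
  funext i j
  simp only [lieForm, extD_apply, map_add, map_sub, map_sum, pd_vect hD i (α j), pd_vect hD j (α i),
    Derivation.leibniz,
    smul_eq_mul, Fin.sum_univ_five]
  simp only [pd_comm j i]
  ring

theorem lieForm_lie {D E : Der K N} (hD : D ∈ vect K N) (hE : E ∈ vect K N) (ω : Form2 K N) :
    lieForm ⁅D, E⁆ ω = lieForm D (lieForm E ω) - lieForm E (lieForm D ω) := by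
  funext i j
  simp only [lieForm, Pi.sub_apply, map_add, map_sub, map_sum, Derivation.commutator_apply,
    pd_vect hD (_ : Fin 5) (E _), pd_vect hE (_ : Fin 5) (D _), Derivation.leibniz,
    smul_eq_mul, Fin.sum_univ_five]
  ring

theorem wedgeField_X (ω ω' : Form2 K N) (m : Fin 5) :
    wedgeField ω ω' (X m) = wedgeCoeff ω ω' m := sum_smul_pd_X _ _

theorem wedgeField_mem_vect (ω ω' : Form2 K N) : wedgeField ω ω' ∈ vect K N := ⟨_, rfl⟩

theorem wedgeField_mem {ω ω' : Form2 K N} (h : ω ∈ dOmega1 K N) (h' : ω' ∈ dOmega1 K N) :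
    wedgeField ω ω' ∈ svect K N := by
  refine ⟨wedgeField_mem_vect _ _, ?_⟩
  simp only [div, Fin.sum_univ_five, wedgeField_X]
  obtain ⟨r0, r1, r2, r3, r4⟩ := wedgeCoeff_values ω ω'
  rw [r0, r1, r2, r3, r4]
  simp only [map_add, map_sub, map_neg, Derivation.leibniz, smul_eq_mul]
  have c := closed_of_mem h
  have c' := closed_of_mem h'
  linear_combination c 0 1 2 * ω' 3 4 - c 0 1 3 * ω' 2 4 + c 0 1 4 * ω' 2 3 + c 0 2 3 * ω' 1 4
    - c 0 2 4 * ω' 1 3 + c 0 3 4 * ω' 1 2 - c 1 2 3 * ω' 0 4 + c 1 2 4 * ω' 0 3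
    - c 1 3 4 * ω' 0 2 + c 2 3 4 * ω' 0 1
    + c' 0 1 2 * ω 3 4 - c' 0 1 3 * ω 2 4 + c' 0 1 4 * ω 2 3 + c' 0 2 3 * ω 1 4
    - c' 0 2 4 * ω 1 3 + c' 0 3 4 * ω 1 2 - c' 1 2 3 * ω 0 4 + c' 1 2 4 * ω 0 3
    - c' 1 3 4 * ω 0 2 + c' 2 3 4 * ω 0 1

theorem wedgeField_comm (ω ω' : Form2 K N) : wedgeField ω ω' = wedgeField ω' ω := by
  simp only [wedgeField, wedgeCoeff_comm ω ω']

theorem wedgeField_self (ω : Form2 K N) : wedgeField ω ω = 0 := by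
  simp only [wedgeField, wedgeCoeff_self two_eq_zero, zero_smul, Finset.sum_const_zero]

theorem wedgeField_add_left (x y z : Form2 K N) :
    wedgeField (x + y) z = wedgeField x z + wedgeField y z := by
  simp only [wedgeField, ← Finset.sum_add_distrib, ← add_smul]
  refine Finset.sum_congr rfl fun m _ => ?_
  congr 1
  simp only [wedgeCoeff, Pi.add_apply]; ring

theorem wedgeField_smul_left (a : K) (x z : Form2 K N) :
    wedgeField (a • x) z = a • wedgeField x z := by
  simp only [wedgeField, Finset.smul_sum, ← smul_assoc]
  refine Finset.sum_congr rfl fun m _ => ?_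
  congr 1
  simp only [wedgeCoeff, Pi.smul_apply, smul_mul_assoc, ← smul_add, ← smul_sub, mul_smul_comm]

theorem wedgeField_add_right (x y z : Form2 K N) :
    wedgeField z (x + y) = wedgeField z x + wedgeField z y := by
  rw [wedgeField_comm, wedgeField_add_left, wedgeField_comm x, wedgeField_comm y]

theorem wedgeField_smul_right (a : K) (x z : Form2 K N) :
    wedgeField z (a • x) = a • wedgeField z x := by
  rw [wedgeField_comm, wedgeField_smul_left, wedgeField_comm x]

theorem lie_wedgeField {D : Der K N} (hD : D ∈ svect K N) {x y : Form2 K N} (hx : IsAlt x)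
    (hy : IsAlt y) :
    ⁅D, wedgeField x y⁆ = wedgeField (lieForm D x) y + wedgeField x (lieForm D y) := by
  refine vect_ext ((vect K N).lie_mem hD.1 (wedgeField_mem_vect _ _))
    ((vect K N).add_mem (wedgeField_mem_vect _ _) (wedgeField_mem_vect _ _)) fun m => ?_
  rw [Derivation.commutator_apply, Derivation.add_apply, wedgeField_X, wedgeField_X, wedgeField_X,
    vect_apply (wedgeField_mem_vect x y)]
  simp only [wedgeField_X]
  have h := wedge_matAct (J := fun i k => pd i (D (X k))) hx hy hD.2 m
  have e : ∀ x : Form2 K N, lieForm D x =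
      (fun i j => D (x i j)) + matAct (fun i k => pd i (D (X k))) x := fun x => rfl
  have add1 : ∀ x y z : Form2 K N, wedgeCoeff (x + y) z m = wedgeCoeff x z m + wedgeCoeff y z m := by
    intro x y z; simp only [wedgeCoeff, Pi.add_apply]; ring
  have add2 : ∀ x y z : Form2 K N, wedgeCoeff z (x + y) m = wedgeCoeff z x m + wedgeCoeff z y m := by
    intro x y z; simp only [wedgeCoeff, Pi.add_apply]; ring
  have leib : D (wedgeCoeff x y m) =
      wedgeCoeff (fun i j => D (x i j)) y m + wedgeCoeff x (fun i j => D (y i j)) m := by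
    have hs : D ((-1) ^ (m : ℕ)) = 0 := by
      rcases neg_one_pow_eq_or (O K N) (m : ℕ) with h | h <;> rw [h] <;> simp
    simp only [wedgeCoeff, Derivation.leibniz, map_add, map_sub, smul_eq_mul, hs]; ring
  rw [e x, e y, add1, add2, leib]
  linear_combination -h

theorem lieForm_eq_extD {D : Der K N} (hD : D ∈ vect K N) {ω : Form2 K N} (h : ω ∈ dOmega1 K N) :
    lieForm D ω = extD K N fun j => ∑ k, D (X k) * ω k j := by
  have c := closed_of_mem h
  have a := (isAlt_of_mem h).2
  funext i j
  have e : D (ω i j) = ∑ k, D (X k) * (pd i (ω k j) - pd j (ω k i)) := by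
    rw [vect_apply hD]
    refine Finset.sum_congr rfl fun k _ => ?_
    have := c k i j
    linear_combination D (X k) * this
  have e' : ∀ k, ω i k = -ω k i := fun k => a i k
  simp only [lieForm, extD_apply, e, map_sum, Derivation.leibniz, smul_eq_mul]
  rw [← Finset.sum_add_distrib, ← Finset.sum_sub_distrib]
  refine Finset.sum_congr rfl fun k _ => ?_
  rw [e' k]; ring

theorem lieForm_wedge_cyclic {x y z : Form2 K N} (hx : x ∈ dOmega1 K N) (hy : y ∈ dOmega1 K N)
    (hz : z ∈ dOmega1 K N) : lieForm (wedgeField y z) x + lieForm (wedgeField z x) y +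
      lieForm (wedgeField x y) z = 0 := by
  rw [lieForm_eq_extD (wedgeField_mem_vect _ _) hx, lieForm_eq_extD (wedgeField_mem_vect _ _) hy,
    lieForm_eq_extD (wedgeField_mem_vect _ _) hz, ← map_add, ← map_add]
  have h : ((fun j => ∑ k, wedgeField y z (X k) * x k j) +
      (fun j => ∑ k, wedgeField z x (X k) * y k j) +
      fun j => ∑ k, wedgeField x y (X k) * z k j) = (0 : Form1 K N) := by
    funext j
    simp only [Pi.add_apply, wedgeField_X, Pi.zero_apply]
    exact contract_cyclic (isAlt_of_mem hx) (isAlt_of_mem hy) (isAlt_of_mem hz) j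
  rw [h, map_zero]

end Five

section FKle

variable (K : Type*) [Field K] [CharP K 2] (N : Fin 5 → WithTop ℕ+)

/-- The space `svect(5; N) ⊕ dΩ¹(5; N)` of the Lie algebra `F(kle(5; N | 10))`: the Lie superalgebra
with the even part `svect(5; N)` and the odd part `Π(dΩ¹(5; N))`, with its parity forgotten. -/
def FKle : Type _ := svect K N × dOmega1 K N

instance : AddCommGroup (FKle K N) := inferInstanceAs (AddCommGroup (svect K N × dOmega1 K N))

instance : Module K (FKle K N) := inferInstanceAs (Module K (svect K N × dOmega1 K N))

variable {K N}

/-- The vector field in `svect(5; N)` given by the product of two exact 2-forms. -/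
def wedgeS (x y : dOmega1 K N) : svect K N :=
  ⟨wedgeField (x : Form2 K N) (y : Form2 K N), wedgeField_mem x.2 y.2⟩

/-- The Lie derivative as the action of `svect(5; N)` on `dΩ¹(5; N)`. -/
def lieS (D : svect K N) (x : dOmega1 K N) : dOmega1 K N :=
  ⟨lieForm (D : Der K N) (x : Form2 K N), lieForm_mem D.2.1 x.2⟩

/-- The bracket of `F(kle(5; N | 10))`: the usual bracket of vector fields, the Lie derivative of
forms along fields, and the product of forms `ω ∧ ω'` divided by the volume form. -/
instance : Bracket (FKle K N) (FKle K N) :=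
  ⟨fun a b => (⁅a.1, b.1⁆ + wedgeS a.2 b.2, lieS a.1 b.2 - lieS b.1 a.2)⟩

theorem FKle.lie_def (a b : FKle K N) :
    ⁅a, b⁆ = ((⁅a.1, b.1⁆ + wedgeS a.2 b.2, lieS a.1 b.2 - lieS b.1 a.2) : FKle K N) := rfl

theorem wedgeS_add_left (x y z : dOmega1 K N) : wedgeS (x + y) z = wedgeS x z + wedgeS y z :=
  Subtype.ext (wedgeField_add_left _ _ _)

theorem wedgeS_comm (x y : dOmega1 K N) : wedgeS x y = wedgeS y x :=
  Subtype.ext (wedgeField_comm _ _)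

theorem wedgeS_add_right (x y z : dOmega1 K N) : wedgeS z (x + y) = wedgeS z x + wedgeS z y :=
  Subtype.ext (wedgeField_add_right _ _ _)

theorem wedgeS_smul_right (a : K) (x y : dOmega1 K N) : wedgeS x (a • y) = a • wedgeS x y :=
  Subtype.ext (wedgeField_smul_right _ _ _)

theorem wedgeS_self (x : dOmega1 K N) : wedgeS x x = 0 := Subtype.ext (wedgeField_self _)

theorem lieS_add_left (D E : svect K N) (x : dOmega1 K N) :
    lieS (D + E) x = lieS D x + lieS E x := Subtype.ext (lieForm_add_left _ _ _)

theorem lieS_add_right (D : svect K N) (x y : dOmega1 K N) :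
    lieS D (x + y) = lieS D x + lieS D y := Subtype.ext (lieForm_add_right _ _ _)

theorem lieS_smul_left (a : K) (D : svect K N) (x : dOmega1 K N) :
    lieS (a • D) x = a • lieS D x := Subtype.ext (lieForm_smul_left _ _ _)

theorem lieS_smul_right (a : K) (D : svect K N) (x : dOmega1 K N) :
    lieS D (a • x) = a • lieS D x := Subtype.ext (lieForm_smul_right _ _ _)

theorem lieS_lie (D E : svect K N) (x : dOmega1 K N) :
    lieS ⁅D, E⁆ x = lieS D (lieS E x) - lieS E (lieS D x) :=
  Subtype.ext (lieForm_lie D.2.1 E.2.1 _)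

theorem lie_wedgeS (D : svect K N) (x y : dOmega1 K N) :
    ⁅D, wedgeS x y⁆ = wedgeS (lieS D x) y + wedgeS x (lieS D y) :=
  Subtype.ext (lie_wedgeField D.2 (isAlt_of_mem x.2) (isAlt_of_mem y.2))

theorem lieS_wedgeS_cyclic (x y z : dOmega1 K N) :
    lieS (wedgeS y z) x + lieS (wedgeS z x) y + lieS (wedgeS x y) z = 0 :=
  Subtype.ext (lieForm_wedge_cyclic x.2 y.2 z.2)

theorem add_self_eq_zero_of_module (K : Type*) [Field K] [CharP K 2] {M : Type*} [AddCommGroup M] [Module K M] (x : M) :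
    x + x = 0 := by
  rw [← two_smul K, CharTwo.two_eq_zero, zero_smul]

theorem wedgeS_sub_left (x y z : dOmega1 K N) : wedgeS (x - y) z = wedgeS x z - wedgeS y z := by
  rw [eq_sub_iff_add_eq, ← wedgeS_add_left, sub_add_cancel]

theorem wedgeS_sub_right (x y z : dOmega1 K N) : wedgeS z (x - y) = wedgeS z x - wedgeS z y := by
  rw [eq_sub_iff_add_eq, ← wedgeS_add_right, sub_add_cancel]

theorem lieS_sub_right (D : svect K N) (x y : dOmega1 K N) :
    lieS D (x - y) = lieS D x - lieS D y := by
  rw [eq_sub_iff_add_eq, ← lieS_add_right, sub_add_cancel]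

theorem FKle.ext' {a b : FKle K N} (h1 : a.1 = b.1) (h2 : a.2 = b.2) : a = b := Prod.ext h1 h2

theorem FKle.jacobi_fst (D E F : svect K N) (x y z : dOmega1 K N) :
    ⁅D, ⁅E, F⁆ + wedgeS y z⁆ + wedgeS x (lieS E z - lieS F y) =
    (⁅⁅D, E⁆ + wedgeS x y, F⁆ + wedgeS (lieS D y - lieS E x) z) +
    (⁅E, ⁅D, F⁆ + wedgeS x z⁆ + wedgeS y (lieS D z - lieS F x)) := by
  have h := add_self_eq_zero_of_module K (wedgeS y (lieS F x))
  rw [lie_add, add_lie, lie_add, leibniz_lie D E F, lie_wedgeS, lie_wedgeS,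
    ← lie_skew (wedgeS x y) F, lie_wedgeS, wedgeS_sub_right, wedgeS_sub_left, wedgeS_sub_right,
    wedgeS_comm (lieS F x) y, wedgeS_comm (lieS E x) z, wedgeS_comm z (lieS E x)]
  rw [← sub_eq_zero]
  refine Eq.trans ?_ h
  abel

theorem FKle.jacobi_snd (D E F : svect K N) (x y z : dOmega1 K N) :
    lieS D (lieS E z - lieS F y) - lieS (⁅E, F⁆ + wedgeS y z) x =
    (lieS (⁅D, E⁆ + wedgeS x y) z - lieS F (lieS D y - lieS E x)) +
    (lieS E (lieS D z - lieS F x) - lieS (⁅D, F⁆ + wedgeS x z) y) := by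
  have h := lieS_wedgeS_cyclic x y z
  have h2 := add_self_eq_zero_of_module K (lieS (wedgeS z x) y)
  simp only [lieS_add_left, lieS_sub_right, lieS_lie]
  rw [wedgeS_comm x z]
  rw [← sub_eq_zero]
  have h3 : lieS (wedgeS z x) y + lieS (wedgeS z x) y -
    (lieS (wedgeS y z) x + lieS (wedgeS z x) y + lieS (wedgeS x y) z) = 0 := by rw [h, h2, sub_zero]
  refine Eq.trans ?_ h3
  abel

instance : LieRing (FKle K N) where
  add_lie a b c := FKle.ext'
    (by
      change ⁅a.1 + b.1, c.1⁆ + wedgeS (a.2 + b.2) c.2 =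
        (⁅a.1, c.1⁆ + wedgeS a.2 c.2) + (⁅b.1, c.1⁆ + wedgeS b.2 c.2)
      rw [add_lie, wedgeS_add_left]; abel)
    (by
      change lieS (a.1 + b.1) c.2 - lieS c.1 (a.2 + b.2) =
        (lieS a.1 c.2 - lieS c.1 a.2) + (lieS b.1 c.2 - lieS c.1 b.2)
      rw [lieS_add_left, lieS_add_right]; abel)
  lie_add a b c := FKle.ext'
    (by
      change ⁅a.1, b.1 + c.1⁆ + wedgeS a.2 (b.2 + c.2) =
        (⁅a.1, b.1⁆ + wedgeS a.2 b.2) + (⁅a.1, c.1⁆ + wedgeS a.2 c.2)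
      rw [lie_add, wedgeS_add_right]; abel)
    (by
      change lieS a.1 (b.2 + c.2) - lieS (b.1 + c.1) a.2 =
        (lieS a.1 b.2 - lieS b.1 a.2) + (lieS a.1 c.2 - lieS c.1 a.2)
      rw [lieS_add_left, lieS_add_right]; abel)
  lie_self a := FKle.ext'
    (by
      change ⁅a.1, a.1⁆ + wedgeS a.2 a.2 = 0
      rw [lie_self, wedgeS_self, add_zero])
    (sub_self _)
  leibniz_lie a b c := FKle.ext' (FKle.jacobi_fst _ _ _ _ _ _) (FKle.jacobi_snd _ _ _ _ _ _)

instance : LieAlgebra K (FKle K N) where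
  lie_smul t a b := FKle.ext'
    (by
      change ⁅a.1, t • b.1⁆ + wedgeS a.2 (t • b.2) = t • (⁅a.1, b.1⁆ + wedgeS a.2 b.2)
      rw [lie_smul, wedgeS_smul_right, smul_add])
    (by
      change lieS a.1 (t • b.2) - lieS (t • b.1) a.2 = t • (lieS a.1 b.2 - lieS b.1 a.2)
      rw [lieS_smul_right, lieS_smul_left, smul_sub])

/-- The 2-form `Z_i(D) = du_i ∧ df_i` for `D = ∑ f_k ∂_k`. -/
def Z (i : Fin 5) (D : Der K N) : Form2 K N :=
  fun a b => pd a (X i) * pd b (D (X i)) - pd b (X i) * pd a (D (X i))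

theorem Z_mem (i : Fin 5) (D : Der K N) : Z i D ∈ dOmega1 K N := by
  refine ⟨fun a => X i * pd a (D (X i)), ?_⟩
  funext a b
  simp only [Z, extD_apply, Derivation.leibniz, smul_eq_mul]
  rw [pd_comm a b]; ring

variable (K N) in
/-- The linear map `ψ : D ↦ D + Z_4(D) + Z_5(D)` (the indices start at `0` in the code). -/
def psi : svect K N →ₗ[K] FKle K N where
  toFun D := (D, (⟨Z 3 (D : Der K N), Z_mem _ _⟩ + ⟨Z 4 (D : Der K N), Z_mem _ _⟩ : dOmega1 K N))
  map_add' D E := FKle.ext' rfl (Subtype.ext (by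
    funext a b
    change Z 3 (D + E : Der K N) a b + Z 4 (D + E : Der K N) a b =
      (Z 3 (D : Der K N) a b + Z 4 (D : Der K N) a b) +
      (Z 3 (E : Der K N) a b + Z 4 (E : Der K N) a b)
    simp only [Z, Derivation.add_apply, map_add]; ring))
  map_smul' t D := FKle.ext' rfl (Subtype.ext (by
    funext a b
    change Z 3 (t • D : Der K N) a b + Z 4 (t • D : Der K N) a b =
      t • (Z 3 (D : Der K N) a b + Z 4 (D : Der K N) a b)
    simp only [Z, Derivation.smul_apply, Derivation.map_smul, mul_smul_comm, ← smul_sub, ← smul_add]))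

end FKle

section FMb

/-- The indices of the eleven indeterminates of `mb(3 | 8)`: `u_1, u_2, u_3, χ_1, χ_2` in the left
summand (so that `χ_s` is `u_{3+s}`), and `η_1, η_2, η_3, ξ_1, ξ_2, ξ_3` in the right one. -/
abbrev MbIdx : Type := Fin 5 ⊕ (Fin 3 ⊕ Fin 3)

/-- The index of `u_i` for `i = 1, 2, 3`. -/
def iu (i : Fin 3) : MbIdx := Sum.inl (i.castLE (by norm_num))

/-- The index of `χ_s = u_{3+s}` for `s = 1, 2`. -/
def ichi (s : Fin 2) : MbIdx := Sum.inl (s.natAdd 3)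

/-- The index of `η_i`. -/
def ieta (i : Fin 3) : MbIdx := Sum.inr (Sum.inl i)

/-- The index of `ξ_i`. -/
def ixi (i : Fin 3) : MbIdx := Sum.inr (Sum.inr i)

/-- The shearing vector in eleven indeterminates: `N` on `u_1, …, u_5` and `1` on the formerly odd
`η_i` and `ξ_i`. -/
def tildeN (N : Fin 5 → WithTop ℕ+) : MbIdx → WithTop ℕ+ := Sum.elim N fun _ => 1

variable (K : Type*) [Field K] [CharP K 2] (N : Fin 5 → WithTop ℕ+)

/-- `Y_{ξ_i} = ∂_{ξ_i}`. -/
def Yxi (i : Fin 3) : Der K (tildeN N) := pd (ixi i)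

/-- `Y_{η_i} = ∂_{η_i} + ξ_k ∂_{u_j} - ξ_j ∂_{u_k} + (ξ_k η_j - ξ_j η_k) ∂_{χ_1} - ξ_j ξ_k ∂_{χ_2}`,
where `(i, j, k)` is the cyclic permutation `(i, i + 1, i + 2)` modulo `3`. -/
def Yeta (i : Fin 3) : Der K (tildeN N) :=
  let j : Fin 3 := i + 1
  let k : Fin 3 := i + 2
  let p : MbIdx → Der K (tildeN N) := fun a => pd a
  let x : MbIdx → O K (tildeN N) := fun a => X a
  p (ieta i) + (x (ixi k) • p (iu j) - x (ixi j) • p (iu k))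
    + (x (ixi k) * x (ieta j) - x (ixi j) * x (ieta k)) • p (ichi 0)
    - (x (ixi j) * x (ixi k)) • p (ichi 1)

/-- The distribution spanned by the `Y_{ξ_i}` and `Y_{η_i}`. -/
def mbDistribution : Submodule (O K (tildeN N)) (Der K (tildeN N)) :=
  Submodule.span _ (Set.range (Yxi K N) ∪ Set.range (Yeta K N))

/-- `F(mb(3; N | 8))`: the vector fields in the eleven indeterminates, all regarded as even,
that preserve the distribution. -/
def FMb : LieSubalgebra K (Der K (tildeN N)) where
  carrier := {D | D ∈ vect K (tildeN N) ∧ ∀ Y ∈ mbDistribution K N, ⁅D, Y⁆ ∈ mbDistribution K N}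
  add_mem' := by
    rintro D E ⟨hD, hD'⟩ ⟨hE, hE'⟩
    refine ⟨(vect K (tildeN N)).add_mem hD hE, fun Y hY => ?_⟩
    have h : ⁅D + E, Y⁆ = ⁅D, Y⁆ + ⁅E, Y⁆ := add_lie D E Y
    rw [h]
    exact Submodule.add_mem _ (hD' Y hY) (hE' Y hY)
  zero_mem' := ⟨(vect K (tildeN N)).zero_mem, fun Y _ => by
    have h : ⁅(0 : Der K (tildeN N)), Y⁆ = 0 := zero_lie Y
    rw [h]
    exact Submodule.zero_mem _⟩
  smul_mem' := by
    rintro a D ⟨hD, hD'⟩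
    refine ⟨(vect K (tildeN N)).smul_mem a hD, fun Y hY => ?_⟩
    have h : ⁅a • D, Y⁆ = a • ⁅D, Y⁆ := smul_lie a D Y
    rw [h]
    exact Submodule.smul_of_tower_mem _ a (hD' Y hY)
  lie_mem' := by
    rintro D E ⟨hD, hD'⟩ ⟨hE, hE'⟩
    refine ⟨(vect K (tildeN N)).lie_mem hD hE, fun Y hY => ?_⟩
    have h : ⁅⁅D, E⁆, Y⁆ = ⁅D, ⁅E, Y⁆⁆ - ⁅E, ⁅D, Y⁆⁆ := lie_lie D E Y
    rw [h]
    exact Submodule.sub_mem _ (hD' _ (hE' Y hY)) (hE' _ (hD' Y hY))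

variable {K N}

variable (K) in
/-- The substitution `η = ξ = 0` in divided power polynomials of the eleven indeterminates. -/
def restrHom : DivPow K MbIdx →ₗ[K] DivPow K (Fin 5) :=
  DivPow.lift fun r => if ∀ a, r (Sum.inr a) = 0 then DivPow.mon fun i => r (Sum.inl i) else 0

theorem restrHom_mem {f : DivPow K MbIdx} (hf : f ∈ DivPow.trunc K (tildeN N)) :
    restrHom K f ∈ DivPow.trunc K N := by
  refine DivPow.map_trunc_le K (restrHom K) (Subalgebra.toSubmodule (DivPow.trunc K N))
    (fun r hr => ?_) hf
  rw [restrHom, DivPow.lift_mon]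
  split_ifs
  · exact DivPow.mon_mem_trunc K fun i n hn => hr (Sum.inl i) n hn
  · exact Submodule.zero_mem _

variable (K N) in
/-- The restriction of a function of the eleven indeterminates to `η = ξ = 0`. -/
def restr : O K (tildeN N) →ₗ[K] O K N where
  toFun f := O.mk (restrHom K (O.val f)) (restrHom_mem (O.val_mem f))
  map_add' f g := O.ext (by
    rw [O.val_mk, map_add O.val, map_add O.val, O.val_mk, O.val_mk, map_add (restrHom K)])
  map_smul' a f := O.ext (by
    rw [O.val_mk, map_smul O.val, RingHom.id_apply, map_smul O.val, O.val_mk,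
      map_smul (restrHom K)])

/-- The generating function `F_1 = g_{χ_1} - ∑ g_{u_i} η_i` of
`D = ∑ (g_{u_i} ∂_{u_i} + g_{η_i} ∂_{η_i} + g_{ξ_i} ∂_{ξ_i}) + ∑ g_{χ_s} ∂_{χ_s}`; it is the coefficient
of `Y_{χ_1}` in the decomposition of `D` with respect to the fields `Y`. -/
def mbF1 (D : Der K (tildeN N)) : O K (tildeN N) :=
  D (X (ichi 0)) - ∑ i, D (X (iu i)) * X (ieta i)

/-- The generating function `F_2 = g_{χ_2} - ∑ g_{u_i} ξ_i - ∑ g_{η_i} ξ_j ξ_k`, the coefficient of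
`Y_{χ_2}`. -/
def mbF2 (D : Der K (tildeN N)) : O K (tildeN N) :=
  D (X (ichi 1)) - ∑ i, D (X (iu i)) * X (ixi i) -
    ∑ i, D (X (ieta i)) * (X (ixi (i + 1)) * X (ixi (i + 2)))

/-- The defining functions `f = (f_1, …, f_5)` of `D = X^f`: `f_1, f_2, f_3` are the coefficients of
`η_1, η_2, η_3` in `F_1`, and `f_4`, `f_5` are the values of `F_1`, `F_2` at `η = ξ = 0`. -/
def mbFun (D : Der K (tildeN N)) : Fin 5 → O K N :=
  ![restr K N (pd (ieta 0) (mbF1 D)), restr K N (pd (ieta 1) (mbF1 D)),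
    restr K N (pd (ieta 2) (mbF1 D)), restr K N (mbF1 D), restr K N (mbF2 D)]

end FMb

/-- The shearing vector `N_∞`: no bound on the exponents of the five indeterminates. -/
abbrev Ninf : Fin 5 → WithTop ℕ+ := fun _ => ⊤

end

end CharTwo5

/-!
The fields `Y_ξ`, `Y_η`, the fields `Y_u = ∂_u + η ∂_χ₁ + ξ ∂_χ₂` and `∂_χ₁`, `∂_χ₂` form a frame;
the coefficients of `X` at the last two are `F_1` and `F_2`. In this frame the condition on `X`
becomes a system of first-order equations for `F_1` and `F_2`: the restriction of a solution to
`η = ξ = 0` determines it, its divergence vanishes, and every divergence-free restriction occurs,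
because the Taylor expansion in `η` and `ξ` can be written down.

`F(kle)` is a Lie algebra and `ψ` is an injective map into it that carries `[D, E] + c(D, E)` to
the bracket, so the Jacobi identity makes `c` a cocycle. A primitive of `c` would contradict its
value on the commuting fields `u_1 ∂_4` and `u_2 ∂_5`.

Let all `N_i` be infinite. A nonzero constant field acts on `svect` surjectively and locally
nilpotently, for both brackets since `c` vanishes on it. On a finite-dimensional quotient by an
invariant subspace a surjective operator is injective, so a proper subalgebra of finite codimension
contains no nonzero constant field. In codimension `5` it would be complementary to the constant
fields, hence contain `u_2 ∂_4 + v` and `u_3 ∂_5 + w` for some constant `v` and `w`; but the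
deformed bracket of these two is a nonzero constant field.
-/

namespace CharTwo5

noncomputable section

/-! ### Divided power algebras -/

section DividedPowers

theorem single_one_le {ι : Type*} [DecidableEq ι] {r : ι → ℕ} {i : ι} (hr : r i ≠ 0) :
    Pi.single i 1 ≤ r :=
  update_le_iff.2 ⟨Nat.one_le_iff_ne_zero.2 hr, fun _ _ => Nat.zero_le _⟩

namespace DivPow

variable {K ι : Type*} [Field K]

instance : Nontrivial (DivPow K ι) := inferInstanceAs (Nontrivial ((ι → ℕ) →₀ K))

theorem ext_coeff {f g : DivPow K ι} (h : ∀ r, coeff r f = coeff r g) : f = g := Finsupp.ext h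

variable [Fintype ι]

theorem coeff_zero_mul (f g : DivPow K ι) : coeff 0 (f * g) = coeff 0 f * coeff 0 g := by
  classical
  have h : (mulHom (K := K) (ι := ι)).compr₂ (coeff 0) =
      (LinearMap.mul K K).compl₁₂ (coeff 0) (coeff 0) := by
    refine hom_ext fun r => hom_ext fun s => ?_
    rw [LinearMap.compr₂_apply, LinearMap.compl₁₂_apply, LinearMap.mul_apply', ← mul_def,
      mon_mul_mon, map_smul, coeff_mon, coeff_mon, coeff_mon]
    by_cases hr : r = 0
    · simp [hr]
    · rw [if_neg hr, if_neg fun h => hr (add_eq_zero.1 h).1, smul_zero, zero_mul]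
  exact LinearMap.congr_fun (LinearMap.congr_fun h f) g

theorem coeff_pd [DecidableEq ι] (i : ι) (r : ι → ℕ) (f : DivPow K ι) :
    coeff r (pd i f) = coeff (r + Pi.single i 1) f := by
  classical
  have h : (coeff r).comp (pdHom i : DivPow K ι →ₗ[K] DivPow K ι) = coeff (r + Pi.single i 1) := by
    refine hom_ext fun s => ?_
    rw [LinearMap.comp_apply, pdHom_mon, coeff_mon]
    by_cases hs : s i = 0
    · rw [if_pos hs, map_zero, if_neg]
      rintro rfl
      simp at hs
    · rw [if_neg hs, coeff_mon]
      exact if_congr (tsub_eq_iff_eq_add_of_le (single_one_le hs)) rfl rfl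
  exact LinearMap.congr_fun h f

variable [CharP K 2]

theorem coeff_eq_zero_of_mem_trunc {N : ι → WithTop ℕ+} {f : DivPow K ι}
    (hf : f ∈ trunc K N) {r : ι → ℕ} (hr : r ∉ Bounded N) : coeff r f = 0 := by
  classical
  refine LinearMap.mem_ker.1 (map_trunc_le K LinearMap.id (LinearMap.ker (coeff r))
    (fun s hs => LinearMap.mem_ker.2 ?_) hf)
  rw [LinearMap.id_apply, coeff_mon, if_neg]
  rintro rfl
  exact hr hs

end DivPow

variable {K : Type*} [Field K] [CharP K 2] {ι : Type*} [Fintype ι] {N : ι → WithTop ℕ+}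

instance : Nontrivial (O K N) := (O.val (K := K) (N := N)).toRingHom.domain_nontrivial

instance : CharP (O K N) 2 :=
  charP_of_injective_algebraMap (algebraMap K (O K N)).injective 2

variable (K N) in
/-- The value of a function at the origin, which is its constant term. -/
def constTerm : O K N →ₐ[K] K :=
  AlgHom.ofLinearMap ((DivPow.coeff 0).comp O.val.toLinearMap)
    (by
      classical
      change DivPow.coeff 0 (O.val (1 : O K N)) = 1
      rw [map_one, DivPow.one_def, DivPow.coeff_mon, if_pos rfl])
    (fun f g => by
      change DivPow.coeff 0 (O.val (f * g)) = DivPow.coeff 0 (O.val f) * DivPow.coeff 0 (O.val g)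
      rw [map_mul, DivPow.coeff_zero_mul])

variable [DecidableEq ι]

theorem constTerm_X (i : ι) : constTerm K N (X i) = 0 := by
  classical
  change DivPow.coeff 0 (DivPow.mon (Pi.single i 1) : DivPow K ι) = 0
  rw [DivPow.coeff_mon, if_neg]
  simp

theorem X_mul_self (i : ι) : (X i * X i : O K N) = 0 := by
  refine O.ext ?_
  rw [map_mul, X, O.val_mk, DivPow.mon_mul_mon, map_zero,
    ← Finset.mul_prod_erase _ _ (Finset.mem_univ i)]
  simp [CharTwo.two_eq_zero]

theorem pd_pd_self {i : ι} (hi : N i = ((1 : ℕ+) : WithTop ℕ+)) (f : O K N) :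
    pd i (pd i f) = 0 := by
  refine O.ext (DivPow.ext_coeff fun r => ?_)
  rw [pd_val, pd_val, DivPow.coeff_pd, DivPow.coeff_pd, map_zero, map_zero]
  refine DivPow.coeff_eq_zero_of_mem_trunc (O.val_mem f) fun hr => ?_
  have hri := hr i 1 hi
  simp at hri

theorem constTerm_vect_apply {D : Der K N} (hD : D ∈ vect K N) (f : O K N) :
    constTerm K N (D f) = ∑ i, constTerm K N (D (X i)) * constTerm K N (pd i f) := by
  simp only [vect_apply hD f, map_sum, map_mul]

theorem pd_mem_vect (i : ι) : (pd i : Der K N) ∈ vect K N := by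
  simpa only [one_smul] using smul_pd_mem_vect (1 : O K N) i

theorem svect_ext {D E : svect K N} (h : ∀ j, (D : Der K N) (X j) = (E : Der K N) (X j)) : D = E :=
  Subtype.ext (vect_ext D.2.1 E.2.1 h)

variable (K N) in
/-- The divergence-free field `u_i ∂_j` with `i ≠ j`, the analogue of an elementary matrix. -/
def elementaryField (i j : ι) (h : i ≠ j) : svect K N :=
  ⟨X i • pd j, smul_pd_mem_vect _ _, by
    simp only [div, smul_pd_X]
    refine Finset.sum_eq_zero fun k _ => ?_
    split_ifs with hk
    · subst hk; rw [pd_X, if_neg h.symm]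
    · rw [map_zero]⟩

theorem elementaryField_apply (i j : ι) (h : i ≠ j) (f : O K N) :
    (elementaryField K N i j h : Der K N) f = X i * pd j f := rfl

theorem elementaryField_X (i j k : ι) (h : i ≠ j) :
    (elementaryField K N i j h : Der K N) (X k) = if j = k then X i else 0 := smul_pd_X _ _ _

theorem constTerm_elementaryField_apply (i j : ι) (h : i ≠ j) (f : O K N) :
    constTerm K N ((elementaryField K N i j h : Der K N) f) = 0 := by
  rw [elementaryField_apply, map_mul, constTerm_X, zero_mul]

theorem elementaryField_lie_elementaryField {i j k l : ι} (hij : i ≠ j) (hkl : k ≠ l)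
    (hjk : j ≠ k) (hli : l ≠ i) :
    ⁅elementaryField K N i j hij, elementaryField K N k l hkl⁆ = 0 :=
  svect_ext fun m => by
    change (elementaryField K N i j hij : Der K N) ((elementaryField K N k l hkl : Der K N) (X m)) -
      (elementaryField K N k l hkl : Der K N) ((elementaryField K N i j hij : Der K N) (X m)) = 0
    rw [elementaryField_X, elementaryField_X, elementaryField_apply, elementaryField_apply]
    split_ifs <;> simp [pd_X, hjk, hli]

end DividedPowers

/-! ### The cocycle and the embedding into `F(kle)` -/

section Cocycle

open LieModule.Cohomology

theorem mem_twoCocycle_of_injective {R L M : Type*} [CommRing R] [LieRing L] [LieAlgebra R L]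
    [LieRing M] (c : twoCochain R L L) (hc : ∀ x y z, c.val (c.val x y) z = 0)
    (ψ : L →+ M) (hψ : Function.Injective ψ) (hlie : ∀ x y, ⁅ψ x, ψ y⁆ = ψ (⁅x, y⁆ + c.val x y)) :
    c ∈ twoCocycle R L L := by
  rw [mem_twoCocycle_iff]
  ext x y z
  rw [d₂₃_apply]
  have hskew : ∀ x y, c.val x y = -c.val y x := fun x y => (twoCochain_skew c y x).symm
  have hc' : ∀ x y z, c.val z (c.val x y) = 0 := fun x y z => by rw [hskew, hc, neg_zero]
  have hJacobi := leibniz_lie (ψ x) (ψ y) (ψ z)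
  simp only [hlie, ← map_add] at hJacobi
  have hJacobi := sub_eq_zero.2 (hψ hJacobi)
  simp only [map_add, LinearMap.add_apply, hc, hc', lie_add, add_lie, leibniz_lie x y z] at hJacobi
  change ⁅x, c.val y z⁆ - ⁅y, c.val x z⁆ + ⁅z, c.val x y⁆ - c.val ⁅x, y⁆ z + c.val ⁅x, z⁆ y
    - c.val ⁅y, z⁆ x = 0
  rw [hskew ⁅x, z⁆ y, hskew ⁅y, z⁆ x, ← lie_skew z (c.val x y), ← hJacobi]
  abel

variable {K : Type*} [Field K] [CharP K 2] {N : Fin 5 → WithTop ℕ+}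

theorem cField_X_zero (D E : Der K N) : cField D E (X 0) =
    pd 1 (D (X 3)) * pd 2 (E (X 4)) + pd 1 (D (X 4)) * pd 2 (E (X 3)) +
      (pd 2 (D (X 3)) * pd 1 (E (X 4)) + pd 2 (D (X 4)) * pd 1 (E (X 3))) := by
  simp [cField_eq, pd_X]

theorem cField_X_one (D E : Der K N) : cField D E (X 1) =
    pd 0 (D (X 3)) * pd 2 (E (X 4)) + pd 0 (D (X 4)) * pd 2 (E (X 3)) +
      (pd 2 (D (X 3)) * pd 0 (E (X 4)) + pd 2 (D (X 4)) * pd 0 (E (X 3))) := by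
  simp [cField_eq, pd_X]

theorem cField_X_two (D E : Der K N) : cField D E (X 2) =
    pd 0 (D (X 3)) * pd 1 (E (X 4)) + pd 0 (D (X 4)) * pd 1 (E (X 3)) +
      (pd 1 (D (X 3)) * pd 0 (E (X 4)) + pd 1 (D (X 4)) * pd 0 (E (X 3))) := by
  simp [cField_eq, pd_X]

theorem cField_X_natAdd (D E : Der K N) (s : Fin 2) : cField D E (X (s.natAdd 3)) = 0 := by
  fin_cases s <;> simp [cField_eq, pd_X]

theorem cField_cField_left (D E F : Der K N) : cField (cField D E) F = 0 := by
  have h3 : cField D E (X 3) = 0 := cField_X_natAdd D E 0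
  have h4 : cField D E (X 4) = 0 := cField_X_natAdd D E 1
  simp [cField_eq (cField D E), h3, h4]

theorem psi_injective : Function.Injective (psi K N) := fun _ _ h => congrArg Prod.fst h

theorem lieForm_Z {D : Der K N} (hD : D ∈ vect K N) (i : Fin 5) (E : Der K N) (a b : Fin 5) :
    lieForm D (Z i E) a b = pd a (D (X i)) * pd b (E (X i)) - pd b (D (X i)) * pd a (E (X i)) +
      (pd a (X i) * pd b (D (E (X i))) - pd b (X i) * pd a (D (E (X i)))) := by
  have hconst (a b : Fin 5) : D (pd a (X b) : O K N) = 0 := by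
    rw [pd_X]
    split_ifs <;> simp only [Derivation.map_one_eq_zero, map_zero]
  have hsum (f : Fin 5 → O K N) : ∑ k, f k * pd k (X i) = f i := by
    simp only [pd_X, mul_ite, mul_one, mul_zero, Finset.sum_ite_eq', Finset.mem_univ, if_true]
  have hpd (a : Fin 5) := pd_vect hD a (E (X i))
  have hexp : lieForm D (Z i E) a b = D (Z i E a b) +
      ((∑ k, pd a (D (X k)) * pd k (X i)) * pd b (E (X i)) -
        pd b (X i) * (∑ k, pd a (D (X k)) * pd k (E (X i))) +
      (pd a (X i) * (∑ k, pd b (D (X k)) * pd k (E (X i))) -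
        (∑ k, pd b (D (X k)) * pd k (X i)) * pd a (E (X i)))) := by
    rw [lieForm]
    congr 1
    simp only [Z, Finset.mul_sum, Finset.sum_mul, ← Finset.sum_sub_distrib,
      ← Finset.sum_add_distrib]
    exact Finset.sum_congr rfl fun k _ => by ring
  rw [hexp, hsum, hsum, hpd, hpd, Z, map_sub, Derivation.leibniz, Derivation.leibniz, hconst,
    hconst]
  simp only [smul_eq_mul]
  ring

theorem lieForm_Z_sub {D E : Der K N} (hD : D ∈ vect K N) (hE : E ∈ vect K N) (i : Fin 5) :
    lieForm D (Z i E) - lieForm E (Z i D) = Z i ⁅D, E⁆ := by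
  funext a b
  simp only [Pi.sub_apply, lieForm_Z hD, lieForm_Z hE, Z, Derivation.commutator_apply, map_sub]
  linear_combination (pd a (D (X i)) * pd b (E (X i)) - pd b (D (X i)) * pd a (E (X i))) *
    (two_eq_zero : (2 : O K N) = 0)

theorem Z_add_of_apply_eq_zero (i : Fin 5) (D E : Der K N) (h : E (X i) = 0) :
    Z i (D + E) = Z i D := by
  funext a b
  simp only [Z, Derivation.add_apply, h, add_zero]

theorem wedgeField_Z (D E : Der K N) :
    wedgeField (Z 3 D + Z 4 D) (Z 3 E + Z 4 E) = cField D E := by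
  refine vect_ext (wedgeField_mem_vect _ _) (cField_mem D E).1 fun m => ?_
  rw [wedgeField_X]
  obtain ⟨r0, r1, r2, r3, r4⟩ := wedgeCoeff_values (Z 3 D + Z 4 D) (Z 3 E + Z 4 E)
  fin_cases m <;> simp only [Fin.zero_eta, Fin.isValue, Fin.mk_one, Fin.reduceFinMk]
  · rw [r0, cField_X_zero]
    simp only [Z, Pi.add_apply, pd_X, Fin.reduceEq, if_true, if_false]
    grind
  · rw [r1, cField_X_one]
    simp only [Z, Pi.add_apply, pd_X, Fin.reduceEq, if_true, if_false]
    grind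
  · rw [r2, cField_X_two]
    simp only [Z, Pi.add_apply, pd_X, Fin.reduceEq, if_true, if_false]
    grind
  · rw [r3, show cField D E (X 3) = 0 from cField_X_natAdd D E 0]; simp [Z, pd_X]
  · rw [r4, show cField D E (X 4) = 0 from cField_X_natAdd D E 1]; simp [Z, pd_X]

/-- The form `Z_4(D) + Z_5(D)`, the component of `ψ(D)` in `dΩ¹`. -/
def psiForm (D : svect K N) : dOmega1 K N :=
  ⟨Z 3 (D : Der K N), Z_mem _ _⟩ + ⟨Z 4 (D : Der K N), Z_mem _ _⟩

theorem coe_psiForm (D : svect K N) : (psiForm D : Form2 K N) = Z 3 (D : Der K N) + Z 4 D := rfl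

theorem psi_apply (D : svect K N) : psi K N D = ((D, psiForm D) : FKle K N) := rfl

theorem wedgeS_psiForm (D E : svect K N) :
    wedgeS (psiForm D) (psiForm E) = (cCochain K N).val D E :=
  Subtype.ext (wedgeField_Z (D : Der K N) (E : Der K N))

theorem lieS_psiForm (D E : svect K N) :
    lieS D (psiForm E) - lieS E (psiForm D) = psiForm (⁅D, E⁆ + (cCochain K N).val D E) := by
  refine Subtype.ext ?_
  have hZ : ∀ s : Fin 2, Z (s.natAdd 3) (⁅(D : Der K N), (E : Der K N)⁆ + cField (D : Der K N) E) =
      lieForm (D : Der K N) (Z (s.natAdd 3) (E : Der K N)) -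
        lieForm (E : Der K N) (Z (s.natAdd 3) (D : Der K N)) := fun s => by
    rw [Z_add_of_apply_eq_zero _ _ _ (cField_X_natAdd _ _ s), lieForm_Z_sub D.2.1 E.2.1]
  change lieForm (D : Der K N) (psiForm E : Form2 K N) -
      lieForm (E : Der K N) (psiForm D : Form2 K N) =
    Z ((0 : Fin 2).natAdd 3) (⁅(D : Der K N), (E : Der K N)⁆ + cField (D : Der K N) E) +
      Z ((1 : Fin 2).natAdd 3) (⁅(D : Der K N), (E : Der K N)⁆ + cField (D : Der K N) E)
  rw [hZ, hZ, coe_psiForm, coe_psiForm, lieForm_add_right, lieForm_add_right]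
  exact add_sub_add_comm _ _ _ _

theorem psi_lie (D E : svect K N) :
    ⁅psi K N D, psi K N E⁆ = psi K N (⁅D, E⁆ + (cCochain K N).val D E) := by
  rw [FKle.lie_def, psi_apply, psi_apply, psi_apply, ← lieS_psiForm, ← wedgeS_psiForm]

theorem cCochain_mem_twoCocycle : cCochain K N ∈ twoCocycle K (svect K N) (svect K N) :=
  mem_twoCocycle_of_injective _ (fun _ _ _ => Subtype.ext (cField_cField_left _ _ _))
    (psi K N).toAddMonoidHom psi_injective psi_lie

-- The fields `D = u_1 ∂_4` and `E = u_2 ∂_5` commute and `c(D, E) = ∂_3`, whereas a coboundary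
-- `[D, b(E)] - [E, b(D)]` has no constant `∂_3`-term.
theorem cCochain_not_coboundary : cCochain K N ∉
    LinearMap.range (d₁₂ K (svect K N) (svect K N)) := by
  rintro ⟨b, hb⟩
  set D := elementaryField K N 0 3 (by decide) with hD
  set E := elementaryField K N 1 4 (by decide) with hE
  have hDE : ⁅D, E⁆ = 0 :=
    elementaryField_lie_elementaryField _ _ (by decide) (by decide)
  have hbc : ⁅D, b E⁆ - ⁅E, b D⁆ = (cCochain K N).val D E := by
    have h : ⁅D, b E⁆ - ⁅E, b D⁆ - b ⁅D, E⁆ = (cCochain K N).val D E :=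
      congrArg (fun f => f.val D E) hb
    rwa [hDE, map_zero, sub_zero] at h
  have hval : constTerm K N
      (((D : Der K N) ((b E : Der K N) (X 2)) - (b E : Der K N) ((D : Der K N) (X 2))) -
        ((E : Der K N) ((b D : Der K N) (X 2)) - (b D : Der K N) ((E : Der K N) (X 2)))) =
      constTerm K N (cField (D : Der K N) E (X 2)) :=
    congrArg (fun F : svect K N => constTerm K N ((F : Der K N) (X 2))) hbc
  have hleft : (D : Der K N) (X 2) = 0 ∧ (E : Der K N) (X 2) = 0 := by
    simp [hD, hE, elementaryField_X]
  have hright : cField (D : Der K N) E (X 2) = 1 := by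
    rw [cField_X_two]
    simp [hD, hE, elementaryField_X, pd_X]
  rw [hleft.1, hleft.2, hright, map_zero, map_zero, sub_zero, sub_zero, map_sub,
    constTerm_elementaryField_apply, constTerm_elementaryField_apply, sub_zero, map_one] at hval
  exact zero_ne_one hval

end Cocycle

/-! ### Restriction to `η = ξ = 0` -/

section Restriction

variable {K : Type*} [Field K]

theorem coeff_restrHom (s : Fin 5 → ℕ) (f : DivPow K MbIdx) :
    DivPow.coeff s (restrHom K f) = DivPow.coeff (Sum.elim s 0) f := by
  classical
  have h : (DivPow.coeff s).comp (restrHom K) = DivPow.coeff (Sum.elim s 0) := by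
    refine DivPow.hom_ext fun r => ?_
    rw [LinearMap.comp_apply, restrHom, DivPow.lift_mon, DivPow.coeff_mon]
    by_cases hr : ∀ a, r (Sum.inr a) = 0
    · rw [if_pos hr, DivPow.coeff_mon]
      refine if_congr ⟨?_, fun h => funext fun i => congrFun h (Sum.inl i)⟩ rfl rfl
      rintro rfl
      exact funext fun a => by rcases a with i | a <;> simp [hr]
    · rw [if_neg hr, map_zero, if_neg]
      rintro rfl
      exact hr fun _ => rfl
  exact LinearMap.congr_fun h f

theorem restrHom_mul (f g : DivPow K MbIdx) :
    restrHom K (f * g) = restrHom K f * restrHom K g := by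
  have h : (DivPow.mulHom (K := K) (ι := MbIdx)).compr₂ (restrHom K) =
      (DivPow.mulHom).compl₁₂ (restrHom K) (restrHom K) := by
    refine DivPow.hom_ext fun r => DivPow.hom_ext fun s => ?_
    rw [LinearMap.compr₂_apply, LinearMap.compl₁₂_apply, ← DivPow.mul_def, ← DivPow.mul_def,
      DivPow.mon_mul_mon, map_smul]
    simp only [restrHom, DivPow.lift_mon]
    by_cases hr : ∀ a, r (Sum.inr a) = 0
    · by_cases hs : ∀ a, s (Sum.inr a) = 0
      · rw [if_pos hr, if_pos hs, if_pos fun a => by simp [hr a, hs a], DivPow.mon_mul_mon,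
          Fintype.prod_sum_type,
          Finset.prod_eq_one (s := (Finset.univ : Finset (Fin 3 ⊕ Fin 3))) fun a _ => by
            simp [hr a], mul_one]
        rfl
      · rw [if_neg hs, mul_zero, if_neg, smul_zero]
        exact fun h => hs fun a => (Nat.add_eq_zero_iff.1 (h a)).2
    · rw [if_neg hr, zero_mul, if_neg, smul_zero]
      exact fun h => hr fun a => (Nat.add_eq_zero_iff.1 (h a)).1
  exact LinearMap.congr_fun (LinearMap.congr_fun h f) g

variable (K) in
/-- The inclusion of the divided power polynomials in `u_1, …, u_5` into those in the eleven
indeterminates, a section of `restrHom`. -/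
def embHom : DivPow K (Fin 5) →ₗ[K] DivPow K MbIdx :=
  DivPow.lift fun s => DivPow.mon (Sum.elim s 0)

theorem coeff_embHom (r : MbIdx → ℕ) (f : DivPow K (Fin 5)) : DivPow.coeff r (embHom K f) =
    if ∀ a, r (Sum.inr a) = 0 then DivPow.coeff (fun i => r (Sum.inl i)) f else 0 := by
  classical
  have h : (DivPow.coeff r).comp (embHom K) =
      if ∀ a, r (Sum.inr a) = 0 then DivPow.coeff (fun i => r (Sum.inl i)) else 0 := by
    refine DivPow.hom_ext fun s => ?_
    rw [LinearMap.comp_apply, embHom, DivPow.lift_mon, DivPow.coeff_mon]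
    split_ifs with hs hr hr
    · subst hs
      exact (if_pos rfl).symm
    · subst hs
      exact absurd (fun _ => rfl) hr
    · rw [DivPow.coeff_mon, if_neg]
      rintro rfl
      exact hs (funext fun a => by rcases a with i | a <;> simp [hr])
    · rfl
  rw [← LinearMap.comp_apply, h]
  split_ifs <;> rfl

variable [CharP K 2] {N : Fin 5 → WithTop ℕ+}

theorem coeff_restr (s : Fin 5 → ℕ) (f : O K (tildeN N)) :
    DivPow.coeff s (O.val (restr K N f)) = DivPow.coeff (Sum.elim s 0) (O.val f) :=
  coeff_restrHom s _

theorem restr_mul (f g : O K (tildeN N)) : restr K N (f * g) = restr K N f * restr K N g :=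
  O.ext (restrHom_mul (O.val f) (O.val g))

theorem restr_X_inr (a : Fin 3 ⊕ Fin 3) : restr K N (X (Sum.inr a)) = 0 := by
  classical
  refine O.ext (DivPow.ext_coeff fun r => ?_)
  rw [coeff_restr, X, O.val_mk, DivPow.coeff_mon, if_neg, map_zero, map_zero]
  intro h
  simpa using congrFun h (Sum.inr a)

theorem restr_pd_inl (i : Fin 5) (f : O K (tildeN N)) :
    restr K N (pd (Sum.inl i) f) = pd i (restr K N f) := by
  refine O.ext (DivPow.ext_coeff fun r => ?_)
  rw [coeff_restr, pd_val, pd_val, DivPow.coeff_pd, DivPow.coeff_pd, coeff_restr]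
  congr 2
  funext a
  rcases a with a | a <;> simp [Pi.single_apply]

theorem pd_inr_pd_inr (a : Fin 3 ⊕ Fin 3) (f : O K (tildeN N)) :
    pd (Sum.inr a) (pd (Sum.inr a) f) = 0 :=
  pd_pd_self (N := tildeN N) (i := Sum.inr a) rfl f

theorem embHom_mem {f : DivPow K (Fin 5)} (hf : f ∈ DivPow.trunc K N) :
    embHom K f ∈ DivPow.trunc K (tildeN N) := by
  refine DivPow.map_trunc_le K (embHom K) (Subalgebra.toSubmodule (DivPow.trunc K (tildeN N)))
    (fun r hr => ?_) hf
  rw [embHom, DivPow.lift_mon]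
  refine DivPow.mon_mem_trunc K fun a n hn => ?_
  rcases a with a | a
  · exact hr a n hn
  · simp

variable (K N) in
/-- The inclusion of the functions of `u_1, …, u_5` into the functions of the eleven
indeterminates, a section of `restr`. -/
def emb : O K N →ₗ[K] O K (tildeN N) :=
  ((embHom K).comp O.val.toLinearMap).codRestrict
    (Subalgebra.toSubmodule (DivPow.trunc K (tildeN N))) fun f => embHom_mem (O.val_mem f)

theorem coeff_emb (r : MbIdx → ℕ) (f : O K N) : DivPow.coeff r (O.val (emb K N f)) =
    if ∀ a, r (Sum.inr a) = 0 then DivPow.coeff (fun i => r (Sum.inl i)) (O.val f) else 0 :=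
  coeff_embHom r _

theorem restr_emb (f : O K N) : restr K N (emb K N f) = f := by
  refine O.ext (DivPow.ext_coeff fun r => ?_)
  rw [coeff_restr, coeff_emb]
  exact if_pos fun _ => rfl

theorem pd_inl_emb (i : Fin 5) (f : O K N) : pd (Sum.inl i) (emb K N f) = emb K N (pd i f) := by
  refine O.ext (DivPow.ext_coeff fun r => ?_)
  rw [pd_val, DivPow.coeff_pd, coeff_emb, coeff_emb, pd_val, DivPow.coeff_pd]
  refine if_congr (by simp) ?_ rfl
  congr 2
  funext j
  simp [Pi.single_apply]

theorem pd_inr_emb (a : Fin 3 ⊕ Fin 3) (f : O K N) : pd (Sum.inr a) (emb K N f) = 0 := by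
  refine O.ext (DivPow.ext_coeff fun r => ?_)
  rw [pd_val, DivPow.coeff_pd, coeff_emb, if_neg, map_zero, map_zero]
  intro h
  simpa using h a

variable (K N) in
/-- The ideal of the functions vanishing to order `n` on `η = ξ = 0`: all of their monomials have
degree at least `n` in `η` and `ξ`. The recursion through derivatives is the form in which these
ideals are used. -/
def vanishingIdeal : ℕ → Ideal (O K (tildeN N))
  | 0 => ⊤
  | n + 1 =>
    { carrier := {g | g ∈ vanishingIdeal n ∧ restr K N g = 0 ∧
        ∀ a, pd (Sum.inr a) g ∈ vanishingIdeal n}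
      zero_mem' := ⟨zero_mem _, map_zero _, fun a => by rw [map_zero]; exact zero_mem _⟩
      add_mem' := fun {f g} hf hg => ⟨add_mem hf.1 hg.1, by rw [map_add, hf.2.1, hg.2.1, add_zero],
        fun a => by rw [map_add]; exact add_mem (hf.2.2 a) (hg.2.2 a)⟩
      smul_mem' := fun f g hg => ⟨Ideal.mul_mem_left _ _ hg.1, by
        rw [smul_eq_mul, restr_mul, hg.2.1, mul_zero], fun a => by
        rw [smul_eq_mul, Derivation.leibniz]
        exact add_mem (Ideal.mul_mem_left _ _ (hg.2.2 a)) (Ideal.mul_mem_right _ _ hg.1)⟩ }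

theorem mem_vanishingIdeal_succ {n : ℕ} {g : O K (tildeN N)} : g ∈ vanishingIdeal K N (n + 1) ↔
    g ∈ vanishingIdeal K N n ∧ restr K N g = 0 ∧ ∀ a, pd (Sum.inr a) g ∈ vanishingIdeal K N n :=
  Iff.rfl

theorem pd_inl_mem_vanishingIdeal {n : ℕ} {g : O K (tildeN N)} (i : Fin 5)
    (hg : g ∈ vanishingIdeal K N n) : pd (Sum.inl i) g ∈ vanishingIdeal K N n := by
  induction n generalizing g with
  | zero => trivial
  | succ n ih =>
    refine ⟨ih hg.1, by rw [restr_pd_inl, hg.2.1, map_zero], fun a => ?_⟩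
    rw [pd_comm]
    exact ih (hg.2.2 a)

theorem coeff_eq_zero_of_mem_vanishingIdeal {n : ℕ} {g : O K (tildeN N)}
    (hg : g ∈ vanishingIdeal K N n) {r : MbIdx → ℕ} (hr : ∑ a, r (Sum.inr a) < n) :
    DivPow.coeff r (O.val g) = 0 := by
  induction n generalizing g r with
  | zero => exact absurd hr (Nat.not_lt_zero _)
  | succ n ih =>
    by_cases h : ∀ a, r (Sum.inr a) = 0
    · have hr0 : r = Sum.elim (fun i => r (Sum.inl i)) 0 :=
        funext fun a => by rcases a with i | a <;> simp [h]
      rw [hr0, ← coeff_restr, hg.2.1, map_zero, map_zero]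
    · push Not at h
      obtain ⟨a, ha⟩ := h
      rw [← tsub_add_cancel_of_le (single_one_le ha), ← DivPow.coeff_pd, ← pd_val]
      refine ih (hg.2.2 a) (lt_of_lt_of_le
        (Finset.sum_lt_sum (fun _ _ => tsub_le_self) ⟨a, Finset.mem_univ _, ?_⟩)
        (Nat.lt_succ_iff.1 hr))
      simpa [Nat.sub_lt_iff_lt_add] using Nat.pos_of_ne_zero ha

theorem eq_zero_of_mem_vanishingIdeal {g : O K (tildeN N)} (h : ∀ n, g ∈ vanishingIdeal K N n) :
    g = 0 :=
  O.ext (DivPow.ext_coeff fun r => by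
    rw [coeff_eq_zero_of_mem_vanishingIdeal (h _) (Nat.lt_succ_self (∑ a, r (Sum.inr a))),
      map_zero, map_zero])

end Restriction

/-! ### The frame `Y` and the equations defining `F(mb(3; N | 8))` -/

/-- `(a, b, c)` is a permutation of `(1, 2, 3)`. In characteristic `2` the formulas for the frame
fields do not depend on the parity of the permutation. -/
structure IsPerm3 (a b c : Fin 3) : Prop where
  ne₁₂ : a ≠ b
  ne₁₃ : a ≠ c
  ne₂₃ : b ≠ c

namespace IsPerm3

theorem succ (a : Fin 3) : IsPerm3 a (a + 1) (a + 2) :=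
  ⟨by revert a; decide, by revert a; decide, by revert a; decide⟩

theorem exists_of_ne {a b : Fin 3} (h : a ≠ b) : ∃ c, IsPerm3 a b c := by
  obtain ⟨c, hac, hbc⟩ : ∃ c, a ≠ c ∧ b ≠ c := by revert a b; decide
  exact ⟨c, h, hac, hbc⟩

variable {a b c : Fin 3} (h : IsPerm3 a b c)
include h

theorem swap₁₂ : IsPerm3 b a c := ⟨h.ne₁₂.symm, h.ne₂₃, h.ne₁₃⟩

theorem swap₂₃ : IsPerm3 a c b := ⟨h.ne₁₃, h.ne₁₂, h.ne₂₃.symm⟩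

theorem swap₁₃ : IsPerm3 c b a := ⟨h.ne₂₃.symm, h.ne₁₃.symm, h.ne₁₂.symm⟩

theorem rotate : IsPerm3 b c a := h.swap₁₂.swap₂₃

theorem ne : (a ≠ b ∧ b ≠ a) ∧ (a ≠ c ∧ c ≠ a) ∧ b ≠ c ∧ c ≠ b :=
  ⟨⟨h.ne₁₂, h.ne₁₂.symm⟩, ⟨h.ne₁₃, h.ne₁₃.symm⟩, h.ne₂₃, h.ne₂₃.symm⟩

theorem eq_succ_or : b = a + 1 ∧ c = a + 2 ∨ b = a + 2 ∧ c = a + 1 := by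
  obtain ⟨h₁, h₂, h₃⟩ := h
  revert a b c
  decide

theorem eq_or (i : Fin 3) : i = a ∨ i = b ∨ i = c := by
  obtain ⟨h₁, h₂, h₃⟩ := h
  revert a b c i
  decide

theorem forall_iff {P : Fin 3 → Prop} : (∀ i, P i) ↔ P a ∧ P b ∧ P c := by
  refine ⟨fun hP => ⟨hP a, hP b, hP c⟩, fun ⟨ha, hb, hc⟩ i => ?_⟩
  obtain rfl | rfl | rfl := h.eq_or i
  exacts [ha, hb, hc]

@[to_additive]
theorem prod_eq {M : Type*} [CommMonoid M] (f : Fin 3 → M) : ∏ i, f i = f a * f b * f c := by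
  have huniv : (Finset.univ : Finset (Fin 3)) = {a, b, c} :=
    (Finset.eq_univ_iff_forall.2 fun i => by simpa using h.eq_or i).symm
  rw [huniv, Finset.prod_insert (by simp [h.ne]), Finset.prod_pair h.ne₂₃, mul_assoc]

theorem mul_succ {M : Type*} [CommMagma M] (f : Fin 3 → M) :
    f (a + 1) * f (a + 2) = f b * f c := by
  obtain ⟨rfl, rfl⟩ | ⟨rfl, rfl⟩ := h.eq_succ_or
  exacts [rfl, mul_comm _ _]

end IsPerm3

section Indices

@[simp] theorem iu_inj {i j : Fin 3} : iu i = iu j ↔ i = j := by simp [iu]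
@[simp] theorem ichi_inj {i j : Fin 2} : ichi i = ichi j ↔ i = j :=
  Sum.inl_injective.eq_iff.trans (Fin.natAdd_inj 3)
@[simp] theorem ieta_inj {i j : Fin 3} : ieta i = ieta j ↔ i = j := by simp [ieta]
@[simp] theorem ixi_inj {i j : Fin 3} : ixi i = ixi j ↔ i = j := by simp [ixi]
@[simp] theorem iu_ne_ichi (i : Fin 3) (s : Fin 2) : iu i ≠ ichi s := by
  revert i s; simp only [iu, ichi]; decide
@[simp] theorem ichi_ne_iu (s : Fin 2) (i : Fin 3) : ichi s ≠ iu i := (iu_ne_ichi i s).symm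
@[simp] theorem iu_ne_ieta (i j : Fin 3) : iu i ≠ ieta j := Sum.inl_ne_inr
@[simp] theorem ieta_ne_iu (i j : Fin 3) : ieta i ≠ iu j := Sum.inr_ne_inl
@[simp] theorem iu_ne_ixi (i j : Fin 3) : iu i ≠ ixi j := Sum.inl_ne_inr
@[simp] theorem ixi_ne_iu (i j : Fin 3) : ixi i ≠ iu j := Sum.inr_ne_inl
@[simp] theorem ichi_ne_ieta (s : Fin 2) (i : Fin 3) : ichi s ≠ ieta i := Sum.inl_ne_inr
@[simp] theorem ieta_ne_ichi (i : Fin 3) (s : Fin 2) : ieta i ≠ ichi s := Sum.inr_ne_inl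
@[simp] theorem ichi_ne_ixi (s : Fin 2) (i : Fin 3) : ichi s ≠ ixi i := Sum.inl_ne_inr
@[simp] theorem ixi_ne_ichi (i : Fin 3) (s : Fin 2) : ixi i ≠ ichi s := Sum.inr_ne_inl
@[simp] theorem ieta_ne_ixi (i j : Fin 3) : ieta i ≠ ixi j := by simp [ieta, ixi]
@[simp] theorem ixi_ne_ieta (i j : Fin 3) : ixi i ≠ ieta j := by simp [ieta, ixi]

theorem forall_fin_five {P : Fin 5 → Prop} :
    (∀ i, P i) ↔ (∀ i : Fin 3, P (i.castLE (by norm_num))) ∧ ∀ s : Fin 2, P (s.natAdd 3) :=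
  Fin.forall_fin_add (m := 3) (n := 2) P

theorem forall_mbIdx {P : MbIdx → Prop} : (∀ k, P k) ↔
    ((∀ i, P (iu i)) ∧ ∀ s, P (ichi s)) ∧ (∀ i, P (ieta i)) ∧ ∀ i, P (ixi i) := by
  rw [Sum.forall, Sum.forall, forall_fin_five]
  rfl

end Indices

section Frame

variable {K : Type*} [Field K] [CharP K 2]

theorem smul_mem_vect {ι : Type*} [Fintype ι] [DecidableEq ι] {N : ι → WithTop ℕ+} (a : O K N)
    {D : Der K N} (hD : D ∈ vect K N) : a • D ∈ vect K N := by
  obtain ⟨f, rfl⟩ := hD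
  exact ⟨fun i => a * f i, by simp only [Finset.smul_sum, mul_smul]⟩

variable {N : Fin 5 → WithTop ℕ+} {a b c : Fin 3} (g : O K (tildeN N))

theorem Yxi_apply (i : Fin 3) : Yxi K N i g = pd (ixi i) g := rfl

theorem Yeta_apply (h : IsPerm3 a b c) : Yeta K N a g = pd (ieta a) g +
    (X (ixi c) * pd (iu b) g + X (ixi b) * pd (iu c) g) +
    (X (ixi c) * X (ieta b) + X (ixi b) * X (ieta c)) * pd (ichi 0) g +
    X (ixi b) * X (ixi c) * pd (ichi 1) g := by
  simp only [Yeta, Derivation.add_apply, Derivation.sub_apply, Derivation.smul_apply, smul_eq_mul,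
    CharTwo.sub_eq_add]
  obtain ⟨rfl, rfl⟩ | ⟨rfl, rfl⟩ := h.eq_succ_or <;> ring

variable (K N) in
/-- The field `Y_{u_i} = ∂_{u_i} + η_i ∂_{χ_1} + ξ_i ∂_{χ_2}`, the bracket of `Y_{ξ_j}` and
`Y_{η_k}` for `{i, j, k} = {1, 2, 3}`, which completes the `Y_{ξ_i}`, `Y_{η_i}`, `∂_{χ_s}` to a
frame. -/
def Yu (i : Fin 3) : Der K (tildeN N) :=
  pd (iu i) + (X (ieta i) : O K (tildeN N)) • pd (ichi 0) +
    (X (ixi i) : O K (tildeN N)) • pd (ichi 1)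

theorem Yu_apply (i : Fin 3) : Yu K N i g =
    pd (iu i) g + X (ieta i) * pd (ichi 0) g + X (ixi i) * pd (ichi 1) g := rfl

theorem Yxi_mem_vect (i : Fin 3) : Yxi K N i ∈ vect K (tildeN N) := pd_mem_vect _

theorem Yeta_mem_vect (i : Fin 3) : Yeta K N i ∈ vect K (tildeN N) :=
  (vect K (tildeN N)).sub_mem ((vect K (tildeN N)).add_mem ((vect K (tildeN N)).add_mem
    (pd_mem_vect _) ((vect K (tildeN N)).sub_mem (smul_pd_mem_vect _ _) (smul_pd_mem_vect _ _)))
    (smul_pd_mem_vect _ _)) (smul_pd_mem_vect _ _)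

theorem Yu_mem_vect (i : Fin 3) : Yu K N i ∈ vect K (tildeN N) :=
  (vect K (tildeN N)).add_mem ((vect K (tildeN N)).add_mem (pd_mem_vect _) (smul_pd_mem_vect _ _))
    (smul_pd_mem_vect _ _)

theorem Yeta_xi (i j : Fin 3) : Yeta K N i (X (ixi j)) = 0 := by
  simp [Yeta_apply _ (.succ i), pd_X]

theorem Yeta_eta (i j : Fin 3) : Yeta K N i (X (ieta j)) = if i = j then 1 else 0 := by
  simp [Yeta_apply _ (.succ i), pd_X]

theorem Yeta_u_self (i : Fin 3) : Yeta K N i (X (iu i)) = 0 := by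
  simp [Yeta_apply _ (.succ i), pd_X, (IsPerm3.succ i).ne]

theorem Yeta_u (h : IsPerm3 a b c) : Yeta K N a (X (iu b)) = X (ixi c) := by
  simp [Yeta_apply _ h, pd_X, h.ne]

theorem Yeta_chi_zero (h : IsPerm3 a b c) : Yeta K N a (X (ichi 0)) =
    X (ixi c) * X (ieta b) + X (ixi b) * X (ieta c) := by
  simp [Yeta_apply _ h, pd_X]

theorem Yeta_chi_one (h : IsPerm3 a b c) : Yeta K N a (X (ichi 1)) = X (ixi b) * X (ixi c) := by
  simp [Yeta_apply _ h, pd_X]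

theorem Yxi_Yxi_self (i : Fin 3) : Yxi K N i (Yxi K N i g) = 0 := pd_inr_pd_inr _ _

theorem Yxi_Yeta (h : IsPerm3 a b c) :
    Yxi K N b (Yeta K N a g) = Yeta K N a (Yxi K N b g) + Yu K N c g := by
  simp only [Yxi_apply, Yeta_apply _ h, Yu_apply, map_add, Derivation.leibniz, smul_eq_mul, pd_X,
    pd_comm (ixi b), ixi_inj, ixi_ne_ieta, h.ne, if_true, if_false]
  ring

theorem Yxi_Yu (a b : Fin 3) :
    Yxi K N a (Yu K N b g) = Yu K N b (Yxi K N a g) + if a = b then pd (ichi 1) g else 0 := by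
  simp only [Yxi_apply, Yu_apply, map_add, Derivation.leibniz, smul_eq_mul, pd_X, pd_comm (ixi a),
    ixi_inj, ixi_ne_ieta, if_false]
  split_ifs <;> ring

theorem Yeta_pd_inl (i : Fin 3) (j : Fin 5) :
    Yeta K N i (pd (Sum.inl j) g) = pd (Sum.inl j) (Yeta K N i g) := by
  have hxi (k : Fin 3) : pd (Sum.inl j) (X (ixi k) : O K (tildeN N)) = 0 := by
    rw [pd_X]; exact if_neg Sum.inl_ne_inr
  have heta (k : Fin 3) : pd (Sum.inl j) (X (ieta k) : O K (tildeN N)) = 0 := by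
    rw [pd_X]; exact if_neg Sum.inl_ne_inr
  simp only [Yeta_apply _ (.succ i), map_add, Derivation.leibniz, smul_eq_mul, hxi, heta,
    pd_comm _ (Sum.inl j) g]
  ring

theorem Yeta_Yu (a b : Fin 3) :
    Yeta K N a (Yu K N b g) = Yu K N b (Yeta K N a g) + if a = b then pd (ichi 0) g else 0 := by
  have hu : Yeta K N a (pd (iu b) g) = pd (iu b) (Yeta K N a g) := Yeta_pd_inl g _ _
  have hchi (s : Fin 2) : Yeta K N a (pd (ichi s) g) = pd (ichi s) (Yeta K N a g) :=
    Yeta_pd_inl g _ _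
  simp only [Yu_apply, map_add, Derivation.leibniz, smul_eq_mul, hu, hchi, Yeta_xi, Yeta_eta]
  split_ifs <;> ring

theorem Yeta_Yeta_self (i : Fin 3) : Yeta K N i (Yeta K N i g) = 0 := by
  obtain ⟨b, c, h⟩ : ∃ b c, IsPerm3 i b c := ⟨_, _, .succ i⟩
  have hu (j : Fin 3) : pd (iu j) (Yeta K N i g) = Yeta K N i (pd (iu j) g) :=
    (Yeta_pd_inl g _ _).symm
  have hchi (s : Fin 2) : pd (ichi s) (Yeta K N i g) = Yeta K N i (pd (ichi s) g) :=
    (Yeta_pd_inl g _ _).symm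
  have heta : pd (ieta i) (Yeta K N i g) = Yeta K N i (pd (ieta i) g) := by
    simp [Yeta_apply _ h, pd_X, pd_comm (ieta i), h.ne]
  have heta_self : pd (ieta i) (pd (ieta i) g) = 0 := pd_inr_pd_inr _ _
  rw [Yeta_apply (Yeta K N i g) h, hu, hu, hchi, hchi, heta]
  simp only [Yeta_apply _ h, heta_self, pd_comm (iu _) (ieta i) g, pd_comm (ichi _) (ieta i) g,
    pd_comm (ichi _) (iu _) g, pd_comm (ichi 1) (ichi 0) g, pd_comm (iu c) (iu b) g]
  grind [X_mul_self (K := K) (N := tildeN N) (ixi b), X_mul_self (K := K) (N := tildeN N) (ixi c)]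

end Frame

section Components

variable {K : Type*} [Field K] [CharP K 2] {N : Fin 5 → WithTop ℕ+} {a b c : Fin 3}
  (D : Der K (tildeN N))

/-- The coefficient `g_{u_i} + ξ_j g_{η_k} + ξ_k g_{η_j}` of `Y_{u_i}` in the decomposition of `D`
with respect to the frame; compare `mbF1` and `mbF2`. -/
def mbC (i : Fin 3) (D : Der K (tildeN N)) : O K (tildeN N) :=
  D (X (iu i)) + (X (ixi (i + 1)) * D (X (ieta (i + 2))) + X (ixi (i + 2)) * D (X (ieta (i + 1))))

theorem mbC_eq (h : IsPerm3 a b c) :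
    mbC a D = D (X (iu a)) + (X (ixi b) * D (X (ieta c)) + X (ixi c) * D (X (ieta b))) := by
  obtain ⟨rfl, rfl⟩ | ⟨rfl, rfl⟩ := h.eq_succ_or <;> simp only [mbC, add_comm]

theorem mbF1_eq (h : IsPerm3 a b c) : mbF1 D = D (X (ichi 0)) +
    (D (X (iu a)) * X (ieta a) + D (X (iu b)) * X (ieta b) + D (X (iu c)) * X (ieta c)) := by
  rw [mbF1, h.sum_eq, CharTwo.sub_eq_add]

theorem mbF2_eq (h : IsPerm3 a b c) : mbF2 D = D (X (ichi 1)) +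
    (D (X (iu a)) * X (ixi a) + D (X (iu b)) * X (ixi b) + D (X (iu c)) * X (ixi c)) +
    (D (X (ieta a)) * (X (ixi b) * X (ixi c)) + D (X (ieta b)) * (X (ixi c) * X (ixi a)) +
      D (X (ieta c)) * (X (ixi a) * X (ixi b))) := by
  have hmul {i j k : Fin 3} (h : IsPerm3 i j k) :
      (X (ixi (i + 1)) * X (ixi (i + 2)) : O K (tildeN N)) = X (ixi j) * X (ixi k) :=
    h.mul_succ fun i => X (ixi i)
  rw [mbF2, h.sum_eq, h.sum_eq, hmul h, hmul h.rotate, hmul h.rotate.rotate, CharTwo.sub_eq_add,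
    CharTwo.sub_eq_add]

theorem eq_sum_frame {D : Der K (tildeN N)} (hD : D ∈ vect K (tildeN N)) :
    D = ∑ i, (D (X (ixi i)) • Yxi K N i + D (X (ieta i)) • Yeta K N i + mbC i D • Yu K N i) +
      mbF1 D • pd (ichi 0) + mbF2 D • pd (ichi 1) := by
  have hY (i : Fin 3) : D (X (ixi i)) • Yxi K N i + D (X (ieta i)) • Yeta K N i +
      mbC i D • Yu K N i ∈ vect K (tildeN N) :=
    (vect K (tildeN N)).add_mem ((vect K (tildeN N)).add_mem (smul_mem_vect _ (Yxi_mem_vect i))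
      (smul_mem_vect _ (Yeta_mem_vect i))) (smul_mem_vect _ (Yu_mem_vect i))
  refine vect_ext hD ((vect K (tildeN N)).add_mem ((vect K (tildeN N)).add_mem
    ((vect K (tildeN N)).toSubmodule.sum_mem fun i _ => hY i) (smul_pd_mem_vect _ _))
    (smul_pd_mem_vect _ _)) ?_
  refine forall_mbIdx.2 ⟨⟨fun i => ?_, Fin.forall_fin_two.2 ⟨?_, ?_⟩⟩, fun i => ?_, fun i => ?_⟩
  · obtain ⟨j, k, h⟩ : ∃ j k, IsPerm3 i j k := ⟨_, _, .succ i⟩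
    simp only [h.sum_eq, Derivation.add_apply, Derivation.smul_apply, smul_eq_mul, Yxi_apply,
      Yu_apply, pd_X, Yeta_u_self, Yeta_u h.swap₁₂, Yeta_u h.rotate.swap₂₃.swap₁₃, mbC_eq D h]
    simp [h.ne]
    grind
  · have h := IsPerm3.succ 0
    simp only [h.sum_eq, Derivation.add_apply, Derivation.smul_apply, smul_eq_mul, Yxi_apply,
      Yu_apply, pd_X, Yeta_chi_zero h, Yeta_chi_zero h.rotate, Yeta_chi_zero h.rotate.rotate,
      mbC_eq D h, mbC_eq D h.rotate, mbC_eq D h.rotate.rotate, mbF1_eq D h]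
    simp
    grind
  · have h := IsPerm3.succ 0
    simp only [h.sum_eq, Derivation.add_apply, Derivation.smul_apply, smul_eq_mul, Yxi_apply,
      Yu_apply, pd_X, Yeta_chi_one h, Yeta_chi_one h.rotate, Yeta_chi_one h.rotate.rotate,
      mbC_eq D h, mbC_eq D h.rotate, mbC_eq D h.rotate.rotate, mbF2_eq D h]
    simp
    grind
  · have h := IsPerm3.succ i
    simp [h.sum_eq, Yxi_apply, Yeta_eta, Yu_apply, pd_X, h.ne]
  · have h := IsPerm3.succ i
    simp [h.sum_eq, Yxi_apply, Yeta_xi, Yu_apply, pd_X, h.ne]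

variable (K N) in
/-- The coefficients of the fields `Y_{u_i}`, `∂_{χ_1}`, `∂_{χ_2}` in the decomposition of a field
with respect to the frame. -/
def frameCoeff : Der K (tildeN N) →ₗ[O K (tildeN N)]
    (Fin 3 → O K (tildeN N)) × O K (tildeN N) × O K (tildeN N) where
  toFun D := (fun i => mbC i D, mbF1 D, mbF2 D)
  map_add' D E := by
    refine Prod.ext (funext fun i => ?_) (Prod.ext ?_ ?_)
    · simp only [mbC, Derivation.add_apply, Prod.fst_add, Pi.add_apply]; ring
    · simp only [mbF1_eq _ (.succ 0), Derivation.add_apply, Prod.snd_add, Prod.fst_add]; ring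
    · simp only [mbF2_eq _ (.succ 0), Derivation.add_apply, Prod.snd_add]; ring
  map_smul' f D := by
    refine Prod.ext (funext fun i => ?_) (Prod.ext ?_ ?_)
    · simp only [mbC, Derivation.smul_apply, smul_eq_mul, RingHom.id_apply, Prod.smul_fst,
        Pi.smul_apply]
      ring
    · simp only [mbF1_eq _ (.succ 0), Derivation.smul_apply, smul_eq_mul, RingHom.id_apply,
        Prod.smul_fst, Prod.smul_snd]
      ring
    · simp only [mbF2_eq _ (.succ 0), Derivation.smul_apply, smul_eq_mul, RingHom.id_apply,
        Prod.smul_snd]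
      ring

theorem frameCoeff_eq_zero_iff :
    frameCoeff K N D = 0 ↔ (∀ i, mbC i D = 0) ∧ mbF1 D = 0 ∧ mbF2 D = 0 :=
  Prod.ext_iff.trans (and_congr funext_iff Prod.ext_iff)

theorem frameCoeff_Yxi (i : Fin 3) : frameCoeff K N (Yxi K N i) = 0 := by
  rw [frameCoeff_eq_zero_iff]
  refine ⟨fun j => ?_, ?_, ?_⟩ <;> simp [mbC, mbF1, mbF2, Yxi_apply, pd_X]

theorem frameCoeff_Yeta (i : Fin 3) : frameCoeff K N (Yeta K N i) = 0 := by
  obtain ⟨b, c, h⟩ : ∃ b c, IsPerm3 i b c := ⟨_, _, .succ i⟩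
  rw [frameCoeff_eq_zero_iff]
  refine ⟨h.forall_iff.2 ⟨?_, ?_, ?_⟩, ?_, ?_⟩
  · simp [mbC_eq _ h, Yeta_u_self, Yeta_eta, h.ne]
  · simp [mbC_eq _ h.rotate, Yeta_u h, Yeta_eta, h.ne, CharTwo.add_self_eq_zero]
  · simp [mbC_eq _ h.rotate.rotate, Yeta_u h.swap₂₃, Yeta_eta, h.ne, CharTwo.add_self_eq_zero]
  · rw [mbF1_eq _ h, Yeta_u_self, Yeta_u h, Yeta_u h.swap₂₃, Yeta_chi_zero h, zero_mul, zero_add,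
      CharTwo.add_self_eq_zero]
  · simp only [mbF2_eq _ h, Yeta_u_self, Yeta_u h, Yeta_u h.swap₂₃, Yeta_chi_one h, Yeta_eta, h.ne,
      if_true, if_false]
    grind

theorem mem_mbDistribution_iff :
    D ∈ mbDistribution K N ↔ D ∈ vect K (tildeN N) ∧ frameCoeff K N D = 0 := by
  constructor
  · intro hD
    induction hD using Submodule.span_induction with
    | mem Y hY =>
      rcases hY with ⟨i, rfl⟩ | ⟨i, rfl⟩
      exacts [⟨Yxi_mem_vect i, frameCoeff_Yxi i⟩, ⟨Yeta_mem_vect i, frameCoeff_Yeta i⟩]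
    | zero => exact ⟨(vect K (tildeN N)).zero_mem, map_zero _⟩
    | add E F _ _ hE hF =>
      exact ⟨(vect K (tildeN N)).add_mem hE.1 hF.1, by rw [map_add, hE.2, hF.2, add_zero]⟩
    | smul f E _ hE => exact ⟨smul_mem_vect f hE.1, by rw [map_smul, hE.2, smul_zero]⟩
  · rintro ⟨hD, h⟩
    obtain ⟨hC, hF1, hF2⟩ := (frameCoeff_eq_zero_iff D).1 h
    rw [eq_sum_frame hD, hF1, hF2, zero_smul, zero_smul, add_zero, add_zero]
    refine Submodule.sum_mem _ fun i _ => ?_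
    rw [hC, zero_smul, add_zero]
    exact add_mem (Submodule.smul_mem _ _ (Submodule.subset_span (.inl ⟨i, rfl⟩)))
      (Submodule.smul_mem _ _ (Submodule.subset_span (.inr ⟨i, rfl⟩)))

end Components

theorem lie_mem_span_of_forall_lie_mem {R A : Type*} [CommRing R] [CommRing A] [Algebra R A]
    {S : Set (Derivation R A A)} {D : Derivation R A A}
    (hS : ∀ Y ∈ S, ⁅D, Y⁆ ∈ Submodule.span A S) {Y : Derivation R A A}
    (hY : Y ∈ Submodule.span A S) : ⁅D, Y⁆ ∈ Submodule.span A S := by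
  induction hY using Submodule.span_induction with
  | mem Y hY => exact hS Y hY
  | zero => rw [lie_zero]; exact zero_mem _
  | add E F _ _ hE hF => rw [lie_add]; exact add_mem hE hF
  | smul a E hE hDE =>
    rw [LieRinehartRing.leibniz_smul_right]
    exact add_mem (Submodule.smul_mem _ _ hDE) (Submodule.smul_mem _ _ hE)

section Brackets

variable {K : Type*} [Field K] [CharP K 2] {N : Fin 5 → WithTop ℕ+} {a b c : Fin 3}
  (D : Der K (tildeN N))

theorem mem_FMb_iff : D ∈ FMb K N ↔ D ∈ vect K (tildeN N) ∧
    (∀ i, frameCoeff K N ⁅D, Yxi K N i⁆ = 0) ∧ ∀ i, frameCoeff K N ⁅D, Yeta K N i⁆ = 0 := by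
  refine and_congr_right fun hD => ⟨fun h => ⟨fun i => ?_, fun i => ?_⟩, fun h Y hY => ?_⟩
  · exact ((mem_mbDistribution_iff _).1 (h _ (Submodule.subset_span (.inl ⟨i, rfl⟩)))).2
  · exact ((mem_mbDistribution_iff _).1 (h _ (Submodule.subset_span (.inr ⟨i, rfl⟩)))).2
  · refine lie_mem_span_of_forall_lie_mem ?_ hY
    rintro _ (⟨i, rfl⟩ | ⟨i, rfl⟩)
    · exact (mem_mbDistribution_iff _).2 ⟨(vect K (tildeN N)).lie_mem hD (Yxi_mem_vect i), h.1 i⟩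
    · exact (mem_mbDistribution_iff _).2 ⟨(vect K (tildeN N)).lie_mem hD (Yeta_mem_vect i), h.2 i⟩

theorem mbC_lie_Yxi_self (i : Fin 3) : mbC i ⁅D, Yxi K N i⁆ = Yxi K N i (mbC i D) := by
  have h := IsPerm3.succ i
  simp [mbC_eq _ h, Derivation.commutator_apply, Yxi_apply, pd_X, h.ne, CharTwo.sub_eq_add]

theorem mbC_lie_Yxi (h : IsPerm3 a b c) :
    mbC a ⁅D, Yxi K N b⁆ = Yxi K N b (mbC a D) + D (X (ieta c)) := by
  simp [mbC_eq _ h, Derivation.commutator_apply, Yxi_apply, pd_X, h.ne, CharTwo.sub_eq_add]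
  grind

theorem mbF1_lie_Yxi (i : Fin 3) : mbF1 ⁅D, Yxi K N i⁆ = Yxi K N i (mbF1 D) := by
  simp [mbF1_eq _ (.succ i), Derivation.commutator_apply, Yxi_apply, pd_X, CharTwo.sub_eq_add]
  grind

theorem mbF2_lie_Yxi (i : Fin 3) : mbF2 ⁅D, Yxi K N i⁆ = Yxi K N i (mbF2 D) + mbC i D := by
  have h := IsPerm3.succ i
  simp [mbF2_eq _ h, mbC_eq _ h, Derivation.commutator_apply, Yxi_apply, pd_X, h.ne,
    CharTwo.sub_eq_add]
  grind

theorem mbC_lie_Yeta_self (i : Fin 3) : mbC i ⁅D, Yeta K N i⁆ = Yeta K N i (mbC i D) := by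
  have h := IsPerm3.succ i
  simp [mbC_eq _ h, Derivation.commutator_apply, Yeta_eta, Yeta_xi, Yeta_u_self, h.ne,
    CharTwo.sub_eq_add]

theorem mbC_lie_Yeta (h : IsPerm3 a b c) :
    mbC b ⁅D, Yeta K N a⁆ = Yeta K N a (mbC b D) + D (X (ixi c)) := by
  simp [mbC_eq _ h.swap₁₂, Derivation.commutator_apply, Yeta_eta, Yeta_xi, Yeta_u h, h.ne,
    CharTwo.sub_eq_add]
  ring

theorem mbF1_lie_Yeta (i : Fin 3) : mbF1 ⁅D, Yeta K N i⁆ = Yeta K N i (mbF1 D) + mbC i D := by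
  have h := IsPerm3.succ i
  simp [mbF1_eq _ h, mbC_eq _ h, Derivation.commutator_apply, Yeta_eta, Yeta_u_self, Yeta_u h,
    Yeta_u h.swap₂₃, Yeta_chi_zero h, h.ne, CharTwo.sub_eq_add]
  grind

theorem mbF2_lie_Yeta (i : Fin 3) : mbF2 ⁅D, Yeta K N i⁆ = Yeta K N i (mbF2 D) := by
  have h := IsPerm3.succ i
  simp [mbF2_eq _ h, Derivation.commutator_apply, Yeta_eta, Yeta_xi, Yeta_u_self, Yeta_u h,
    Yeta_u h.swap₂₃, Yeta_chi_one h, h.ne, CharTwo.sub_eq_add]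
  grind

variable {D}

theorem Yxi_mbF1 (hD : D ∈ FMb K N) (i : Fin 3) : Yxi K N i (mbF1 D) = 0 := by
  rw [← mbF1_lie_Yxi]
  exact ((frameCoeff_eq_zero_iff _).1 (((mem_FMb_iff D).1 hD).2.1 i)).2.1

theorem Yeta_mbF2 (hD : D ∈ FMb K N) (i : Fin 3) : Yeta K N i (mbF2 D) = 0 := by
  rw [← mbF2_lie_Yeta]
  exact ((frameCoeff_eq_zero_iff _).1 (((mem_FMb_iff D).1 hD).2.2 i)).2.2

theorem Yxi_mbF2 (hD : D ∈ FMb K N) (i : Fin 3) : Yxi K N i (mbF2 D) = mbC i D := by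
  rw [← CharTwo.add_eq_zero, ← mbF2_lie_Yxi]
  exact ((frameCoeff_eq_zero_iff _).1 (((mem_FMb_iff D).1 hD).2.1 i)).2.2

theorem Yeta_mbF1 (hD : D ∈ FMb K N) (i : Fin 3) : Yeta K N i (mbF1 D) = mbC i D := by
  rw [← CharTwo.add_eq_zero, ← mbF1_lie_Yeta]
  exact ((frameCoeff_eq_zero_iff _).1 (((mem_FMb_iff D).1 hD).2.2 i)).2.1

theorem Yu_mbF2 (hD : D ∈ FMb K N) (i : Fin 3) : Yu K N i (mbF2 D) = D (X (ixi i)) := by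
  have h : IsPerm3 (i + 1) (i + 2) i := (IsPerm3.succ i).rotate
  have hC := ((frameCoeff_eq_zero_iff _).1 (((mem_FMb_iff D).1 hD).2.2 (i + 1))).1 (i + 2)
  have hY := Yxi_Yeta (mbF2 D) h
  rw [mbC_lie_Yeta D h, ← Yxi_mbF2 hD, CharTwo.add_eq_zero] at hC
  rw [Yeta_mbF2 hD, map_zero, eq_comm, CharTwo.add_eq_zero] at hY
  rw [← hY, hC]

theorem Yu_mbF1 (hD : D ∈ FMb K N) (i : Fin 3) : Yu K N i (mbF1 D) = D (X (ieta i)) := by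
  have h : IsPerm3 (i + 1) (i + 2) i := (IsPerm3.succ i).rotate
  have hC := ((frameCoeff_eq_zero_iff _).1 (((mem_FMb_iff D).1 hD).2.1 (i + 2))).1 (i + 1)
  have hY := Yxi_Yeta (mbF1 D) h
  rw [mbC_lie_Yxi D h, ← Yeta_mbF1 hD, CharTwo.add_eq_zero] at hC
  rw [Yxi_mbF1 hD, map_zero, zero_add] at hY
  rw [← hY, hC]

theorem mem_FMb (hD : D ∈ vect K (tildeN N)) (hξ1 : ∀ i, Yxi K N i (mbF1 D) = 0)
    (hη2 : ∀ i, Yeta K N i (mbF2 D) = 0) (hξ2 : ∀ i, Yxi K N i (mbF2 D) = mbC i D)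
    (hη1 : ∀ i, Yeta K N i (mbF1 D) = mbC i D) (hu2 : ∀ i, Yu K N i (mbF2 D) = D (X (ixi i)))
    (hu1 : ∀ i, Yu K N i (mbF1 D) = D (X (ieta i))) : D ∈ FMb K N := by
  refine (mem_FMb_iff D).2 ⟨hD, fun i => (frameCoeff_eq_zero_iff _).2 ⟨fun j => ?_, ?_, ?_⟩,
    fun i => (frameCoeff_eq_zero_iff _).2 ⟨fun j => ?_, ?_, ?_⟩⟩
  · obtain rfl | hji := eq_or_ne j i
    · rw [mbC_lie_Yxi_self, ← hξ2, Yxi_Yxi_self]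
    · obtain ⟨k, h⟩ := IsPerm3.exists_of_ne hji
      rw [mbC_lie_Yxi D h, ← hη1, Yxi_Yeta _ h, hξ1, map_zero, zero_add, hu1,
        CharTwo.add_self_eq_zero]
  · rw [mbF1_lie_Yxi, hξ1]
  · rw [mbF2_lie_Yxi, hξ2, CharTwo.add_self_eq_zero]
  · obtain rfl | hij := eq_or_ne i j
    · rw [mbC_lie_Yeta_self, ← hη1, Yeta_Yeta_self]
    · obtain ⟨k, h⟩ := IsPerm3.exists_of_ne hij
      rw [mbC_lie_Yeta D h, ← hξ2, ← hu2, ← Yxi_Yeta _ h, hη2, map_zero]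
  · rw [mbF1_lie_Yeta, hη1, CharTwo.add_self_eq_zero]
  · rw [mbF2_lie_Yeta, hη2]

end Brackets

/-! ### The map `X^f ↦ D^f` -/

section Phi

variable {K : Type*} [Field K] [CharP K 2] {N : Fin 5 → WithTop ℕ+} {a b c : Fin 3}

@[simp] theorem restr_X_ieta (i : Fin 3) : restr K N (X (ieta i)) = 0 := restr_X_inr _

@[simp] theorem restr_X_ixi (i : Fin 3) : restr K N (X (ixi i)) = 0 := restr_X_inr _

theorem restr_pd_iu (i : Fin 3) (g : O K (tildeN N)) :
    restr K N (pd (iu i) g) = pd (i.castLE (by norm_num)) (restr K N g) := restr_pd_inl _ _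

theorem restr_pd_ichi (s : Fin 2) (g : O K (tildeN N)) :
    restr K N (pd (ichi s) g) = pd (s.natAdd 3) (restr K N g) := restr_pd_inl _ _

theorem restr_Yeta (i : Fin 3) (g : O K (tildeN N)) :
    restr K N (Yeta K N i g) = restr K N (pd (ieta i) g) := by
  simp [Yeta_apply _ (.succ i), restr_mul]

theorem restr_Yu (i : Fin 3) (g : O K (tildeN N)) :
    restr K N (Yu K N i g) = pd (i.castLE (by norm_num)) (restr K N g) := by
  simp [Yu_apply, restr_mul, restr_pd_iu]

theorem restr_mbC (i : Fin 3) (D : Der K (tildeN N)) :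
    restr K N (mbC i D) = restr K N (D (X (iu i))) := by
  simp [mbC, restr_mul]

theorem restr_mbF1 (D : Der K (tildeN N)) : restr K N (mbF1 D) = restr K N (D (X (ichi 0))) := by
  simp [mbF1, restr_mul]

theorem restr_mbF2 (D : Der K (tildeN N)) : restr K N (mbF2 D) = restr K N (D (X (ichi 1))) := by
  simp [mbF2, restr_mul]

section Defining

variable {D : Der K (tildeN N)} (hD : D ∈ FMb K N)
include hD

theorem restr_pd_ieta_mbF1 (i : Fin 3) :
    restr K N (pd (ieta i) (mbF1 D)) = restr K N (D (X (iu i))) := by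
  rw [← restr_Yeta, Yeta_mbF1 hD, restr_mbC]

theorem mbFun_apply (j : Fin 5) : mbFun D j = restr K N (D (X (Sum.inl j))) := by
  fin_cases j
  · exact restr_pd_ieta_mbF1 hD 0
  · exact restr_pd_ieta_mbF1 hD 1
  · exact restr_pd_ieta_mbF1 hD 2
  · exact restr_mbF1 D
  · exact restr_mbF2 D

theorem Yeta_mbC_self (i : Fin 3) : Yeta K N i (mbC i D) = 0 := by
  rw [← Yeta_mbF1 hD, Yeta_Yeta_self]

theorem Yeta_mbC (h : IsPerm3 a b c) : Yeta K N a (mbC b D) = Yu K N c (mbF2 D) := by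
  have hY := Yxi_Yeta (mbF2 D) h
  rwa [Yeta_mbF2 hD, map_zero, Yxi_mbF2 hD, eq_comm, CharTwo.add_eq_zero] at hY

theorem Yxi_mbC_self (i : Fin 3) : Yxi K N i (mbC i D) = 0 := by
  rw [← Yxi_mbF2 hD, Yxi_Yxi_self]

theorem Yxi_mbC (h : IsPerm3 a b c) : Yxi K N b (mbC a D) = Yu K N c (mbF1 D) := by
  rw [← Yeta_mbF1 hD, Yxi_Yeta _ h, Yxi_mbF1 hD, map_zero, zero_add]

theorem sum_Yu_mbC :
    ∑ i, Yu K N i (mbC i D) + pd (ichi 0) (mbF1 D) + pd (ichi 1) (mbF2 D) = 0 := by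
  have h : IsPerm3 0 1 2 := .succ 0
  -- apply `Y_{ξ_2}` to `Y_{η_1} C_3 = Y_{u_2} F_2`
  have hYxi := congrArg (Yxi K N 1) (Yeta_mbC hD h.swap₂₃)
  rw [Yxi_Yeta _ h, Yxi_mbC hD h.swap₁₃, Yeta_Yu, Yeta_mbF1 hD, Yxi_Yu, Yxi_mbF2 hD, if_pos rfl,
    if_pos rfl] at hYxi
  rw [h.sum_eq]
  grind

theorem sum_mbFun_smul_pd_mem_svect : ∑ j, mbFun D j • (pd j : Der K N) ∈ svect K N := by
  refine ⟨⟨_, rfl⟩, ?_⟩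
  simp only [div, sum_smul_pd_X]
  have h := congrArg (restr K N) (sum_Yu_mbC hD)
  simp only [map_add, map_sum, restr_Yu, restr_mbC, restr_pd_ichi, restr_mbF1, restr_mbF2,
    map_zero] at h
  simp only [mbFun_apply hD]
  rw [Fin.sum_univ_three] at h
  rwa [Fin.sum_univ_five]

end Defining

variable (K N) in
/-- The map `φ : X^f ↦ D^f`. -/
def phi : FMb K N →ₗ[K] svect K N where
  toFun D := ⟨∑ j, mbFun (D : Der K (tildeN N)) j • pd j, sum_mbFun_smul_pd_mem_svect D.2⟩
  map_add' D E := svect_ext fun j => by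
    change (∑ i, mbFun _ i • (pd i : Der K N)) (X j) =
      (∑ i, mbFun _ i • (pd i : Der K N)) (X j) + (∑ i, mbFun _ i • (pd i : Der K N)) (X j)
    rw [sum_smul_pd_X, sum_smul_pd_X, sum_smul_pd_X, mbFun_apply (D + E).2, mbFun_apply D.2,
      mbFun_apply E.2, ← map_add]
    rfl
  map_smul' r D := svect_ext fun j => by
    change (∑ i, mbFun _ i • (pd i : Der K N)) (X j) =
      r • (∑ i, mbFun _ i • (pd i : Der K N)) (X j)
    rw [sum_smul_pd_X, sum_smul_pd_X, mbFun_apply (r • D).2, mbFun_apply D.2, ← map_smul]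
    rfl

theorem coe_phi (D : FMb K N) :
    (phi K N D : Der K N) = ∑ j, mbFun (D : Der K (tildeN N)) j • pd j := rfl

theorem phi_X (D : FMb K N) (j : Fin 5) :
    (phi K N D : Der K N) (X j) = restr K N ((D : Der K (tildeN N)) (X (Sum.inl j))) := by
  rw [coe_phi, sum_smul_pd_X, mbFun_apply D.2]

theorem pd_ieta_mem_vanishingIdeal {n : ℕ} {g : O K (tildeN N)} {i : Fin 3}
    (hg : g ∈ vanishingIdeal K N n) (hY : Yeta K N i g ∈ vanishingIdeal K N n) :
    pd (ieta i) g ∈ vanishingIdeal K N n := by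
  have h : pd (ieta i) g = Yeta K N i g +
      (X (ixi (i + 2)) * pd (iu (i + 1)) g + X (ixi (i + 1)) * pd (iu (i + 2)) g +
        (X (ixi (i + 2)) * X (ieta (i + 1)) + X (ixi (i + 1)) * X (ieta (i + 2))) * pd (ichi 0) g +
        X (ixi (i + 1)) * X (ixi (i + 2)) * pd (ichi 1) g) := by
    rw [Yeta_apply _ (.succ i)]
    grind
  have hpd (f : O K (tildeN N)) (j : Fin 5) : f * pd (Sum.inl j) g ∈ vanishingIdeal K N n :=
    Ideal.mul_mem_left _ f (pd_inl_mem_vanishingIdeal j hg)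
  rw [h]
  exact add_mem hY (add_mem (add_mem (add_mem (hpd _ _) (hpd _ _)) (hpd _ _)) (hpd _ _))

theorem Yu_mem_vanishingIdeal {n : ℕ} {g : O K (tildeN N)} (i : Fin 3)
    (hg : g ∈ vanishingIdeal K N n) : Yu K N i g ∈ vanishingIdeal K N n := by
  rw [Yu_apply]
  exact add_mem (add_mem (pd_inl_mem_vanishingIdeal _ hg)
    (Ideal.mul_mem_left _ _ (pd_inl_mem_vanishingIdeal _ hg)))
    (Ideal.mul_mem_left _ _ (pd_inl_mem_vanishingIdeal _ hg))

theorem mem_vanishingIdeal_of_restr_eq_zero {D : Der K (tildeN N)} (hD : D ∈ FMb K N)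
    (h0 : ∀ j, restr K N (D (X (Sum.inl j))) = 0) (n : ℕ) : mbF1 D ∈ vanishingIdeal K N n ∧
      mbF2 D ∈ vanishingIdeal K N n ∧ ∀ i, mbC i D ∈ vanishingIdeal K N n := by
  induction n with
  | zero => exact ⟨trivial, trivial, fun _ => trivial⟩
  | succ n ih =>
    obtain ⟨ih1, ih2, ihC⟩ := ih
    simp only [mem_vanishingIdeal_succ, Sum.forall]
    refine ⟨⟨ih1, (restr_mbF1 D).trans (h0 _), fun i => pd_ieta_mem_vanishingIdeal ih1 ?_,
        fun i => ?_⟩, ⟨ih2, (restr_mbF2 D).trans (h0 _),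
        fun i => pd_ieta_mem_vanishingIdeal ih2 ?_, fun i => ?_⟩,
      fun i => ⟨ihC i, (restr_mbC i D).trans (h0 _),
        fun j => pd_ieta_mem_vanishingIdeal (ihC i) ?_, fun j => ?_⟩⟩
    · exact Yeta_mbF1 hD i ▸ ihC i
    · exact (Yxi_mbF1 hD i).symm ▸ zero_mem (vanishingIdeal K N n)
    · exact (Yeta_mbF2 hD i).symm ▸ zero_mem (vanishingIdeal K N n)
    · exact (Yxi_mbF2 hD i).symm ▸ ihC i
    · obtain rfl | hji := eq_or_ne j i
      · exact (Yeta_mbC_self hD j).symm ▸ zero_mem _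
      · obtain ⟨k, h⟩ := IsPerm3.exists_of_ne hji
        exact Yeta_mbC hD h ▸ Yu_mem_vanishingIdeal k ih2
    · obtain rfl | hij := eq_or_ne i j
      · exact (Yxi_mbC_self hD i).symm ▸ zero_mem (vanishingIdeal K N n)
      · obtain ⟨k, h⟩ := IsPerm3.exists_of_ne hij
        exact (Yxi_mbC hD h).symm ▸ Yu_mem_vanishingIdeal k ih1

theorem eq_zero_of_mbF_eq_zero {D : Der K (tildeN N)} (hD : D ∈ FMb K N) (h1 : mbF1 D = 0)
    (h2 : mbF2 D = 0) : D = 0 := by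
  have hxi (i : Fin 3) : D (X (ixi i)) = 0 := by rw [← Yu_mbF2 hD, h2, map_zero]
  have heta (i : Fin 3) : D (X (ieta i)) = 0 := by rw [← Yu_mbF1 hD, h1, map_zero]
  have hu (i : Fin 3) : D (X (iu i)) = 0 := by
    simpa [mbC, heta, h1] using (Yeta_mbF1 hD i).symm
  refine vect_ext hD.1 (vect K (tildeN N)).zero_mem
    (forall_mbIdx.2 ⟨⟨hu, Fin.forall_fin_two.2 ⟨?_, ?_⟩⟩, heta, hxi⟩)
  · simpa [mbF1, hu] using h1
  · simpa [mbF2, hu, heta] using h2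

theorem phi_injective : Function.Injective (phi K N) := by
  rw [injective_iff_map_eq_zero]
  intro D hD
  have h := mem_vanishingIdeal_of_restr_eq_zero D.2 fun j => by rw [← phi_X, hD]; rfl
  exact Subtype.ext (eq_zero_of_mbF_eq_zero D.2 (eq_zero_of_mem_vanishingIdeal fun n => (h n).1)
    (eq_zero_of_mem_vanishingIdeal fun n => (h n).2.1))

theorem restr_apply_of_mem_FMb (D : FMb K N) (g : O K (tildeN N)) :
    restr K N ((D : Der K (tildeN N)) g) = (phi K N D : Der K N) (restr K N g) +
      (∑ i : Fin 3, pd (i.castLE (by norm_num)) ((phi K N D : Der K N) (X 3)) *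
        restr K N (pd (ieta i) g) +
      ∑ i : Fin 3, pd (i.castLE (by norm_num)) ((phi K N D : Der K N) (X 4)) *
        restr K N (pd (ixi i) g)) := by
  have h3 : (phi K N D : Der K N) (X 3) = restr K N (mbF1 (D : Der K (tildeN N))) :=
    (phi_X D 3).trans (restr_mbF1 _).symm
  have h4 : (phi K N D : Der K N) (X 4) = restr K N (mbF2 (D : Der K (tildeN N))) :=
    (phi_X D 4).trans (restr_mbF2 _).symm
  have heta (i : Fin 3) : (D : Der K (tildeN N)) (X (Sum.inr (Sum.inl i))) =
      Yu K N i (mbF1 (D : Der K (tildeN N))) := (Yu_mbF1 D.2 i).symm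
  have hxi (i : Fin 3) : (D : Der K (tildeN N)) (X (Sum.inr (Sum.inr i))) =
      Yu K N i (mbF2 (D : Der K (tildeN N))) := (Yu_mbF2 D.2 i).symm
  rw [vect_apply D.2.1, vect_apply (phi K N D).2.1, map_sum]
  simp only [Fintype.sum_sum_type, restr_mul, heta, hxi, restr_Yu, h3, h4, restr_pd_inl, phi_X]
  rfl

section Corrections

variable {E : Der K (tildeN N)} (hE : E ∈ FMb K N)
include hE

theorem restr_pd_ieta_iu_self (i : Fin 3) : restr K N (pd (ieta i) (E (X (iu i)))) = 0 := by
  have h := congrArg (restr K N) (Yeta_mbC_self hE i)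
  simpa [restr_Yeta, mbC, restr_mul, pd_X] using h

theorem restr_pd_ieta_iu (h : IsPerm3 a b c) : restr K N (pd (ieta a) (E (X (iu b)))) =
    pd (c.castLE (by norm_num)) (restr K N (E (X (ichi 1)))) := by
  have hY := congrArg (restr K N) (Yeta_mbC hE h)
  simpa [restr_Yeta, mbC, restr_mul, pd_X, restr_Yu, restr_mbF2] using hY

theorem restr_pd_ixi_iu (i j : Fin 3) : restr K N (pd (ixi j) (E (X (iu i)))) = 0 := by
  obtain rfl | hij := eq_or_ne i j
  · have hY := congrArg (restr K N) (Yxi_mbC_self hE i)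
    simpa [Yxi_apply, mbC_eq _ (.succ i), restr_mul, pd_X, (IsPerm3.succ i).ne] using hY
  · obtain ⟨k, h⟩ := IsPerm3.exists_of_ne hij
    have hY := congrArg (restr K N) (Yxi_mbC hE h)
    rw [Yu_mbF1 hE] at hY
    simpa [Yxi_apply, mbC_eq _ h, restr_mul, pd_X, h.ne] using hY

theorem restr_pd_inr_ichi (s : Fin 2) (k : Fin 3 ⊕ Fin 3) :
    restr K N (pd (Sum.inr k) (E (X (ichi s)))) = 0 := by
  revert s
  rcases k with i | i <;> refine Fin.forall_fin_two.2 ⟨?_, ?_⟩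
  · change restr K N (pd (ieta i) _) = 0
    simpa [mbF1_eq _ (.succ i), restr_mul, pd_X, (IsPerm3.succ i).ne] using
      restr_pd_ieta_mbF1 hE i
  · have hY := congrArg (restr K N) (Yeta_mbF2 hE i)
    change restr K N (pd (ieta i) _) = 0
    simpa [restr_Yeta, mbF2, restr_mul, pd_X] using hY
  · have hY := congrArg (restr K N) (Yxi_mbF1 hE i)
    change restr K N (pd (ixi i) _) = 0
    simpa [Yxi_apply, mbF1, restr_mul, pd_X] using hY
  · have hY := congrArg (restr K N) (Yxi_mbF2 hE i)
    rw [restr_mbC] at hY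
    change restr K N (pd (ixi i) _) = 0
    simpa [Yxi_apply, mbF2_eq _ (.succ i), restr_mul, pd_X, (IsPerm3.succ i).ne] using hY

end Corrections

theorem restr_apply_iu (h : IsPerm3 a b c) (D E : FMb K N) :
    restr K N ((D : Der K (tildeN N)) ((E : Der K (tildeN N)) (X (iu a)))) =
      (phi K N D : Der K N) ((phi K N E : Der K N) (X (a.castLE (by norm_num)))) +
      (pd (b.castLE (by norm_num)) ((phi K N D : Der K N) (X 3)) *
        pd (c.castLE (by norm_num)) ((phi K N E : Der K N) (X 4)) +
      pd (c.castLE (by norm_num)) ((phi K N D : Der K N) (X 3)) *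
        pd (b.castLE (by norm_num)) ((phi K N E : Der K N) (X 4))) := by
  have h4 : (phi K N E : Der K N) (X 4) = restr K N ((E : Der K (tildeN N)) (X (ichi 1))) :=
    phi_X E 4
  have ha : (phi K N E : Der K N) (X (a.castLE (by norm_num))) =
    restr K N ((E : Der K (tildeN N)) (X (iu a))) := phi_X E _
  simp only [restr_apply_of_mem_FMb D, h.sum_eq, restr_pd_ieta_iu_self E.2,
    restr_pd_ieta_iu E.2 h.swap₁₂, restr_pd_ieta_iu E.2 h.rotate.rotate,
    restr_pd_ixi_iu E.2, h4, ha]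
  ring

theorem restr_apply_ichi (s : Fin 2) (D E : FMb K N) :
    restr K N ((D : Der K (tildeN N)) ((E : Der K (tildeN N)) (X (ichi s)))) =
      (phi K N D : Der K N) ((phi K N E : Der K N) (X (s.natAdd 3))) := by
  have heta (i : Fin 3) := restr_pd_inr_ichi E.2 s (Sum.inl i)
  have hxi (i : Fin 3) := restr_pd_inr_ichi E.2 s (Sum.inr i)
  rw [restr_apply_of_mem_FMb D, phi_X E]
  simp only [ieta, ixi, heta, hxi, mul_zero, Finset.sum_const_zero, add_zero]
  rfl

theorem cField_X_castLE (h : IsPerm3 a b c) (D E : Der K N) :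
    cField D E (X (a.castLE (by norm_num))) =
      (pd (b.castLE (by norm_num)) (D (X 3)) * pd (c.castLE (by norm_num)) (E (X 4)) +
        pd (b.castLE (by norm_num)) (D (X 4)) * pd (c.castLE (by norm_num)) (E (X 3))) +
      (pd (c.castLE (by norm_num)) (D (X 3)) * pd (b.castLE (by norm_num)) (E (X 4)) +
        pd (c.castLE (by norm_num)) (D (X 4)) * pd (b.castLE (by norm_num)) (E (X 3))) := by
  obtain ⟨rfl, rfl⟩ | ⟨rfl, rfl⟩ := h.eq_succ_or <;> fin_cases a
  · exact cField_X_zero D E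
  · exact (cField_X_one D E).trans (add_comm _ _)
  · exact cField_X_two D E
  · exact (cField_X_zero D E).trans (add_comm _ _)
  · exact cField_X_one D E
  · exact (cField_X_two D E).trans (add_comm _ _)

theorem phi_lie (D E : FMb K N) : phi K N ⁅D, E⁆ =
    ⁅phi K N D, phi K N E⁆ + (cCochain K N).val (phi K N D) (phi K N E) := by
  refine svect_ext fun j => ?_
  have hlie : (phi K N ⁅D, E⁆ : Der K N) (X j) =
      restr K N ((D : Der K (tildeN N)) ((E : Der K (tildeN N)) (X (Sum.inl j)))) +
      restr K N ((E : Der K (tildeN N)) ((D : Der K (tildeN N)) (X (Sum.inl j)))) := by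
    rw [phi_X, ← map_add, ← CharTwo.sub_eq_add]
    rfl
  change _ = ⁅(phi K N D : Der K N), (phi K N E : Der K N)⁆ (X j) +
    cField (phi K N D : Der K N) (phi K N E : Der K N) (X j)
  rw [hlie, Derivation.commutator_apply, CharTwo.sub_eq_add]
  clear hlie
  revert j
  refine forall_fin_five.2 ⟨fun i => ?_, fun s => ?_⟩
  · have hDE := restr_apply_iu (.succ i) D E
    have hED := restr_apply_iu (.succ i) E D
    rw [iu] at hDE hED
    rw [hDE, hED, cField_X_castLE (.succ i)]
    ring
  · have hDE := restr_apply_ichi s D E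
    have hED := restr_apply_ichi s E D
    rw [ichi] at hDE hED
    rw [hDE, hED, cField_X_natAdd, add_zero]

end Phi

/-! ### Surjectivity of `φ` -/

section FrameField

variable {K : Type*} [Field K] [CharP K 2] {N : Fin 5 → WithTop ℕ+}

theorem frameCoeff_Yu (i : Fin 3) : frameCoeff K N (Yu K N i) = (Pi.single i 1, 0, 0) := by
  refine Prod.ext (funext fun j => ?_) (Prod.ext ?_ ?_)
  · change mbC j (Yu K N i) = _
    simp [mbC, Yu_apply, pd_X, Pi.single_apply, eq_comm]
  · change mbF1 (Yu K N i) = 0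
    simp [mbF1, Yu_apply, pd_X]
  · change mbF2 (Yu K N i) = 0
    simp [mbF2, Yu_apply, pd_X]

theorem frameCoeff_pd_ichi_zero : frameCoeff K N (pd (ichi 0)) = (0, 1, 0) := by
  refine Prod.ext (funext fun j => ?_) (Prod.ext ?_ ?_)
  · change mbC j _ = 0
    simp [mbC, pd_X]
  · change mbF1 _ = 1
    simp [mbF1, pd_X]
  · change mbF2 _ = 0
    simp [mbF2, pd_X]

theorem frameCoeff_pd_ichi_one : frameCoeff K N (pd (ichi 1)) = (0, 0, 1) := by
  refine Prod.ext (funext fun j => ?_) (Prod.ext ?_ ?_)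
  · change mbC j _ = 0
    simp [mbC, pd_X]
  · change mbF1 _ = 0
    simp [mbF1, pd_X]
  · change mbF2 _ = 1
    simp [mbF2, pd_X]

/-- The only candidate for a field in `F(mb(3; N | 8))` with generating functions `F_1 = F` and
`F_2 = G`. -/
def mbField (F G : O K (tildeN N)) : Der K (tildeN N) :=
  ∑ i, (Yu K N i G • Yxi K N i + Yu K N i F • Yeta K N i + Yeta K N i F • Yu K N i) +
    F • pd (ichi 0) + G • pd (ichi 1)

variable (F G : O K (tildeN N))

theorem mbField_mem_vect : mbField F G ∈ vect K (tildeN N) := by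
  refine (vect K (tildeN N)).add_mem ((vect K (tildeN N)).add_mem
    ((vect K (tildeN N)).toSubmodule.sum_mem fun i _ => ?_) (smul_pd_mem_vect _ _))
    (smul_pd_mem_vect _ _)
  exact (vect K (tildeN N)).add_mem ((vect K (tildeN N)).add_mem (smul_mem_vect _ (Yxi_mem_vect i))
    (smul_mem_vect _ (Yeta_mem_vect i))) (smul_mem_vect _ (Yu_mem_vect i))

theorem mbField_ixi (i : Fin 3) : mbField F G (X (ixi i)) = Yu K N i G := by
  have h := IsPerm3.succ i
  simp [mbField, h.sum_eq, Yxi_apply, Yeta_xi, Yu_apply, pd_X, h.ne]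

theorem mbField_ieta (i : Fin 3) : mbField F G (X (ieta i)) = Yu K N i F := by
  have h := IsPerm3.succ i
  simp [mbField, h.sum_eq, Yxi_apply, Yeta_eta, Yu_apply, pd_X, h.ne]

theorem frameCoeff_mbField :
    frameCoeff K N (mbField F G) = (fun i => Yeta K N i F, F, G) := by
  simp only [mbField, map_add, map_sum, map_smul, frameCoeff_Yxi, frameCoeff_Yeta, frameCoeff_Yu,
    frameCoeff_pd_ichi_zero, frameCoeff_pd_ichi_one]
  refine Prod.ext (funext fun i => ?_) (Prod.ext ?_ ?_)
  · simp [Prod.fst_sum, Finset.sum_apply, Pi.single_apply]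
  · simp [Prod.snd_sum]
  · simp [Prod.snd_sum]

theorem mbC_mbField (i : Fin 3) : mbC i (mbField F G) = Yeta K N i F :=
  congrFun (congrArg Prod.fst (frameCoeff_mbField F G)) i

theorem mbF1_mbField : mbF1 (mbField F G) = F :=
  congrArg (fun p => p.2.1) (frameCoeff_mbField F G)

theorem mbF2_mbField : mbF2 (mbField F G) = G :=
  congrArg (fun p => p.2.2) (frameCoeff_mbField F G)

variable {F G}

theorem mbField_mem_FMb (hF : ∀ i, Yxi K N i F = 0) (hFG : ∀ i, Yxi K N i G = Yeta K N i F)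
    (hG : ∀ i, Yeta K N i G = 0) : mbField F G ∈ FMb K N :=
  mem_FMb (mbField_mem_vect F G) (by rwa [mbF1_mbField]) (by rwa [mbF2_mbField])
    (fun i => by rw [mbF2_mbField, mbC_mbField, hFG])
    (fun i => by rw [mbF1_mbField, mbC_mbField])
    (fun i => by rw [mbF2_mbField, mbField_ixi]) (fun i => by rw [mbF1_mbField, mbField_ieta])

end FrameField

section Generating

variable {K : Type*} [Field K] [CharP K 2] {N : Fin 5 → WithTop ℕ+} {a b c : Fin 3}

variable (K N) in
/-- The field `∂_{u_i} + η_i ∂_{χ_1}`, the part of `Y_{u_i}` free of `ξ`. -/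
def Pu (i : Fin 3) : Der K (tildeN N) :=
  pd (iu i) + (X (ieta i) : O K (tildeN N)) • pd (ichi 0)

theorem Pu_apply (i : Fin 3) (g : O K (tildeN N)) :
    Pu K N i g = pd (iu i) g + X (ieta i) * pd (ichi 0) g := rfl

theorem Yeta_eq_Pu (h : IsPerm3 a b c) (g : O K (tildeN N)) : Yeta K N a g = pd (ieta a) g +
    X (ixi c) * Pu K N b g + X (ixi b) * Pu K N c g + X (ixi b) * X (ixi c) * pd (ichi 1) g := by
  rw [Yeta_apply _ h, Pu_apply, Pu_apply]
  ring

theorem Pu_Pu (i j : Fin 3) (g : O K (tildeN N)) :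
    Pu K N i (Pu K N j g) = Pu K N j (Pu K N i g) := by
  simp [Pu_apply, pd_X, pd_comm (iu j) (iu i) g, pd_comm (ichi 0) (iu _) g]
  ring

theorem pd_ichi_Pu (s : Fin 2) (i : Fin 3) (g : O K (tildeN N)) :
    pd (ichi s) (Pu K N i g) = Pu K N i (pd (ichi s) g) := by
  simp [Pu_apply, pd_X, pd_comm (ichi s) (iu i) g, pd_comm (ichi s) (ichi 0) g]

theorem pd_ieta_Pu (i j : Fin 3) (g : O K (tildeN N)) : pd (ieta i) (Pu K N j g) =
    Pu K N j (pd (ieta i) g) + if i = j then pd (ichi 0) g else 0 := by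
  simp only [Pu_apply, map_add, Derivation.leibniz, smul_eq_mul, pd_X, pd_comm (ieta i), ieta_inj]
  split_ifs <;> ring

theorem pd_ixi_Pu (i j : Fin 3) (g : O K (tildeN N)) :
    pd (ixi i) (Pu K N j g) = Pu K N j (pd (ixi i) g) := by
  simp [Pu_apply, pd_X, pd_comm (ixi i)]

/-- The solution `G` of the equations `∂_{ξ_i} G = Y_{η_i} F` with value `q` at `ξ = 0`, for `F` and
`q` independent of `ξ`. -/
def genF2 (q F : O K (tildeN N)) : O K (tildeN N) :=
  q + ∑ i, X (ixi i) * pd (ieta i) F + ∑ i, X (ixi (i + 1)) * X (ixi (i + 2)) * Pu K N i F +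
    (∏ i, X (ixi i)) * pd (ichi 1) F

theorem genF2_eq (h : IsPerm3 a b c) (q F : O K (tildeN N)) : genF2 q F =
    q + (X (ixi a) * pd (ieta a) F + X (ixi b) * pd (ieta b) F + X (ixi c) * pd (ieta c) F) +
    (X (ixi b) * X (ixi c) * Pu K N a F + X (ixi a) * X (ixi c) * Pu K N b F +
      X (ixi a) * X (ixi b) * Pu K N c F) +
    X (ixi a) * X (ixi b) * X (ixi c) * pd (ichi 1) F := by
  have hmul {i j k : Fin 3} (hijk : IsPerm3 i j k) :
      (X (ixi (i + 1)) * X (ixi (i + 2)) : O K (tildeN N)) = X (ixi j) * X (ixi k) :=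
    hijk.mul_succ fun i => X (ixi i)
  rw [genF2, h.sum_eq, h.sum_eq, h.prod_eq, hmul h, hmul h.swap₁₂, hmul h.rotate.rotate]

theorem Yxi_genF2 {q F : O K (tildeN N)} (hq : ∀ i, pd (ixi i) q = 0)
    (hF : ∀ i, pd (ixi i) F = 0) (i : Fin 3) : Yxi K N i (genF2 q F) = Yeta K N i F := by
  have h := IsPerm3.succ i
  simp [Yxi_apply, genF2_eq h, Yeta_eq_Pu h, hq, hF, pd_X, pd_ixi_Pu, pd_comm (ixi i) (ieta _) F,
    pd_comm (ixi i) (ichi _) F, h.ne]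
  ring

theorem Yeta_genF2 {q F : O K (tildeN N)} (hq : ∀ i, pd (ieta i) q = 0)
    (hF : ∀ {i j k}, IsPerm3 i j k → pd (ieta i) (pd (ieta j) F) = Pu K N k q)
    (hdiv : ∑ i, Pu K N i (pd (ieta i) F) + pd (ichi 0) F + pd (ichi 1) q = 0) (i : Fin 3) :
    Yeta K N i (genF2 q F) = 0 := by
  obtain ⟨b, c, h⟩ : ∃ b c, IsPerm3 i b c := ⟨_, _, .succ i⟩
  have hself : pd (ieta i) (pd (ieta i) F) = 0 := pd_inr_pd_inr _ _
  rw [h.sum_eq] at hdiv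
  simp only [genF2_eq h, map_add, Derivation.leibniz, smul_eq_mul, Yeta_xi, mul_zero, add_zero]
  simp only [Yeta_eq_Pu h, hself, hF h, hF h.swap₂₃, hq, pd_ieta_Pu, pd_ichi_Pu, Pu_Pu b i,
    Pu_Pu c i, Pu_Pu c b, pd_comm (ichi 1) (ieta _) F, h.ne, if_true, if_false, add_zero, zero_add]
  grind [X_mul_self (K := K) (N := tildeN N) (ixi i), X_mul_self (K := K) (N := tildeN N) (ixi b),
    X_mul_self (K := K) (N := tildeN N) (ixi c)]

/-- The generating function `F_1` of `X^f`, as a function of `D^f = ∑ f_i ∂_{u_i}`. -/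
def genF1 (D : Der K N) : O K (tildeN N) :=
  emb K N (D (X 3)) + ∑ i : Fin 3, X (ieta i) * emb K N (D (X (i.castLE (by norm_num)))) +
    ∑ i : Fin 3, X (ieta (i + 1)) * X (ieta (i + 2)) *
      emb K N (pd (i.castLE (by norm_num)) (D (X 4))) +
    (∏ i, X (ieta i)) * emb K N (pd 3 (D (X 4)))

theorem genF1_eq (h : IsPerm3 a b c) (D : Der K N) : genF1 D = emb K N (D (X 3)) +
    (X (ieta a) * emb K N (D (X (a.castLE (by norm_num)))) +
      X (ieta b) * emb K N (D (X (b.castLE (by norm_num)))) +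
      X (ieta c) * emb K N (D (X (c.castLE (by norm_num))))) +
    (X (ieta b) * X (ieta c) * emb K N (pd (a.castLE (by norm_num)) (D (X 4))) +
      X (ieta a) * X (ieta c) * emb K N (pd (b.castLE (by norm_num)) (D (X 4))) +
      X (ieta a) * X (ieta b) * emb K N (pd (c.castLE (by norm_num)) (D (X 4)))) +
    X (ieta a) * X (ieta b) * X (ieta c) * emb K N (pd 3 (D (X 4))) := by
  have hmul {i j k : Fin 3} (hijk : IsPerm3 i j k) :
      (X (ieta (i + 1)) * X (ieta (i + 2)) : O K (tildeN N)) = X (ieta j) * X (ieta k) :=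
    hijk.mul_succ fun i => X (ieta i)
  rw [genF1, h.sum_eq, h.sum_eq, h.prod_eq, hmul h, hmul h.swap₁₂, hmul h.rotate.rotate]

theorem pd_ieta_emb (i : Fin 3) (f : O K N) : pd (ieta i) (emb K N f) = 0 := pd_inr_emb _ f

theorem pd_ixi_emb (i : Fin 3) (f : O K N) : pd (ixi i) (emb K N f) = 0 := pd_inr_emb _ f

theorem pd_iu_emb (i : Fin 3) (f : O K N) :
    pd (iu i) (emb K N f) = emb K N (pd (i.castLE (by norm_num)) f) := pd_inl_emb _ f

theorem pd_ichi_emb (s : Fin 2) (f : O K N) :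
    pd (ichi s) (emb K N f) = emb K N (pd (s.natAdd 3) f) := pd_inl_emb _ f

theorem pd_ixi_genF1 (D : Der K N) (i : Fin 3) : pd (ixi i) (genF1 D) = 0 := by
  simp [genF1, Fin.prod_univ_three, pd_X, pd_ixi_emb]

theorem pd_ieta_genF1 (h : IsPerm3 a b c) (D : Der K N) : pd (ieta a) (genF1 D) =
    emb K N (D (X (a.castLE (by norm_num)))) +
    (X (ieta c) * emb K N (pd (b.castLE (by norm_num)) (D (X 4))) +
      X (ieta b) * emb K N (pd (c.castLE (by norm_num)) (D (X 4)))) +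
    X (ieta b) * X (ieta c) * emb K N (pd 3 (D (X 4))) := by
  simp [genF1_eq h, pd_X, pd_ieta_emb, h.ne]
  ring

theorem pd_ieta_pd_ieta_genF1 (h : IsPerm3 a b c) (D : Der K N) :
    pd (ieta a) (pd (ieta b) (genF1 D)) = Pu K N c (emb K N (D (X 4))) := by
  have h3 : Fin.natAdd 3 (0 : Fin 2) = (3 : Fin 5) := rfl
  simp [pd_ieta_genF1 h.swap₁₂, Pu_apply, pd_X, pd_ieta_emb, pd_iu_emb, pd_ichi_emb, h3, h.ne]
  ring

theorem sum_Pu_pd_ieta_genF1 (D : Der K N) : ∑ i, Pu K N i (pd (ieta i) (genF1 D)) +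
    pd (ichi 0) (genF1 D) + pd (ichi 1) (emb K N (D (X 4))) = emb K N (div D) := by
  have h : IsPerm3 0 1 2 := .succ 0
  have h3 : Fin.natAdd 3 (0 : Fin 2) = (3 : Fin 5) := rfl
  have h4 : Fin.natAdd 3 (1 : Fin 2) = (4 : Fin 5) := rfl
  rw [h.sum_eq, pd_ieta_genF1 h, pd_ieta_genF1 h.rotate, pd_ieta_genF1 h.rotate.rotate, genF1_eq h]
  simp [Pu_apply, pd_X, pd_iu_emb, pd_ichi_emb, div, Fin.sum_univ_five, h3, h4]
  simp only [pd_comm 1 0 (D (X 4)), pd_comm 2 0 (D (X 4)), pd_comm 2 1 (D (X 4)),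
    pd_comm 3 _ (D (X 4))]
  grind

theorem phi_surjective : Function.Surjective (phi K N) := by
  intro D
  set F := genF1 (D : Der K N) with hF
  set G := genF2 (emb K N ((D : Der K N) (X 4))) F with hG
  have hmem : mbField F G ∈ FMb K N :=
    mbField_mem_FMb (pd_ixi_genF1 _) (Yxi_genF2 (fun i => pd_ixi_emb i _) (pd_ixi_genF1 _))
      (Yeta_genF2 (fun i => pd_ieta_emb i _) (fun h => pd_ieta_pd_ieta_genF1 h _)
        (by rw [sum_Pu_pd_ieta_genF1, D.2.2, map_zero]))
  refine ⟨⟨mbField F G, hmem⟩, svect_ext fun j => ?_⟩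
  rw [phi_X]
  revert j
  refine forall_fin_five.2 ⟨fun i => ?_, Fin.forall_fin_two.2 ⟨?_, ?_⟩⟩
  · refine (restr_pd_ieta_mbF1 hmem i).symm.trans ?_
    simp [mbF1_mbField, hF, pd_ieta_genF1 (.succ i), restr_mul, restr_emb]
  · refine (restr_mbF1 _).symm.trans ?_
    simp [mbF1_mbField, hF, genF1, Fin.prod_univ_three, restr_mul, restr_emb]
  · refine (restr_mbF2 _).symm.trans ?_
    simp [mbF2_mbField, hG, genF2, Fin.prod_univ_three, restr_mul, restr_emb]

variable (K N) in
/-- The linear bijection `φ : X^f ↦ D^f`. -/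
def phiEquiv : FMb K N ≃ₗ[K] svect K N :=
  LinearEquiv.ofBijective (phi K N) ⟨phi_injective, phi_surjective⟩

variable (K N) in
/-- The embedding `ψ ∘ φ` of Lie algebras. -/
def psiPhi : FMb K N →ₗ⁅K⁆ FKle K N where
  toLinearMap := psi K N ∘ₗ phi K N
  map_lie' {D E} := by
    change psi K N (phi K N ⁅D, E⁆) = ⁅psi K N (phi K N D), psi K N (phi K N E)⁆
    rw [psi_lie, phi_lie]

end Generating

/-! ### Values at the origin -/

section ValueAtZero

variable {K : Type*} [Field K] [CharP K 2] {ι : Type*} [Fintype ι] [DecidableEq ι]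
  {N : ι → WithTop ℕ+}

variable (K N) in
/-- The field `∑ v_i ∂_i` with constant coefficients. -/
def constField : (ι → K) →ₗ[K] svect K N where
  toFun v := ⟨∑ i, algebraMap K (O K N) (v i) • pd i, ⟨_, rfl⟩, by
    simp only [div, sum_smul_pd_X, Derivation.map_algebraMap, Finset.sum_const_zero]⟩
  map_add' v w := svect_ext fun j => by
    change (∑ i, algebraMap K (O K N) ((v + w) i) • (pd i : Der K N)) (X j) =
      (∑ i, algebraMap K (O K N) (v i) • (pd i : Der K N)) (X j) +
        (∑ i, algebraMap K (O K N) (w i) • (pd i : Der K N)) (X j)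
    simp only [sum_smul_pd_X, Pi.add_apply, map_add]
  map_smul' a v := svect_ext fun j => by
    change (∑ i, algebraMap K (O K N) ((a • v) i) • (pd i : Der K N)) (X j) =
      a • (∑ i, algebraMap K (O K N) (v i) • (pd i : Der K N)) (X j)
    simp only [sum_smul_pd_X, Pi.smul_apply, smul_eq_mul, map_mul, Algebra.smul_def]

theorem constField_X (v : ι → K) (j : ι) :
    (constField K N v : Der K N) (X j) = algebraMap K (O K N) (v j) :=
  sum_smul_pd_X (fun i => algebraMap K (O K N) (v i)) j

theorem constField_apply (v : ι → K) (f : O K N) :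
    (constField K N v : Der K N) f = ∑ i, v i • pd i f := by
  simp only [vect_apply (constField K N v).2.1 f, constField_X, Algebra.smul_def]

theorem lie_constField_X (v : ι → K) (D : svect K N) (j : ι) :
    ((⁅constField K N v, D⁆ : svect K N) : Der K N) (X j) =
      (constField K N v : Der K N) ((D : Der K N) (X j)) := by
  change (constField K N v : Der K N) ((D : Der K N) (X j)) -
    (D : Der K N) ((constField K N v : Der K N) (X j)) = _
  rw [constField_X, Derivation.map_algebraMap, sub_zero]

variable (K N) in
/-- The value of a divergence-free field at the origin. -/
def valueAtZero : svect K N →ₗ[K] (ι → K) where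
  toFun D j := constTerm K N ((D : Der K N) (X j))
  map_add' _ _ := funext fun _ => map_add (constTerm K N) _ _
  map_smul' a _ := funext fun _ => map_smul (constTerm K N) a _

theorem valueAtZero_apply (D : svect K N) (j : ι) :
    valueAtZero K N D j = constTerm K N ((D : Der K N) (X j)) := rfl

theorem valueAtZero_constField (v : ι → K) : valueAtZero K N (constField K N v) = v :=
  funext fun j => by rw [valueAtZero_apply, constField_X, AlgHom.commutes, Algebra.algebraMap_self,
    RingHom.id_apply]

theorem valueAtZero_surjective : Function.Surjective (valueAtZero K N) :=
  fun v => ⟨_, valueAtZero_constField v⟩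

variable (K N) in
/-- The divergence-free fields that vanish at the origin. -/
def vanishing : LieSubalgebra K (svect K N) where
  toSubmodule := LinearMap.ker (valueAtZero K N)
  lie_mem' {D E} hD hE := by
    have hD' (j : ι) : constTerm K N ((D : Der K N) (X j)) = 0 := congrFun hD j
    have hE' (j : ι) : constTerm K N ((E : Der K N) (X j)) = 0 := congrFun hE j
    refine LinearMap.mem_ker.2 (funext fun j => ?_)
    change constTerm K N ((D : Der K N) ((E : Der K N) (X j)) -
      (E : Der K N) ((D : Der K N) (X j))) = 0
    rw [map_sub, constTerm_vect_apply D.2.1, constTerm_vect_apply E.2.1]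
    simp only [hD', hE', zero_mul, Finset.sum_const_zero, sub_zero]

theorem mem_vanishing_iff {D : svect K N} : D ∈ vanishing K N ↔ valueAtZero K N D = 0 := Iff.rfl

theorem finrank_quotient_vanishing :
    Module.finrank K (svect K N ⧸ (vanishing K N).toSubmodule) = Fintype.card ι :=
  ((valueAtZero K N).quotKerEquivOfSurjective valueAtZero_surjective).finrank_eq.trans
    (Module.finrank_fintype_fun_eq_card K)

theorem elementaryField_mem_vanishing (i j : ι) (h : i ≠ j) :
    elementaryField K N i j h ∈ vanishing K N :=
  mem_vanishing_iff.2 (funext fun _ => constTerm_elementaryField_apply i j h _)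

theorem valueAtZero_lie_elementaryField (D : svect K N) (i j : ι) (h : i ≠ j) :
    valueAtZero K N ⁅D, elementaryField K N i j h⁆ = Pi.single j (valueAtZero K N D i) := by
  funext k
  change constTerm K N ((D : Der K N) ((elementaryField K N i j h : Der K N) (X k)) -
    (elementaryField K N i j h : Der K N) ((D : Der K N) (X k))) = _
  rw [map_sub, constTerm_elementaryField_apply, sub_zero, elementaryField_X]
  obtain rfl | hk := eq_or_ne j k
  · rw [if_pos rfl, Pi.single_eq_same, valueAtZero_apply]
  · rw [if_neg hk, Pi.single_eq_of_ne hk.symm, map_zero, map_zero]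

theorem eq_top_of_vanishing_le {P : LieSubalgebra K (svect K N)} (hle : vanishing K N ≤ P)
    (hP : ∀ v, ∃ D ∈ P, valueAtZero K N D = v) : P = ⊤ := by
  refine eq_top_iff.2 fun E _ => ?_
  obtain ⟨D, hD, hDE⟩ := hP (valueAtZero K N E)
  have hsub : E - D ∈ P := hle (by rw [mem_vanishing_iff, map_sub, hDE, sub_self])
  simpa only [sub_add_cancel] using P.add_mem hsub hD

theorem exists_valueAtZero_eq_single [Nontrivial ι] {P : LieSubalgebra K (svect K N)}
    (hP : vanishing K N < P) (j : ι) (a : K) : ∃ D ∈ P, valueAtZero K N D = Pi.single j a := by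
  obtain ⟨hle, D, hD, hD'⟩ := SetLike.lt_iff_le_and_exists.1 hP
  obtain ⟨i, hi⟩ : ∃ i, valueAtZero K N D i ≠ 0 := Function.ne_iff.1 hD'
  have hoff (k : ι) (hk : i ≠ k) (b : K) : ∃ E ∈ P, valueAtZero K N E = Pi.single k b :=
    ⟨(b * (valueAtZero K N D i)⁻¹) • ⁅D, elementaryField K N i k hk⁆,
      P.smul_mem _ (P.lie_mem hD (hle (elementaryField_mem_vanishing i k hk))), by
        rw [map_smul, valueAtZero_lie_elementaryField, ← Pi.single_smul, smul_eq_mul,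
          inv_mul_cancel_right₀ hi]⟩
  obtain rfl | hj := eq_or_ne i j
  · obtain ⟨k, hk⟩ := exists_ne i
    obtain ⟨E, hE, hE'⟩ := hoff k hk.symm a
    exact ⟨⁅E, elementaryField K N k i hk⁆,
      P.lie_mem hE (hle (elementaryField_mem_vanishing k i hk)), by
        rw [valueAtZero_lie_elementaryField, hE', Pi.single_eq_same]⟩
  · exact hoff j hj a

theorem isCoatom_vanishing [Nontrivial ι] : IsCoatom (vanishing K N) := by
  refine ⟨fun htop => ?_, fun P hP => eq_top_of_vanishing_le hP.le fun v => ?_⟩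
  · obtain ⟨i⟩ : Nonempty ι := inferInstance
    have hmem : constField K N 1 ∈ vanishing K N := by rw [htop]; trivial
    rw [mem_vanishing_iff, valueAtZero_constField] at hmem
    exact one_ne_zero (congrFun hmem i)
  · choose D hD hD' using fun j => exists_valueAtZero_eq_single hP j (v j)
    refine ⟨∑ j, D j, P.toSubmodule.sum_mem fun j _ => hD j, ?_⟩
    rw [map_sum, Finset.sum_congr rfl fun j _ => hD' j, Finset.univ_sum_single]

end ValueAtZero

theorem cCochain_constField {K : Type*} [Field K] [CharP K 2] {N : Fin 5 → WithTop ℕ+}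
    (v : Fin 5 → K) (D : svect K N) : (cCochain K N).val (constField K N v) D = 0 := by
  refine Subtype.ext ?_
  change cField (constField K N v : Der K N) (D : Der K N) = 0
  rw [cField_eq]
  simp only [constField_X, Derivation.map_algebraMap, zero_mul, add_zero, zero_smul]

/-! ### Fields with constant coefficients -/

section Integration

variable {K ι : Type*} [Field K] [Fintype ι] [DecidableEq ι]

/-- The linear map `u^(r) ↦ u^(r + e_i)`, a right inverse of `∂_i`. -/
def DivPow.integrate (i : ι) : DivPow K ι →ₗ[K] DivPow K ι :=
  DivPow.lift fun r => DivPow.mon (r + Pi.single i 1)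

theorem DivPow.coeff_integrate (i : ι) (r : ι → ℕ) (f : DivPow K ι) : coeff r (integrate i f) =
    if r i = 0 then 0 else coeff (r - Pi.single i 1) f := by
  classical
  have h : (coeff r).comp (integrate i) =
      if r i = 0 then 0 else coeff (K := K) (r - Pi.single i 1) := by
    refine hom_ext fun s => ?_
    rw [LinearMap.comp_apply, integrate, lift_mon, coeff_mon]
    split_ifs with hs hr hr
    · subst hs
      simp at hr
    · subst hs
      rw [add_tsub_cancel_right, coeff_mon, if_pos rfl]
    · rfl
    · rw [coeff_mon, if_neg]
      rintro rfl
      exact hs (tsub_add_cancel_of_le (single_one_le hr))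
  rw [← LinearMap.comp_apply, h]
  split_ifs <;> rfl

variable [CharP K 2] {N : ι → WithTop ℕ+}

theorem DivPow.integrate_mem_trunc {i : ι} (hi : N i = ⊤) {f : DivPow K ι} (hf : f ∈ trunc K N) :
    integrate i f ∈ trunc K N := by
  refine map_trunc_le K (integrate i) (Subalgebra.toSubmodule (trunc K N)) (fun r hr => ?_) hf
  rw [integrate, lift_mon]
  refine mon_mem_trunc K fun j n hn => ?_
  obtain rfl | hj := eq_or_ne j i
  · exact absurd (hn.symm.trans hi) WithTop.coe_ne_top
  · simpa [hj] using hr j n hn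

/-- Integration with respect to `u_i`, which is possible in `O(m; N)` when `N_i = ∞`. -/
def integrate (i : ι) (hi : N i = ⊤) : O K N →ₗ[K] O K N :=
  ((DivPow.integrate i).comp O.val.toLinearMap).codRestrict
    (Subalgebra.toSubmodule (DivPow.trunc K N)) fun f => DivPow.integrate_mem_trunc hi (O.val_mem f)

theorem coeff_integrate {i : ι} (hi : N i = ⊤) (r : ι → ℕ) (f : O K N) :
    DivPow.coeff r (O.val (integrate i hi f)) =
      if r i = 0 then 0 else DivPow.coeff (r - Pi.single i 1) (O.val f) :=
  DivPow.coeff_integrate i r _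

theorem pd_integrate_self {i : ι} (hi : N i = ⊤) (f : O K N) : pd i (integrate i hi f) = f := by
  refine O.ext (DivPow.ext_coeff fun r => ?_)
  rw [pd_val, DivPow.coeff_pd, coeff_integrate, if_neg (by simp), add_tsub_cancel_right]

theorem pd_integrate {i j : ι} (hi : N i = ⊤) (hij : i ≠ j) (f : O K N) :
    pd j (integrate i hi f) = integrate i hi (pd j f) := by
  refine O.ext (DivPow.ext_coeff fun r => ?_)
  rw [pd_val, DivPow.coeff_pd, coeff_integrate, coeff_integrate, pd_val, DivPow.coeff_pd]
  simp only [Pi.add_apply, Pi.single_eq_of_ne hij, add_zero]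
  split_ifs with hr
  · rfl
  · rw [tsub_add_eq_add_tsub (single_one_le hr)]

theorem constField_pd (v : ι → K) (j : ι) (f : O K N) :
    (constField K N v : Der K N) (pd j f) = pd j ((constField K N v : Der K N) f) := by
  simp only [constField_apply, map_sum, Derivation.map_smul, pd_comm j]

theorem constField_integrate {i : ι} (hi : N i = ⊤) (v : ι → K) (f : O K N) :
    (constField K N v : Der K N) (integrate i hi f) =
      v i • f + integrate i hi ((constField K N (Function.update v i 0) : Der K N) f) := by
  rw [constField_apply, constField_apply, ← Finset.add_sum_erase _ _ (Finset.mem_univ i),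
    ← Finset.add_sum_erase _ _ (Finset.mem_univ i), pd_integrate_self, Function.update_self,
    zero_smul, zero_add, map_sum]
  refine congrArg _ (Finset.sum_congr rfl fun j hj => ?_)
  have hji := Finset.ne_of_mem_erase hj
  rw [pd_integrate hi hji.symm, Function.update_of_ne hji, map_smul]

theorem constField_update_integrate {i : ι} (hi : N i = ⊤) (v : ι → K) (f : O K N) :
    (constField K N (Function.update v i 0) : Der K N) (integrate i hi f) =
      integrate i hi ((constField K N (Function.update v i 0) : Der K N) f) := by
  rw [constField_integrate, Function.update_self, zero_smul, zero_add, Function.update_idem]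

theorem constField_pow_eq_zero (v : ι → K) {n : ℕ} {f : O K N}
    (hf : ∀ r : ι → ℕ, n ≤ ∑ i, r i → DivPow.coeff r (O.val f) = 0) :
    ((constField K N v : Der K N).toLinearMap ^ n) f = 0 := by
  induction n generalizing f with
  | zero => exact O.ext (DivPow.ext_coeff fun r => hf r (Nat.zero_le _))
  | succ n ih =>
    rw [pow_succ, Module.End.mul_apply]
    refine ih fun r hr => ?_
    change DivPow.coeff r (O.val ((constField K N v : Der K N) f)) = 0
    rw [constField_apply, map_sum, map_sum]
    refine Finset.sum_eq_zero fun i _ => ?_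
    rw [map_smul, map_smul, pd_val, DivPow.coeff_pd, hf, smul_zero]
    simpa [Finset.sum_add_distrib] using hr

theorem exists_constField_pow_eq_zero (v : ι → K) (f : O K N) :
    ∃ n, ((constField K N v : Der K N).toLinearMap ^ n) f = 0 := by
  let s : Finset (ι → ℕ) := Finsupp.support (O.val f)
  refine ⟨s.sup (fun r => ∑ i, r i) + 1, constField_pow_eq_zero v fun r hr => ?_⟩
  by_contra hne
  exact absurd (Finset.le_sup (f := fun r : ι → ℕ => ∑ i, r i) (Finsupp.mem_support_iff.2 hne))
    (Nat.not_le.2 hr)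

theorem constField_surjective {v : ι → K} {i : ι} (hi : N i = ⊤) (hv : v i ≠ 0) :
    Function.Surjective (constField K N v : Der K N) := by
  -- With `L = constField v`, `E = L - v_i ∂_i` and `I` the integration: `L I = v_i + I E`,
  -- and `E` is locally nilpotent and commutes with `I`.
  set E := (constField K N (Function.update v i 0) : Der K N).toLinearMap with hE
  have hcomm (n : ℕ) (f : O K N) : (E ^ n) (integrate i hi f) = integrate i hi ((E ^ n) f) := by
    induction n with
    | zero => rfl
    | succ n ih =>
      rw [pow_succ', Module.End.mul_apply, Module.End.mul_apply, ih]
      exact constField_update_integrate hi v _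
  have hmem (n : ℕ) (f : O K N) (hf : (E ^ n) f = 0) :
      f ∈ LinearMap.range (constField K N v : Der K N).toLinearMap := by
    induction n generalizing f with
    | zero => exact (show f = 0 from hf) ▸ zero_mem _
    | succ n ih =>
      have hrec : integrate i hi (E f) ∈ LinearMap.range (constField K N v : Der K N).toLinearMap :=
        ih _ (by rw [hcomm, ← Module.End.mul_apply, ← Module.End.mul_apply, mul_assoc, ← pow_succ,
          Module.End.mul_apply, hf, map_zero])
      have hf' : v i • f =
          (constField K N v : Der K N) (integrate i hi f) - integrate i hi (E f) := by
        rw [constField_integrate, hE]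
        exact (add_sub_cancel_right _ _).symm
      rw [← (Submodule.smul_mem_iff _ hv), hf']
      exact sub_mem (LinearMap.mem_range_self _ (integrate i hi f)) hrec
  intro f
  obtain ⟨n, hn⟩ := exists_constField_pow_eq_zero (Function.update v i 0) f
  exact hmem n f hn

end Integration

section Potential

variable {K ι : Type*} [Field K] [CharP K 2] [Fintype ι] [DecidableEq ι] {N : ι → WithTop ℕ+}

theorem div_smul_pd (f : O K N) (i : ι) : div (f • (pd i : Der K N)) = pd i f := by
  simp only [div, smul_pd_X]
  rw [Finset.sum_eq_single i (fun k _ hk => by rw [if_neg hk.symm, map_zero])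
    fun h => absurd (Finset.mem_univ i) h, if_pos rfl]

/-- The divergence-free field `∂_j h ∂_i + ∂_i h ∂_j` with potential `h`. -/
def potField (i j : ι) (h : O K N) : svect K N :=
  ⟨pd j h • pd i + pd i h • pd j,
    (vect K N).add_mem (smul_pd_mem_vect _ _) (smul_pd_mem_vect _ _), by
    have hadd (D E : Der K N) : div (D + E) = div D + div E := by
      simp only [div, Derivation.add_apply, map_add, Finset.sum_add_distrib]
    rw [hadd, div_smul_pd, div_smul_pd, pd_comm i j, CharTwo.add_self_eq_zero]⟩

theorem potField_X (i j k : ι) (h : O K N) : (potField i j h : Der K N) (X k) =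
    (if i = k then pd j h else 0) + if j = k then pd i h else 0 :=
  congrArg₂ (· + ·) (smul_pd_X _ _ _) (smul_pd_X _ _ _)

theorem sum_potField_X (i m : ι) (h : ι → O K N) :
    ((∑ j, potField i j (h j) : svect K N) : Der K N) (X m) =
      (if i = m then ∑ j, pd j (h j) else 0) + pd i (h m) := by
  let coord : svect K N →ₗ[K] O K N :=
    { toFun D := (D : Der K N) (X m)
      map_add' _ _ := rfl
      map_smul' _ _ := rfl }
  change coord (∑ j, potField i j (h j)) = _
  rw [map_sum]
  change ∑ j, (potField i j (h j) : Der K N) (X m) = _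
  simp only [potField_X, Finset.sum_add_distrib, Finset.sum_ite_eq', Finset.mem_univ, if_true]
  split_ifs <;> simp only [Finset.sum_const_zero]

theorem eq_sum_potField {i k : ι} (hi : N i = ⊤) (hk : N k = ⊤) (hik : i ≠ k) (D : svect K N) :
    D = ∑ j, potField i j (integrate i hi ((D : Der K N) (X j))) +
      potField i k (integrate k hk (∑ j, pd j (integrate i hi ((D : Der K N) (X j))))) := by
  have hdiv : ∑ j, pd j ((D : Der K N) (X j)) = 0 := D.2.2
  have hcurl : pd i (∑ j, pd j (integrate i hi ((D : Der K N) (X j)))) = 0 := by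
    simp only [map_sum, pd_comm i, pd_integrate_self, hdiv]
  refine svect_ext fun m => Eq.symm
    ((congrArg₂ (· + ·) (sum_potField_X i m _) (potField_X i k m _)).trans ?_)
  rw [pd_integrate_self, pd_integrate_self, pd_integrate hk hik.symm,
    hcurl, map_zero, ite_self, add_zero, add_right_comm, CharTwo.add_self_eq_zero, zero_add]

theorem ad_constField_surjective {i k l : ι} (hi : N i = ⊤) (hk : N k = ⊤) (hik : i ≠ k)
    (hl : N l = ⊤) {v : ι → K} (hv : v l ≠ 0) :
    Function.Surjective (LieAlgebra.ad K (svect K N) (constField K N v)) := by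
  have hpot (j : ι) (h : O K N) :
      potField i j h ∈ LinearMap.range (LieAlgebra.ad K (svect K N) (constField K N v)) := by
    obtain ⟨g, rfl⟩ := constField_surjective hl hv h
    refine ⟨potField i j g, svect_ext fun m => ?_⟩
    rw [LieAlgebra.ad_apply, lie_constField_X, potField_X, potField_X, map_add]
    split_ifs <;> simp only [constField_pd, map_zero]
  intro D
  rw [← LinearMap.mem_range, eq_sum_potField hi hk hik D]
  exact add_mem (sum_mem fun j _ => hpot _ _) (hpot _ _)

theorem exists_ad_constField_pow_eq_zero (v : ι → K) (D : svect K N) :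
    ∃ n, (LieAlgebra.ad K (svect K N) (constField K N v) ^ n) D = 0 := by
  have hpow (n : ℕ) (j : ι) :
      (((LieAlgebra.ad K (svect K N) (constField K N v) ^ n) D : svect K N) : Der K N) (X j) =
        ((constField K N v : Der K N).toLinearMap ^ n) ((D : Der K N) (X j)) := by
    induction n with
    | zero => rfl
    | succ n ih =>
      rw [pow_succ', pow_succ', Module.End.mul_apply, Module.End.mul_apply, ← ih]
      exact lie_constField_X v _ j
  choose n hn using fun j => exists_constField_pow_eq_zero v ((D : Der K N) (X j))
  refine ⟨∑ j, n j, svect_ext fun j => ?_⟩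
  rw [hpow, Module.End.pow_map_zero_of_le
    (Finset.single_le_sum (fun _ _ => Nat.zero_le _) (Finset.mem_univ j)) (hn j)]
  rfl

end Potential

/-! ### Subalgebras of codimension five -/

section LinearAlgebra

variable {K L : Type*} [Field K] [AddCommGroup L] [Module K L]

theorem eq_top_of_surjective_of_locally_nilpotent {P : Submodule K L} [FiniteDimensional K (L ⧸ P)]
    {T : L →ₗ[K] L} (hP : P ≤ P.comap T) (hs : Function.Surjective T)
    (hn : ∀ x, ∃ n, (T ^ n) x = 0) : P = ⊤ := by
  have hsurj : Function.Surjective (P.mapQ P T hP) := fun y => by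
    obtain ⟨y, rfl⟩ := P.mkQ_surjective y
    obtain ⟨x, rfl⟩ := hs y
    exact ⟨P.mkQ x, rfl⟩
  have hinj := LinearMap.injective_iff_surjective.2 hsurj
  have hback {x : L} (hx : T x ∈ P) : x ∈ P := by
    rw [← Submodule.Quotient.mk_eq_zero] at hx ⊢
    exact hinj (hx.trans (map_zero _).symm)
  have hback_pow (n : ℕ) {x : L} (hx : (T ^ n) x ∈ P) : x ∈ P := by
    induction n with
    | zero => exact hx
    | succ n ih =>
      rw [pow_succ', Module.End.mul_apply] at hx
      exact ih (hback hx)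
  refine eq_top_iff.2 fun x _ => ?_
  obtain ⟨n, hx⟩ := hn x
  exact hback_pow n (hx ▸ P.zero_mem)

theorem exists_add_mem_of_finrank_quotient_eq {V : Type*} [AddCommGroup V] [Module K V]
    [FiniteDimensional K V] {P : Submodule K L} [FiniteDimensional K (L ⧸ P)] {f : V →ₗ[K] L}
    (hf : ∀ v, f v ∈ P → v = 0) (h : Module.finrank K (L ⧸ P) = Module.finrank K V) (x : L) :
    ∃ v, x + f v ∈ P := by
  have hinj : Function.Injective (P.mkQ ∘ₗ f) :=
    (injective_iff_map_eq_zero _).2 fun v hv => hf v ((Submodule.Quotient.mk_eq_zero P).1 hv)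
  obtain ⟨v, hv⟩ := (LinearMap.injective_iff_surjective_of_finrank_eq_finrank h.symm).1 hinj
    (P.mkQ (-x))
  refine ⟨v, (Submodule.Quotient.mk_eq_zero P).1 ?_⟩
  change P.mkQ x + (P.mkQ ∘ₗ f) v = 0
  rw [hv, map_neg, add_neg_cancel]

theorem finrank_quotient_comap {L' : Type*} [AddCommGroup L'] [Module K L'] (e : L ≃ₗ[K] L')
    (P : Submodule K L') :
    Module.finrank K (L ⧸ P.comap (e : L →ₗ[K] L')) = Module.finrank K (L' ⧸ P) :=
  (Submodule.Quotient.equiv _ _ e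
    (Submodule.map_comap_eq_of_surjective e.surjective _)).finrank_eq

end LinearAlgebra

theorem eq_top_of_lie_constField_mem {K ι : Type*} [Field K] [CharP K 2] [Fintype ι]
    [DecidableEq ι] {N : ι → WithTop ℕ+} {i k l : ι} (hi : N i = ⊤) (hk : N k = ⊤) (hik : i ≠ k)
    (hl : N l = ⊤) {v : ι → K} (hv : v l ≠ 0) {P : Submodule K (svect K N)}
    [FiniteDimensional K (svect K N ⧸ P)] (hP : ∀ D ∈ P, ⁅constField K N v, D⁆ ∈ P) : P = ⊤ :=
  eq_top_of_surjective_of_locally_nilpotent (T := LieAlgebra.ad K _ (constField K N v)) hP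
    (ad_constField_surjective hi hk hik hl hv) (exists_ad_constField_pow_eq_zero v)

section Codimension

variable {K : Type*} [Field K] [CharP K 2]

theorem lie_add_cCochain_elementaryField {N : Fin 5 → WithTop ℕ+} {D E : svect K N}
    {v w : Fin 5 → K} (hD : D = elementaryField K N 1 3 (by decide) + constField K N v)
    (hE : E = elementaryField K N 2 4 (by decide) + constField K N w) :
    ⁅D, E⁆ + (cCochain K N).val D E = constField K N ![1, 0, 0, -w 1, v 2] := by
  have hDX (k : Fin 5) : (D : Der K N) (X k) =
      (if 3 = k then X 1 else 0) + algebraMap K (O K N) (v k) := by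
    rw [hD, ← elementaryField_X 1 3 k (by decide), ← constField_X]
    rfl
  have hEX (k : Fin 5) : (E : Der K N) (X k) =
      (if 4 = k then X 2 else 0) + algebraMap K (O K N) (w k) := by
    rw [hE, ← elementaryField_X 2 4 k (by decide), ← constField_X]
    rfl
  have h3 : cField (D : Der K N) E (X 3) = 0 := cField_X_natAdd _ _ 0
  have h4 : cField (D : Der K N) E (X 4) = 0 := cField_X_natAdd _ _ 1
  refine svect_ext fun k => ?_
  change ((D : Der K N) ((E : Der K N) (X k)) - (E : Der K N) ((D : Der K N) (X k))) +
    cField (D : Der K N) (E : Der K N) (X k) = _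
  rw [constField_X]
  fin_cases k
  · simp [cField_X_zero, hDX, hEX, pd_X]
  · simp [cField_X_one, hDX, hEX, pd_X]
  · simp [cField_X_two, hDX, hEX, pd_X]
  · simp [h3, hDX, hEX]
  · simp [h4, hDX, hEX]

theorem finrank_quotient_ne_five {P : Submodule K (svect K Ninf)}
    (hP : ∀ D ∈ P, ∀ E ∈ P, ⁅D, E⁆ + (cCochain K Ninf).val D E ∈ P) :
    Module.finrank K (svect K Ninf ⧸ P) ≠ 5 := by
  intro h5
  have hfin : FiniteDimensional K (svect K Ninf ⧸ P) := Module.finite_of_finrank_pos (by omega)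
  have hP_ne_top : P ≠ ⊤ := by
    rintro rfl
    rw [Module.finrank_zero_of_subsingleton] at h5
    omega
  have hconst (v : Fin 5 → K) (hv : constField K Ninf v ∈ P) : v = 0 := by
    by_contra hne
    obtain ⟨l, hl⟩ := Function.ne_iff.1 hne
    refine hP_ne_top (eq_top_of_lie_constField_mem (i := (0 : Fin 5)) (k := 1) rfl rfl
      (by decide) rfl hl fun D hD => ?_)
    simpa only [cCochain_constField, add_zero] using hP _ hv D hD
  have hadd := exists_add_mem_of_finrank_quotient_eq hconst
    (h5.trans (Module.finrank_fin_fun K).symm)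
  obtain ⟨v, hv⟩ := hadd (elementaryField K Ninf 1 3 (by decide))
  obtain ⟨w, hw⟩ := hadd (elementaryField K Ninf 2 4 (by decide))
  have hbracket := hP _ hv _ hw
  rw [lie_add_cCochain_elementaryField rfl rfl] at hbracket
  exact one_ne_zero (congrFun (hconst _ hbracket) 0)

theorem finrank_quotient_FMb_ne_five (M : LieSubalgebra K (FMb K Ninf)) :
    Module.finrank K (FMb K Ninf ⧸ M.toSubmodule) ≠ 5 := by
  rw [(Submodule.Quotient.equiv M.toSubmodule (M.toSubmodule.map (phi K Ninf))
    (phiEquiv K Ninf) rfl).finrank_eq]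
  refine finrank_quotient_ne_five ?_
  rintro _ ⟨D, hD, rfl⟩ _ ⟨E, hE, rfl⟩
  exact ⟨⁅D, E⁆, M.lie_mem hD hE, phi_lie D E⟩

theorem isEmpty_FMb_equiv_svect : IsEmpty (FMb K Ninf ≃ₗ⁅K⁆ svect K Ninf) :=
  ⟨fun e => finrank_quotient_FMb_ne_five
    ((vanishing K Ninf).comap (e : FMb K Ninf →ₗ⁅K⁆ svect K Ninf))
    ((finrank_quotient_comap e.toLinearEquiv _).trans finrank_quotient_vanishing)⟩

end Codimension

end

end CharTwo5

theorem mainTheorem1_general (K : Type*) [Field K] [CharP K 2] :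
    (∀ N : Fin 5 → WithTop ℕ+,
      (∃ φ : CharTwo5.FMb K N ≃ₗ[K] CharTwo5.svect K N,
        (∀ D : CharTwo5.FMb K N,
          ((φ D : CharTwo5.svect K N) : CharTwo5.Der K N) =
            ∑ i, CharTwo5.mbFun (D : CharTwo5.Der K (CharTwo5.tildeN N)) i • CharTwo5.pd i) ∧
        (∀ D E : CharTwo5.FMb K N,
          φ ⁅D, E⁆ = ⁅φ D, φ E⁆ + (CharTwo5.cCochain K N).val (φ D) (φ E)) ∧
        (∃ Φ : CharTwo5.FMb K N →ₗ⁅K⁆ CharTwo5.FKle K N,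
          Function.Injective Φ ∧ ∀ D, Φ D = CharTwo5.psi K N (φ D))) ∧
      CharTwo5.cCochain K N ∈
        LieModule.Cohomology.twoCocycle K (CharTwo5.svect K N) (CharTwo5.svect K N) ∧
      CharTwo5.cCochain K N ∉ LinearMap.range
        (LieModule.Cohomology.d₁₂ K (CharTwo5.svect K N) (CharTwo5.svect K N)) ∧
      Function.Injective (CharTwo5.psi K N) ∧
      (∀ D E : CharTwo5.svect K N, ⁅CharTwo5.psi K N D, CharTwo5.psi K N E⁆ =
        CharTwo5.psi K N (⁅D, E⁆ + (CharTwo5.cCochain K N).val D E))) ∧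
    (∀ M : LieSubalgebra K (CharTwo5.FMb K CharTwo5.Ninf),
      Module.finrank K (CharTwo5.FMb K CharTwo5.Ninf ⧸ M.toSubmodule) ≠ 5) ∧
    (∀ N : Fin 5 → WithTop ℕ+, ∃ M : LieSubalgebra K (CharTwo5.svect K N), IsCoatom M ∧
      Module.finrank K (CharTwo5.svect K N ⧸ M.toSubmodule) = 5) ∧
    IsEmpty (CharTwo5.FMb K CharTwo5.Ninf ≃ₗ⁅K⁆ CharTwo5.svect K CharTwo5.Ninf) :=
  ⟨fun N => ⟨⟨CharTwo5.phiEquiv K N, CharTwo5.coe_phi, CharTwo5.phi_lie,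
      CharTwo5.psiPhi K N, CharTwo5.psi_injective.comp CharTwo5.phi_injective, fun _ => rfl⟩,
    CharTwo5.cCochain_mem_twoCocycle, CharTwo5.cCochain_not_coboundary,
    CharTwo5.psi_injective, CharTwo5.psi_lie⟩,
    CharTwo5.finrank_quotient_FMb_ne_five,
    fun N => ⟨CharTwo5.vanishing K N, CharTwo5.isCoatom_vanishing,
      CharTwo5.finrank_quotient_vanishing⟩,
    CharTwo5.isEmpty_FMb_equiv_svect⟩

theorem mainTheorem1 (K : Type*) [Field K] [IsAlgClosed K] [CharP K 2] :
    (∀ N : Fin 5 → WithTop ℕ+,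
      (∃ φ : CharTwo5.FMb K N ≃ₗ[K] CharTwo5.svect K N,
        (∀ D : CharTwo5.FMb K N,
          ((φ D : CharTwo5.svect K N) : CharTwo5.Der K N) =
            ∑ i, CharTwo5.mbFun (D : CharTwo5.Der K (CharTwo5.tildeN N)) i • CharTwo5.pd i) ∧
        (∀ D E : CharTwo5.FMb K N,
          φ ⁅D, E⁆ = ⁅φ D, φ E⁆ + (CharTwo5.cCochain K N).val (φ D) (φ E)) ∧
        (∃ Φ : CharTwo5.FMb K N →ₗ⁅K⁆ CharTwo5.FKle K N,
          Function.Injective Φ ∧ ∀ D, Φ D = CharTwo5.psi K N (φ D))) ∧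
      CharTwo5.cCochain K N ∈
        LieModule.Cohomology.twoCocycle K (CharTwo5.svect K N) (CharTwo5.svect K N) ∧
      CharTwo5.cCochain K N ∉ LinearMap.range
        (LieModule.Cohomology.d₁₂ K (CharTwo5.svect K N) (CharTwo5.svect K N)) ∧
      Function.Injective (CharTwo5.psi K N) ∧
      (∀ D E : CharTwo5.svect K N, ⁅CharTwo5.psi K N D, CharTwo5.psi K N E⁆ =
        CharTwo5.psi K N (⁅D, E⁆ + (CharTwo5.cCochain K N).val D E))) ∧
    (¬ ∃ M : LieSubalgebra K (CharTwo5.FMb K CharTwo5.Ninf), IsCoatom M ∧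
      Module.finrank K (CharTwo5.FMb K CharTwo5.Ninf ⧸ M.toSubmodule) = 5) ∧
    (∃ M : LieSubalgebra K (CharTwo5.svect K CharTwo5.Ninf), IsCoatom M ∧
      Module.finrank K (CharTwo5.svect K CharTwo5.Ninf ⧸ M.toSubmodule) = 5) ∧
    IsEmpty (CharTwo5.FMb K CharTwo5.Ninf ≃ₗ⁅K⁆ CharTwo5.svect K CharTwo5.Ninf) := by
  obtain ⟨hdeform, hFMb, hsvect, hiso⟩ := mainTheorem1_general K
  exact ⟨hdeform, fun ⟨M, _, hM⟩ => hFMb M hM, hsvect CharTwo5.Ninf, hiso⟩
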